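/- **Setting.** Let $G=(V,E)$ be a finite simple graph with $n=|V|$, $m=|E|$ and maximum degree $\Delta$. For $S\subseteq V$ let $\rho(S)=|E(G[S])|/|S|$, and let $\rho^*=\max_{S}\rho(S)$. **ParallelGreedy++.** Start with loads $\ell(v)=0$ for all $v$ and $S=V$, and perform $T$ iterations. One iteration does the following. 1. *Parallel peeling order.* Let $R=V$ and $d=0$. While $R\neq\emptyset$: let $B=\{v\in R:\ \ell(v)+\deg_{G[R]}(v)\le d\}$; if $B\ne\emptyset$, peel all of $B$ at once ($R\leftarrow R\setminus B$; this is one peeling round), otherwise $d\leftarrow d+1$. List the vertices as $v_1,\dots,v_n$ in the order of the rounds, the vertices of one round in arbitrary order. Let $c_p$, the peeling complexity of this iteration, be the number of peeling rounds. 2. *Update.* Let $H_i=\{v_i,\dots,v_n\}$. Set $\ell(v_i)\leftarrow \ell(v_i)+\deg_{G[H_i]}(v_i)$ for all $i$. If $\max_i\rho(H_i)>\rho(S)$, replace $S$ by some $H_i$ of maximum density. The output is $S$ after $T$ iterations. **Theorem.** (a) There is an absolute constant $C>0$ such that for every $G$, every $0<\varepsilon<1$, every integer $T\ge C\,\frac{\Delta\log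 n}{\rho^*\varepsilon^2}$ and every run of ParallelGreedy++ for $T$ iterations (whatever the order within the rounds), the output $S$ satisfies $\rho^*\le(1+\varepsilon)\,\rho(S)$. In particular $T=\Theta\!\left(\frac{\Delta\log n}{\rho^*\varepsilon^2}\right)$ iterations suffice for a $(1+\varepsilon)$-approximation. (b) Let $n\ge 2$. In the randomized work-depth model (shared memory with words of $O(\log(n+m+T))$ bits; parallel loops; concurrent reads, concurrent writes and atomic fetch-and-add at unit work and depth, where the atomic operations of one parallel step take effect in an adversarial order; independent uniform random words), there is a fixed program for the loop body with the following property. Started on adjacency lists of $G$ and otherwise zero memory and executed $T$ times, it almost surely performs a run of ParallelGreedy++, the loads and the current best $S$ being held in memory after each iteration. Each iteration takes $O(n+m)$ expected work. For every $a\ge1$, each iteration has depth $O_a(c_p\log n)$ with probability at least $1-n^{-a}$, where $c_p$ is the peeling complexity of that iteration. -/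

import Mathlib

open MeasureTheory

namespace ParGreedy

section Algorithm

/-! ### Densities and the algorithm ParallelGreedy++ -/

variable {V : Type*} [Fintype V] [DecidableEq V]

/-- The density `|E(S)| / |S|` of the subgraph of `G` induced by `S`. -/
noncomputable def density (G : SimpleGraph V) [DecidableRel G.Adj] (S : Finset V) : ℝ :=
  ((G.edgeFinset ∩ S.sym2).card : ℝ) / (S.card : ℝ)

/-- The maximum density `ρ*` of an induced subgraph of `G`. -/
noncomputable def maxDensity (G : SimpleGraph V) [DecidableRel G.Adj] : ℝ :=
  ⨆ S : Finset V, density G S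

/-- The number of neighbours of `v` in the vertex set `R`. -/
def degIn (G : SimpleGraph V) [DecidableRel G.Adj] (R : Finset V) (v : V) : ℕ :=
  (R.filter (fun u => G.Adj v u)).card

/-- The vertices `v` of the remaining graph `R` with `ℓ(v) + deg_R(v) ≤ d`. -/
def below (G : SimpleGraph V) [DecidableRel G.Adj] (ℓ : V → ℕ) (R : Finset V) (d : ℕ) :
    Finset V :=
  R.filter (fun v => ℓ v + degIn G R v ≤ d)

/-- `PeelRounds G ℓ R d Bs`: peeling the remaining graph `R`, starting with threshold `d`, removes
the batches `Bs` one after another. All vertices that are at most the threshold are peeled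
simultaneously; the threshold is incremented when there are none. -/
inductive PeelRounds (G : SimpleGraph V) [DecidableRel G.Adj] (ℓ : V → ℕ) :
    Finset V → ℕ → List (Finset V) → Prop
  | done (d : ℕ) : PeelRounds G ℓ ∅ d []
  | peel {R : Finset V} {d : ℕ} {Bs : List (Finset V)} :
      (below G ℓ R d).Nonempty → PeelRounds G ℓ (R \ below G ℓ R d) d Bs →
      PeelRounds G ℓ R d (below G ℓ R d :: Bs)
  | raise {R : Finset V} {d : ℕ} {Bs : List (Finset V)} :
      R.Nonempty → below G ℓ R d = ∅ → PeelRounds G ℓ R (d + 1) Bs →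
      PeelRounds G ℓ R d Bs

/-- `ord` lists the vertices batch by batch in the order of the parallel peeling for the loads `ℓ`,
the vertices of one batch in an arbitrary order; `c` is the number of peeling rounds, the peeling
complexity. -/
def IsPeelingOrder (G : SimpleGraph V) [DecidableRel G.Adj] (ℓ : V → ℕ) (ord : List V) (c : ℕ) :
    Prop :=
  ∃ Ls : List (List V), PeelRounds G ℓ Finset.univ 0 (Ls.map List.toFinset) ∧
    (∀ L ∈ Ls, L.Nodup) ∧ Ls.flatten = ord ∧ Ls.length = c

/-- The vertices that remain after the first `i` vertices of `ord` have been peeled. -/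
def rest (ord : List V) (i : ℕ) : Finset V := (ord.drop i).toFinset

/-- One iteration of ParallelGreedy++ takes loads `ℓ` and best subgraph `S` to `ℓ'` and `S'`, with
peeling complexity `c`: a parallel peeling order is computed, the vertices are peeled along it, the
load of a vertex grows by its degree at the moment when it is peeled, and `S` is replaced by a
densest one among the graphs that remain on the way if that is denser than `S`. -/
def Iteration (G : SimpleGraph V) [DecidableRel G.Adj] (ℓ : V → ℕ) (S : Finset V)
    (ℓ' : V → ℕ) (S' : Finset V) (c : ℕ) : Prop :=
  ∃ ord : List V, IsPeelingOrder G ℓ ord c ∧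
    (∀ v, ℓ' v = ℓ v + degIn G (rest ord (ord.idxOf v)) v) ∧
    ((S' = S ∧ ∀ i < ord.length, density G (rest ord i) ≤ density G S) ∨
      (∃ i < ord.length, S' = rest ord i ∧ density G S < density G S' ∧
        ∀ j < ord.length, density G (rest ord j) ≤ density G S'))

/-- A run of `T` iterations of ParallelGreedy++ on `G`. Iteration `t` (counted from `0`) leads from
the loads `ℓ t` and best subgraph `S t` to `ℓ (t + 1)` and `S (t + 1)`, and has peeling
complexity `c t`. The output is `S T`. -/
def IsRun (G : SimpleGraph V) [DecidableRel G.Adj] (T : ℕ) (ℓ : ℕ → V → ℕ) (S : ℕ → Finset V)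
    (c : ℕ → ℕ) : Prop :=
  ℓ 0 = (fun _ => 0) ∧ S 0 = Finset.univ ∧
    ∀ t < T, Iteration G (ℓ t) (S t) (ℓ (t + 1)) (S (t + 1)) (c t)

end Algorithm

section Machine

/-! ### The work-depth model

A randomized parallel random access machine with shared memory and `w`-bit words. A program is a
sequential control structure over parallel steps. In a parallel step any number of threads, forked
by nested parallel loops, first read the shared memory and compute; then each performs a concurrent
write or an atomic fetch-and-add. The atomic operations of one step take effect in an order that is
chosen by an adversary. -/

/-- The shared memory: arrays (numbered by constants of the program) of words. -/
abbrev Mem := ℕ → ℕ → ℕ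

/-- Binary word operations; comparisons yield `0` or `1`, subtraction is truncated at `0`. -/
inductive Op
  | add | sub | mul | div | mod | lt | eq

/-- The value of a binary word operation. -/
def Op.eval : Op → ℕ → ℕ → ℕ
  | .add, x, y => x + y
  | .sub, x, y => x - y
  | .mul, x, y => x * y
  | .div, x, y => x / y
  | .mod, x, y => x % y
  | .lt, x, y => if x < y then 1 else 0
  | .eq, x, y => if x = y then 1 else 0

/-- Expressions: constants, the index of the `k`-th innermost enclosing parallel loop, reading cell
`i` of array `a`, reading the `i`-th random word, and binary operations. -/
inductive Expr
  | const (k : ℕ)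
  | idx (k : ℕ)
  | read (a : ℕ) (i : Expr)
  | rnd (i : Expr)
  | op (o : Op) (x y : Expr)

/-- The number of operations that evaluate an expression, also its (sequential) depth. -/
def Expr.size : Expr → ℕ
  | .const _ => 1
  | .idx _ => 1
  | .read _ i => i.size + 1
  | .rnd i => i.size + 1
  | .op _ x y => x.size + y.size + 1

/-- The value of an expression, for the random words `ω`, the loop indices `env` and the
memory `M`. -/
def Expr.eval {w : ℕ} (ω : ℕ → Fin (2 ^ w)) (env : List ℕ) (M : Mem) : Expr → ℕ
  | .const k => k
  | .idx k => env.getD k 0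
  | .read a i => M a (i.eval ω env M)
  | .rnd i => (ω (i.eval ω env M) : ℕ)
  | .op o x y => o.eval (x.eval ω env M) (y.eval ω env M)

/-- Atomic operations. `write a i v` stores `v` in cell `i` of array `a`; `fetchAdd a i v b j` adds
`v` to cell `i` of array `a` and delivers the previous content of that cell in cell `j` of
array `b`. -/
inductive Req
  | write (a i v : ℕ)
  | fetchAdd (a i v b j : ℕ)

/-- Store a value, cut to `w` bits. -/
def store (w : ℕ) (M : Mem) (a i v : ℕ) : Mem :=
  fun a' i' => if a' = a ∧ i' = i then v % 2 ^ w else M a' i'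

/-- The effect of an atomic operation. -/
def Req.apply (w : ℕ) (M : Mem) : Req → Mem
  | .write a i v => store w M a i v
  | .fetchAdd a i v b j => store w (store w M a i (M a i + v)) b j (M a i)

/-- Parallel steps: nothing, one atomic operation, a case distinction (`q` if `c` is zero, otherwise
`p`), two branches in parallel, and the parallel loop over all indices `i < N`. -/
inductive Par
  | skip
  | write (a : ℕ) (i v : Expr)
  | fetchAdd (a : ℕ) (i v : Expr) (b : ℕ) (j : Expr)
  | cond (c : Expr) (p q : Par)
  | both (p q : Par)
  | parfor (N : Expr) (p : Par)

/-- The atomic operations that the threads of a parallel step issue. -/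
def Par.reqs {w : ℕ} (ω : ℕ → Fin (2 ^ w)) (M : Mem) : Par → List ℕ → List Req
  | .skip, _ => []
  | .write a i v, env => [.write a (i.eval ω env M) (v.eval ω env M)]
  | .fetchAdd a i v b j, env =>
      [.fetchAdd a (i.eval ω env M) (v.eval ω env M) b (j.eval ω env M)]
  | .cond c p q, env => if c.eval ω env M = 0 then q.reqs ω M env else p.reqs ω M env
  | .both p q, env => p.reqs ω M env ++ q.reqs ω M env
  | .parfor N p, env => (List.range (N.eval ω env M)).flatMap (fun i => p.reqs ω M (i :: env))

/-- The work of a parallel step: the total number of operations of all threads. -/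
def Par.work {w : ℕ} (ω : ℕ → Fin (2 ^ w)) (M : Mem) : Par → List ℕ → ℕ
  | .skip, _ => 1
  | .write _ i v, _ => i.size + v.size + 1
  | .fetchAdd _ i v _ j, _ => i.size + v.size + j.size + 1
  | .cond c p q, env =>
      c.size + 1 + if c.eval ω env M = 0 then q.work ω M env else p.work ω M env
  | .both p q, env => 1 + p.work ω M env + q.work ω M env
  | .parfor N p, env =>
      N.size + 1 + ∑ i ∈ Finset.range (N.eval ω env M), p.work ω M (i :: env)

/-- The depth of a parallel step: the longest chain of operations. -/
def Par.depth {w : ℕ} (ω : ℕ → Fin (2 ^ w)) (M : Mem) : Par → List ℕ → ℕ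
  | .skip, _ => 1
  | .write _ i v, _ => i.size + v.size + 1
  | .fetchAdd _ i v _ j, _ => i.size + v.size + j.size + 1
  | .cond c p q, env =>
      c.size + 1 + if c.eval ω env M = 0 then q.depth ω M env else p.depth ω M env
  | .both p q, env => 1 + max (p.depth ω M env) (q.depth ω M env)
  | .parfor N p, env =>
      N.size + 1 + (Finset.range (N.eval ω env M)).sup (fun i => p.depth ω M (i :: env))

/-- Programs: parallel steps under sequential control. -/
inductive Cmd
  | par (p : Par)
  | seq (p q : Cmd)
  | cond (c : Expr) (p q : Cmd)
  | loop (c : Expr) (p : Cmd)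

/-- The memory, with the work and the depth spent so far. -/
structure State where
  mem : Mem
  work : ℕ
  depth : ℕ

/-- The adversary that orders the atomic operations of each parallel step, knowing the state. -/
structure Scheduler where
  order : State → List Req → List Req
  perm : ∀ s l, (order s l).Perm l

/-- The effect of a parallel step. -/
def State.step {w : ℕ} (σ : Scheduler) (ω : ℕ → Fin (2 ^ w)) (p : Par) (s : State) : State where
  mem := (σ.order s (p.reqs ω s.mem [])).foldl (Req.apply w) s.mem
  work := s.work + p.work ω s.mem []
  depth := s.depth + p.depth ω s.mem []

/-- Account for the sequential evaluation of the control expression `c`. -/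
def State.charge (s : State) (c : Expr) : State where
  mem := s.mem
  work := s.work + c.size
  depth := s.depth + c.size

/-- `Exec σ ω p s s'`: the program `p`, started in `s`, halts in `s'`. Given the adversary `σ` and
the random words `ω` this is deterministic. -/
inductive Exec {w : ℕ} (σ : Scheduler) (ω : ℕ → Fin (2 ^ w)) : Cmd → State → State → Prop
  | par (p : Par) (s : State) : Exec σ ω (.par p) s (s.step σ ω p)
  | seq {p q : Cmd} {s s' s'' : State} :
      Exec σ ω p s s' → Exec σ ω q s' s'' → Exec σ ω (.seq p q) s s''
  | condTrue {c : Expr} {p q : Cmd} {s s' : State} :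
      c.eval ω [] s.mem ≠ 0 → Exec σ ω p (s.charge c) s' → Exec σ ω (.cond c p q) s s'
  | condFalse {c : Expr} {p q : Cmd} {s s' : State} :
      c.eval ω [] s.mem = 0 → Exec σ ω q (s.charge c) s' → Exec σ ω (.cond c p q) s s'
  | loopTrue {c : Expr} {p : Cmd} {s s' s'' : State} :
      c.eval ω [] s.mem ≠ 0 → Exec σ ω p (s.charge c) s' → Exec σ ω (.loop c p) s' s'' →
      Exec σ ω (.loop c p) s s''
  | loopFalse {c : Expr} {p : Cmd} {s : State} :
      c.eval ω [] s.mem = 0 → Exec σ ω (.loop c p) s (s.charge c)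

/-- The law of the random words: independent and uniform on `w`-bit words. -/
noncomputable def coins (w : ℕ) : Measure (ℕ → Fin (2 ^ w)) :=
  Measure.infinitePi (fun _ => (PMF.uniformOfFintype (Fin (2 ^ w))).toMeasure)

/-- `adj` consists of adjacency lists of `G`, each in an arbitrary order. -/
def IsAdjacency {n : ℕ} (G : SimpleGraph (Fin n)) (adj : Fin n → List (Fin n)) : Prop :=
  ∀ v, (adj v).Nodup ∧ ∀ u, u ∈ adj v ↔ G.Adj v u

/-- The initial memory. Array `0` holds the number of vertices, array `2` the concatenated adjacency
lists, array `1` the positions where they start (and, as entry `n`, the total length). All other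
cells are zero. -/
def inputMem {n : ℕ} (adj : Fin n → List (Fin n)) : Mem
  | 0, i => if i = 0 then n else 0
  | 1, i => if i ≤ n then ((List.ofFn adj).take i).flatten.length else 0
  | 2, i => ((List.ofFn adj).flatten.map Fin.val).getD i 0
  | _, _ => 0

/-- Array `3` holds the loads, and array `4` is zero exactly on the current best subgraph. -/
def Holds {n : ℕ} (M : Mem) (ℓ : Fin n → ℕ) (S : Finset (Fin n)) : Prop :=
  ∀ v : Fin n, M 3 v = ℓ v ∧ (M 4 v = 0 ↔ v ∈ S)

end Machine

end ParGreedy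

/-!
# Approximation and parallel cost of ParallelGreedy++

**The approximation guarantee.** Along a parallel peeling order, the value `D v` of the threshold at
the removal of `v` is monotone, and `ℓ' v ≤ D v ≤ ℓ v + deg v`, where `ℓ` and `ℓ'` are the loads
before and after the iteration (`IsPeelingOrder.thresholds`). Thus, up to factors `exp (η Δ)`, the
potential `∑ v, exp (η ℓ v)` grows by `η ∑ v, exp (η D v) d v`, where `d v` is the degree of `v` at
its removal. The degrees `d v` over a suffix of the order sum up to the number of edges inside that
suffix, which is at most `λ` times its size if `λ` bounds the densities seen. As the weights
`exp (η D v)` increase along the order, summation by parts bounds the growth by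
`η λ ∑ v, exp (η D v)` (`sum_exp_mul_le`, `Iteration.potential`), so each load after `T` iterations
is at most `log n / η + (1 + O(η Δ)) T λ` (`IsRun.load_le`). On the other hand, each iteration
charges every edge inside a set `A` to a vertex of `A`, so some load in `A` is at least `T` times the
density of `A` (`IsRun.mul_card_edges_le`). A suitable `η` of order `ε / Δ` gives `approximation`.

**The implementation.** The program is deterministic: fetch-and-add hands out distinct consecutive
positions in whatever order the operations take effect (`Tickets`), which is all that list building
needs. Its correctness and costs are derived by a calculus of preconditions for total correctness
(`wp`). The key of a vertex is its load plus its degree in the remaining graph. Keys only decrease,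
so the vertices below the threshold after a round are found among the neighbours of the peeled ones,
at a cost proportional to their degrees (`wp_peelRound`).

The difficulty is to raise the threshold to the least key in logarithmic depth and with total work
linear in `n + m`, although the loads, and hence the thresholds, may be much larger than that. A key
lies in the interval `[ℓ v, ℓ v + deg v]`, and these intervals have `n + 2 m` elements in total.
Within the union of the intervals, a doubling search for the first number at which a counter of
arrivals differs from a counter of departures finds the next key (`wp_search`, `wp_advance`). At a
number outside the union, the vertices already peeled are exactly those whose interval lies below
it. By monotonicity of the thresholds, they were also peeled first in the previous iteration
(`jumpOK_next`). So the next vertex of the previous order shows where the union continues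
(`PeelInv.gap`), and a search to the left from its load finds the end of the gap (`wp_jump`). The
searches are paid for by a potential that is bounded by the total length of the intervals (`pot`,
`pot_le`). All in all, the peeling takes linear work and depth `O(c log n)` (`wp_peelLoop`).

The loads and the numbers of edges of all remaining graphs follow from sums over a binary tree
(`wp_upSweep`, `wp_downSweep`), and a tournament on the same tree finds the densest remaining graph
(`winner`, `wp_finish`). Iterating `wp_program` gives the run (`exists_run`).
-/

namespace ParGreedy

/-! ### Peeling orders and their thresholds -/

section Graph

variable {V : Type*} [Fintype V] [DecidableEq V] {G : SimpleGraph V} [DecidableRel G.Adj]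

theorem degIn_mono {R R' : Finset V} (h : R ⊆ R') (v : V) : degIn G R v ≤ degIn G R' v :=
  Finset.card_le_card (Finset.filter_subset_filter _ h)

theorem degIn_univ (v : V) : degIn G Finset.univ v = G.degree v := by
  rw [degIn, ← G.card_neighborFinset_eq_degree]
  congr 1
  ext u
  simp

theorem degIn_le_degree (R : Finset V) (v : V) : degIn G R v ≤ G.degree v :=
  (degIn_mono (Finset.subset_univ R) v).trans_eq (degIn_univ v)

/-- The handshake lemma for an induced subgraph. -/
theorem sum_degIn (S : Finset V) :
    ∑ v ∈ S, degIn G S v = 2 * (G.edgeFinset ∩ S.sym2).card := by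
  classical
  let H : SimpleGraph V :=
    { Adj := fun u v => G.Adj u v ∧ u ∈ S ∧ v ∈ S
      symm := ⟨fun u v h => ⟨h.1.symm, h.2.2, h.2.1⟩⟩
      loopless := ⟨fun u h => G.loopless.irrefl u h.1⟩ }
  have hE : H.edgeFinset = G.edgeFinset ∩ S.sym2 := by
    ext e
    induction e with
    | h u v => simp [H]
  have hd : ∀ v, H.degree v = if v ∈ S then degIn G S v else 0 := by
    intro v
    rw [← H.card_neighborFinset_eq_degree]
    split_ifs with hv
    · rw [degIn]
      congr 1
      ext u
      simp [H, hv, and_comm]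
    · rw [Finset.card_eq_zero, Finset.eq_empty_iff_forall_notMem]
      intro u hu
      simp [H, hv] at hu
  rw [← hE, ← H.sum_degrees_eq_twice_card_edges]
  simp [hd]

/-- If the vertices are ranked, every edge of an induced subgraph is counted once at its
endpoint of lower rank. -/
theorem sum_degIn_later (S : Finset V) (pos : V → ℕ) (hpos : Set.InjOn pos S) :
    ∑ v ∈ S, degIn G (S.filter (fun u => pos v < pos u)) v = (G.edgeFinset ∩ S.sym2).card := by
  have e1 : ∑ v ∈ S, degIn G (S.filter (fun u => pos v < pos u)) v =
      ∑ v ∈ S, degIn G (S.filter (fun u => pos u < pos v)) v := by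
    simp only [degIn, Finset.card_filter, Finset.sum_filter]
    rw [Finset.sum_comm]
    refine Finset.sum_congr rfl fun u _ => Finset.sum_congr rfl fun v _ => ?_
    simp [G.adj_comm]
  have e2 : ∀ v ∈ S, degIn G (S.filter (fun u => pos v < pos u)) v +
      degIn G (S.filter (fun u => pos u < pos v)) v = degIn G S v := by
    intro v hv
    rw [degIn, degIn, ← Finset.card_union_of_disjoint, degIn]
    · congr 1
      ext u
      simp only [Finset.mem_union, Finset.mem_filter]
      constructor
      · tauto
      · rintro ⟨hu, ha⟩
        have : pos v ≠ pos u := fun h => ha.ne (hpos hv hu h)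
        rcases lt_or_gt_of_ne this with h | h <;> tauto
    · rw [Finset.disjoint_left]
      intro u
      simp only [Finset.mem_filter]
      intro h h'
      exact lt_asymm h.1.2 h'.1.2
  have := sum_degIn (G := G) S
  rw [← Finset.sum_congr rfl e2, Finset.sum_add_distrib, ← e1] at this
  omega

theorem mem_rest {ord : List V} (h : ord.Nodup) {i : ℕ} {u : V} :
    u ∈ rest ord i ↔ u ∈ ord ∧ i ≤ ord.idxOf u := by
  rw [rest, List.mem_toFinset, List.mem_drop_iff_getElem]
  constructor
  · rintro ⟨j, hj, rfl⟩
    exact ⟨List.getElem_mem _, by rw [h.idxOf_getElem]; omega⟩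
  · rintro ⟨hu, hi⟩
    have := List.idxOf_lt_length_of_mem hu
    refine ⟨ord.idxOf u - i, by omega, ?_⟩
    simp [Nat.add_sub_cancel' hi]

theorem degIn_rest {ord : List V} (h : ord.Nodup) (hall : ∀ v, v ∈ ord) {S : Finset V} {v : V}
    (hS : ∀ u, ord.idxOf v < ord.idxOf u → u ∈ S) :
    degIn G (rest ord (ord.idxOf v)) v =
      degIn G (S.filter (fun u => ord.idxOf v < ord.idxOf u)) v := by
  rw [degIn, degIn]
  congr 1
  ext u
  simp only [Finset.mem_filter, mem_rest h, hall, true_and]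
  constructor
  · rintro ⟨hle, ha⟩
    have : ord.idxOf v ≠ ord.idxOf u := fun e => ha.ne ((List.idxOf_inj (hall v)).1 e)
    have hlt := lt_of_le_of_ne hle this
    exact ⟨⟨hS u hlt, hlt⟩, ha⟩
  · rintro ⟨⟨_, hlt⟩, ha⟩
    exact ⟨hlt.le, ha⟩

/-- The number of edges that remain when the first `i` vertices have been peeled. -/
theorem sum_degIn_rest {ord : List V} (h : ord.Nodup) (hall : ∀ v, v ∈ ord) (i : ℕ) :
    ∑ v ∈ rest ord i, degIn G (rest ord (ord.idxOf v)) v =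
      (G.edgeFinset ∩ (rest ord i).sym2).card := by
  rw [← sum_degIn_later (rest ord i) (fun v => ord.idxOf v)
    (fun u _ v _ e => (List.idxOf_inj (hall u)).1 e)]
  refine Finset.sum_congr rfl fun v hv => degIn_rest h hall fun u hu => ?_
  rw [mem_rest h] at hv ⊢
  exact ⟨hall u, hv.2.trans hu.le⟩

/-- Every edge inside `S` is charged to one of its endpoints by one pass of peeling. -/
theorem card_edges_le_sum_degIn_rest {ord : List V} (h : ord.Nodup) (hall : ∀ v, v ∈ ord)
    (S : Finset V) : (G.edgeFinset ∩ S.sym2).card ≤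
      ∑ v ∈ S, degIn G (rest ord (ord.idxOf v)) v := by
  rw [← sum_degIn_later S (fun v => ord.idxOf v)
    (fun u _ v _ e => (List.idxOf_inj (hall u)).1 e)]
  refine Finset.sum_le_sum fun v _ => ?_
  refine degIn_mono (fun u hu => ?_) v
  rw [Finset.mem_filter] at hu
  exact (mem_rest h).2 ⟨hall u, hu.2.le⟩

/-- The threshold `D v` of `v` is the value of the counter `d` at the round in which `v` is peeled.
The vertices of one round may be listed in any order: each of them satisfies the bound already with
the degree in the graph at the start of the round. -/
theorem peelRounds_thresholds {ℓ : V → ℕ} {R : Finset V} {d : ℕ} {Bs : List (Finset V)}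
    (h : PeelRounds G ℓ R d Bs) : (∀ v ∈ R, d ≤ ℓ v + G.degree v) →
    ∀ Ls : List (List V), Ls.map List.toFinset = Bs → (∀ L ∈ Ls, L.Nodup) →
      Ls.flatten.Nodup ∧ Ls.flatten.toFinset = R ∧
      ∃ D : V → ℕ, Ls.flatten.Pairwise (fun u v => D u ≤ D v) ∧
        ∀ v ∈ R, d ≤ D v ∧ D v ≤ ℓ v + G.degree v ∧
          ℓ v + degIn G (rest Ls.flatten (Ls.flatten.idxOf v)) v ≤ D v := by
  induction h with
  | done d =>
    intro _ Ls hLs _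
    rw [List.map_eq_nil_iff] at hLs
    subst hLs
    exact ⟨by simp, by simp, fun _ => 0, by simp, by simp⟩
  | @peel R d Bs hne _ ih =>
    intro hd Ls hLs hnd
    obtain ⟨L, Ls', rfl, hL, hLs'⟩ := List.map_eq_cons_iff.1 hLs
    obtain ⟨n1, s1, D, p1, b1⟩ := ih (fun v hv => hd v (Finset.mem_sdiff.1 hv).1) Ls' hLs'
      (fun L hL => hnd L (List.mem_cons_of_mem _ hL))
    have memL : ∀ v, v ∈ L ↔ v ∈ below G ℓ R d := fun v => by rw [← hL, List.mem_toFinset]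
    have memF : ∀ v, v ∈ Ls'.flatten ↔ v ∈ R ∧ v ∉ below G ℓ R d := fun v => by
      rw [← List.mem_toFinset, s1, Finset.mem_sdiff]
    have hsub : below G ℓ R d ⊆ R := Finset.filter_subset _ _
    have htot : (L ++ Ls'.flatten).toFinset = R := by
      ext v
      rw [List.mem_toFinset, List.mem_append, memL, memF]
      constructor
      · rintro (h | h)
        exacts [hsub h, h.1]
      · tauto
    rw [List.flatten_cons]
    refine ⟨?_, htot, fun v => if v ∈ L then d else D v, ?_, ?_⟩
    · refine (List.nodup_append'.2 ⟨hnd L (by simp), n1, ?_⟩)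
      intro v hv hv'
      exact ((memF v).1 hv').2 ((memL v).1 hv)
    · refine List.pairwise_append.2 ⟨?_, ?_, ?_⟩
      · exact List.pairwise_of_forall_mem_list fun u hu v hv => by simp [hu, hv]
      · refine p1.imp_of_mem fun {u v} hu hv huv => ?_
        rw [memF] at hu hv
        have hu' : u ∉ L := by rw [memL]; exact hu.2
        have hv' : v ∉ L := by rw [memL]; exact hv.2
        simp only [if_neg hu', if_neg hv']
        exact huv
      · intro u hu v hv
        rw [memF] at hv
        have hv' : v ∉ L := by rw [memL]; exact hv.2
        simp only [if_pos hu, if_neg hv']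
        exact (b1 v (Finset.mem_sdiff.2 hv)).1
    · intro v hv
      by_cases hvL : v ∈ L
      · simp only [if_pos hvL]
        refine ⟨le_rfl, hd v hv, ?_⟩
        have := (Finset.mem_filter.1 ((memL v).1 hvL)).2
        refine le_trans (Nat.add_le_add_left (degIn_mono ?_ v) _) this
        intro u hu
        rw [← htot, List.mem_toFinset]
        exact List.mem_of_mem_drop (List.mem_toFinset.1 hu)
      · simp only [if_neg hvL]
        have hv' : v ∈ R \ below G ℓ R d :=
          Finset.mem_sdiff.2 ⟨hv, fun h => hvL ((memL v).2 h)⟩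
        have hi : rest (L ++ Ls'.flatten) ((L ++ Ls'.flatten).idxOf v) =
            rest Ls'.flatten (Ls'.flatten.idxOf v) := by
          rw [rest, rest, List.idxOf_append_of_notMem hvL, List.drop_append,
            List.drop_of_length_le (Nat.le_add_right _ _)]
          simp
        rw [hi]
        exact b1 v hv'
  | @raise R d Bs hne he _ ih =>
    intro hd Ls hLs hnd
    obtain ⟨n1, s1, D, p1, b1⟩ := ih (fun v hv => by
      have h1 : v ∉ below G ℓ R d := by rw [he]; simp
      have h2 : ¬ ℓ v + degIn G R v ≤ d := fun h => h1 (Finset.mem_filter.2 ⟨hv, h⟩)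
      have := degIn_le_degree (G := G) R v
      omega) Ls hLs hnd
    exact ⟨n1, s1, D, p1, fun v hv => ⟨(Nat.le_succ d).trans (b1 v hv).1, (b1 v hv).2⟩⟩

/-- The thresholds `D v` at which the vertices are peeled increase along a peeling order. They lie
between the new load of a vertex and its old load plus its degree. -/
theorem IsPeelingOrder.thresholds {ℓ : V → ℕ} {ord : List V} {c : ℕ}
    (h : IsPeelingOrder G ℓ ord c) : ord.Nodup ∧ (∀ v, v ∈ ord) ∧
      ∃ D : V → ℕ, ord.Pairwise (fun u v => D u ≤ D v) ∧ ∀ v, D v ≤ ℓ v + G.degree v ∧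
        ℓ v + degIn G (rest ord (ord.idxOf v)) v ≤ D v := by
  obtain ⟨Ls, hP, hnd, rfl, rfl⟩ := h
  obtain ⟨h1, h2, D, h3, h4⟩ := peelRounds_thresholds hP (by simp) Ls rfl hnd
  refine ⟨h1, fun v => ?_, D, h3, fun v => (h4 v (Finset.mem_univ v)).2⟩
  rw [← List.mem_toFinset, h2]
  exact Finset.mem_univ v

end Graph

/-! ### The approximation guarantee -/

section Approximation

variable {V : Type*} [Fintype V] [DecidableEq V] {G : SimpleGraph V} [DecidableRel G.Adj]

theorem density_nonneg (S : Finset V) : 0 ≤ density G S := by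
  unfold density
  positivity

theorem card_edges_le_of_density_le {S : Finset V} {lam : ℝ} (h : density G S ≤ lam) :
    ((G.edgeFinset ∩ S.sym2).card : ℝ) ≤ lam * S.card := by
  rcases S.eq_empty_or_nonempty with rfl | hS
  · simp
  · have : (0 : ℝ) < S.card := by exact_mod_cast hS.card_pos
    rwa [density, div_le_iff₀ this] at h

/-- Summation by parts: monotone weights preserve the sign of nonnegative suffix sums. -/
theorem mul_sum_le_sum_mul {x c : V → ℝ} : ∀ (L : List V) (y : ℝ), (∀ v ∈ L, y ≤ x v) →
    L.Pairwise (fun u v => x u ≤ x v) → (∀ i, 0 ≤ ((L.drop i).map c).sum) →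
    y * (L.map c).sum ≤ (L.map (fun v => x v * c v)).sum
  | [], y, _, _, _ => by simp
  | a :: L, y, hy, hm, hc => by
    rw [List.pairwise_cons] at hm
    have ih := mul_sum_le_sum_mul L (x a) hm.1 hm.2 (fun i => by simpa using hc (i + 1))
    have h0 := hc 0
    simp only [List.drop_zero, List.map_cons, List.sum_cons] at h0 ⊢
    have := mul_le_mul_of_nonneg_right (hy a (by simp)) h0
    linarith

/-- If all suffixes of the order have density at most `lam`, then so has the `exp (η D)`-weighted
average of the degrees at removal: the weights increase along the order, and the degrees at removal
over a suffix sum up to its number of edges. -/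
theorem sum_exp_mul_le {ord : List V} (h : ord.Nodup) (hall : ∀ v, v ∈ ord) {D : V → ℕ}
    (hD : ord.Pairwise (fun u v => D u ≤ D v)) {lam η : ℝ} (hη : 0 ≤ η)
    (hlam : ∀ i < ord.length, density G (rest ord i) ≤ lam) :
    ∑ v, Real.exp (η * D v) * degIn G (rest ord (ord.idxOf v)) v ≤
      lam * ∑ v, Real.exp (η * D v) := by
  have hu : (Finset.univ : Finset V) = ord.toFinset := by
    ext v
    simp [hall]
  have key := mul_sum_le_sum_mul (x := fun v => Real.exp (η * D v))
    (c := fun v => lam - degIn G (rest ord (ord.idxOf v)) v) ord 0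
    (fun v _ => (Real.exp_pos _).le)
    (hD.imp fun {u v} huv => Real.exp_le_exp.2
      (mul_le_mul_of_nonneg_left (by exact_mod_cast huv) hη)) (fun i => by
      rcases lt_or_ge i ord.length with hi | hi
      · rw [← List.sum_toFinset _ (h.sublist (List.drop_sublist i ord)), Finset.sum_sub_distrib]
        have := card_edges_le_of_density_le (hlam i hi)
        rw [← sum_degIn_rest h hall i] at this
        push_cast at this
        rw [Finset.sum_const, nsmul_eq_mul]
        unfold rest at this ⊢
        linarith
      · rw [List.drop_of_length_le hi]
        simp)
  rw [zero_mul, ← List.sum_toFinset _ h, ← hu] at key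
  simp only [mul_sub, Finset.sum_sub_distrib] at key
  rw [← Finset.sum_mul] at key
  linarith

theorem Iteration.density_le {ℓ ℓ' : V → ℕ} {S S' : Finset V} {c : ℕ}
    (h : Iteration G ℓ S ℓ' S' c) : density G S ≤ density G S' := by
  obtain ⟨ord, _, _, ⟨rfl, _⟩ | ⟨i, _, _, hlt, _⟩⟩ := h
  exacts [le_rfl, hlt.le]

/-- The potential `∑ exp (η ℓ v)` grows by at most the factor `exp (η (1 + 5 δ) λ)` in an
iteration, where `η Δ ≤ δ` and `λ` bounds the density of the best subgraph afterwards. -/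
theorem Iteration.potential {ℓ ℓ' : V → ℕ} {S S' : Finset V} {c : ℕ}
    (h : Iteration G ℓ S ℓ' S' c) {lam η δ : ℝ} (hη : 0 ≤ η) (hδ : η * G.maxDegree ≤ δ)
    (hδ1 : δ ≤ 1) (hlam : density G S' ≤ lam) :
    ∑ v, Real.exp (η * ℓ' v) ≤
      Real.exp (η * ((1 + 5 * δ) * lam)) * ∑ v, Real.exp (η * ℓ v) := by
  obtain ⟨ord, hord, hℓ, hS⟩ := h
  have hden : ∀ i < ord.length, density G (rest ord i) ≤ lam := by
    rcases hS with ⟨rfl, h⟩ | ⟨_, _, _, _, h⟩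
    · exact fun i hi => (h i hi).trans hlam
    · exact fun i hi => (h i hi).trans hlam
  obtain ⟨hnd, hall, D, hDm, hD⟩ := hord.thresholds
  have hlam0 : 0 ≤ lam := (density_nonneg S').trans hlam
  have hδ0 : 0 ≤ δ := le_trans (by positivity) hδ
  have hexp : ∀ x : ℝ, 0 ≤ x → x ≤ 1 → Real.exp x ≤ 1 + x + x ^ 2 := by
    intro x h0 h1
    have := Real.exp_bound' h0 h1 (n := 2) (by norm_num)
    simp only [Finset.sum_range_succ, Finset.sum_range_zero] at this
    norm_num at this
    nlinarith
  have hdeg : ∀ v : V, η * (G.degree v : ℝ) ≤ δ := fun v =>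
    (mul_le_mul_of_nonneg_left (by exact_mod_cast G.degree_le_maxDegree v) hη).trans hδ
  have step : ∀ v, Real.exp (η * ℓ' v) ≤ Real.exp (η * ℓ v) +
      η * (1 + δ) * (Real.exp (η * D v) * degIn G (rest ord (ord.idxOf v)) v) := by
    intro v
    set q : ℝ := ((degIn G (rest ord (ord.idxOf v)) v : ℕ) : ℝ) with hq
    have hq0 : 0 ≤ q := by positivity
    have hqd : q ≤ G.degree v := by
      rw [hq]
      exact_mod_cast degIn_le_degree _ v
    have hx : η * q ≤ δ := (mul_le_mul_of_nonneg_left hqd hη).trans (hdeg v)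
    have hx0 : 0 ≤ η * q := mul_nonneg hη hq0
    have e1 : Real.exp (η * ℓ' v) = Real.exp (η * ℓ v) * Real.exp (η * q) := by
      rw [← Real.exp_add, hℓ v, hq]
      push_cast
      ring_nf
    have e2 : Real.exp (η * ℓ v) ≤ Real.exp (η * D v) := by
      refine Real.exp_le_exp.2 (mul_le_mul_of_nonneg_left ?_ hη)
      exact_mod_cast (Nat.le_add_right _ _).trans (hD v).2
    have e3 := hexp _ hx0 (hx.trans hδ1)
    have e4 : Real.exp (η * q) ≤ 1 + η * q * (1 + δ) := by nlinarith
    rw [e1]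
    have p := Real.exp_pos (η * ℓ v)
    have : Real.exp (η * ℓ v) * Real.exp (η * q) ≤
        Real.exp (η * ℓ v) * (1 + η * q * (1 + δ)) := mul_le_mul_of_nonneg_left e4 p.le
    have : Real.exp (η * ℓ v) * (η * q * (1 + δ)) ≤ Real.exp (η * D v) * (η * q * (1 + δ)) :=
      mul_le_mul_of_nonneg_right e2 (by positivity)
    linarith
  have hbound : ∑ v, Real.exp (η * D v) ≤ (1 + 2 * δ) * ∑ v, Real.exp (η * ℓ v) := by
    rw [Finset.mul_sum]
    refine Finset.sum_le_sum fun v _ => ?_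
    have e1 : η * D v ≤ η * ℓ v + δ := by
      have : (D v : ℝ) ≤ ℓ v + G.degree v := by exact_mod_cast (hD v).1
      have := mul_le_mul_of_nonneg_left this hη
      linarith [hdeg v]
    have e2 : Real.exp δ ≤ 1 + 2 * δ := by nlinarith [hexp δ hδ0 hδ1]
    calc Real.exp (η * D v) ≤ Real.exp (η * ℓ v + δ) := Real.exp_le_exp.2 e1
      _ = Real.exp δ * Real.exp (η * ℓ v) := by rw [Real.exp_add, mul_comm]
      _ ≤ _ := mul_le_mul_of_nonneg_right e2 (Real.exp_pos _).le
  have hsum := sum_exp_mul_le hnd hall hDm hη hden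
  set Φ := ∑ v, Real.exp (η * ℓ v) with hΦ
  have hΦ0 : 0 ≤ Φ := Finset.sum_nonneg fun v _ => (Real.exp_pos _).le
  have h1 : ∑ v, Real.exp (η * ℓ' v) ≤ Φ + η * (1 + δ) * (lam * ((1 + 2 * δ) * Φ)) := by
    refine (Finset.sum_le_sum fun v _ => step v).trans ?_
    rw [Finset.sum_add_distrib, ← Finset.mul_sum]
    have := hsum.trans (mul_le_mul_of_nonneg_left hbound hlam0)
    have := mul_le_mul_of_nonneg_left this (show 0 ≤ η * (1 + δ) by positivity)
    linarith
  have h2 : (1 + δ) * (1 + 2 * δ) ≤ 1 + 5 * δ := by nlinarith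
  have h3 : Φ + η * (1 + δ) * (lam * ((1 + 2 * δ) * Φ)) ≤
      (η * ((1 + 5 * δ) * lam) + 1) * Φ := by
    have := mul_le_mul_of_nonneg_right h2 (show 0 ≤ η * lam * Φ by positivity)
    nlinarith
  exact (h1.trans h3).trans (mul_le_mul_of_nonneg_right (Real.add_one_le_exp _) hΦ0)

theorem IsRun.density_mono {T : ℕ} {ℓ : ℕ → V → ℕ} {S : ℕ → Finset V} {c : ℕ → ℕ}
    (h : IsRun G T ℓ S c) {t : ℕ} (ht : t ≤ T) : density G (S t) ≤ density G (S T) := by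
  induction T, ht using Nat.le_induction with
  | base => exact le_rfl
  | succ T hT ih =>
    exact (ih ⟨h.1, h.2.1, fun t ht => h.2.2 t (by omega)⟩).trans (h.2.2 T (by omega)).density_le

/-- The average load inside `S` is at least the number of iterations times the density of `S`. -/
theorem IsRun.mul_card_edges_le {T : ℕ} {ℓ : ℕ → V → ℕ} {S : ℕ → Finset V} {c : ℕ → ℕ}
    (h : IsRun G T ℓ S c) (A : Finset V) {t : ℕ} (ht : t ≤ T) :
    t * (G.edgeFinset ∩ A.sym2).card ≤ ∑ v ∈ A, ℓ t v := by
  induction t with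
  | zero => simp
  | succ t ih =>
    obtain ⟨ord, hord, hℓ, _⟩ := h.2.2 t (by omega)
    obtain ⟨hnd, hall, _⟩ := hord.thresholds
    have h1 := card_edges_le_sum_degIn_rest (G := G) hnd hall A
    have h2 := ih (by omega)
    rw [Finset.sum_congr rfl fun v _ => hℓ v, Finset.sum_add_distrib, add_mul, one_mul]
    exact Nat.add_le_add h2 h1

/-- The growth of the potential, starting from `card V`, bounds every single load. -/
theorem IsRun.load_le [Nonempty V] {T : ℕ} {ℓ : ℕ → V → ℕ} {S : ℕ → Finset V} {c : ℕ → ℕ}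
    (h : IsRun G T ℓ S c) {η δ : ℝ} (hη : 0 < η) (hδ : η * G.maxDegree ≤ δ) (hδ1 : δ ≤ 1) (v : V) :
    (ℓ T v : ℝ) ≤ Real.log (Fintype.card V) / η + T * ((1 + 5 * δ) * density G (S T)) := by
  set r := η * ((1 + 5 * δ) * density G (S T)) with hr
  have hpot : ∀ t ≤ T, ∑ v, Real.exp (η * ℓ t v) ≤ Real.exp (t * r) * Fintype.card V := by
    intro t
    induction t with
    | zero =>
      intro _
      rw [h.1]
      simp
    | succ t ih =>
      intro ht
      refine ((h.2.2 t (by omega)).potential hη.le hδ hδ1 (h.density_mono ht)).trans ?_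
      refine (mul_le_mul_of_nonneg_left (ih (by omega)) (Real.exp_pos _).le).trans_eq ?_
      rw [← hr, ← mul_assoc, ← Real.exp_add]
      push_cast
      ring_nf
  have hn : (0 : ℝ) < Fintype.card V := by exact_mod_cast Fintype.card_pos
  have h1 : Real.exp (η * ℓ T v) ≤ Real.exp (T * r) * Fintype.card V :=
    (Finset.single_le_sum (f := fun v => Real.exp (η * ℓ T v)) (fun v _ => (Real.exp_pos _).le)
      (Finset.mem_univ v)).trans (hpot T le_rfl)
  have h2 : η * ℓ T v ≤ T * r + Real.log (Fintype.card V) := by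
    have := Real.log_le_log (Real.exp_pos _) h1
    rwa [Real.log_exp, Real.log_mul (Real.exp_pos _).ne' hn.ne', Real.log_exp] at this
  have h3 : (ℓ T v : ℝ) ≤ (T * r + Real.log (Fintype.card V)) / η := by
    rw [le_div_iff₀ hη]
    linarith
  refine h3.trans_eq ?_
  rw [hr]
  field_simp
  ring

/-- Both estimates of the loads together: the average load in any `A` is at least `T * density G A`,
and every load is at most `log n / η + T (1 + 5 δ) density G (S T)`. With `δ = ε / 20` and `η = δ /
Δ`, the number of iterations makes the first summand at most `T * maxDensity G * ε / 4`. -/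
theorem approximation (n : ℕ) (G : SimpleGraph (Fin n)) [DecidableRel G.Adj] (ε : ℝ) (T : ℕ)
    (ℓ : ℕ → Fin n → ℕ) (S : ℕ → Finset (Fin n)) (c : ℕ → ℕ) (hε : 0 < ε) (hε1 : ε < 1)
    (hT : 80 * ((G.maxDegree : ℝ) * Real.log n / (maxDensity G * ε ^ 2)) ≤ (T : ℝ))
    (hrun : IsRun G T ℓ S c) : maxDensity G ≤ (1 + ε) * density G (S T) := by
  have hbdd : BddAbove (Set.range fun S : Finset (Fin n) => density G S) := Set.finite_range _ |>.bddAbove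
  rcases le_or_gt (maxDensity G) 0 with h0 | h0
  · exact h0.trans (mul_nonneg (by linarith) (density_nonneg _))
  obtain ⟨A, hA⟩ : ∃ A, 0 < density G A := by
    by_contra hc
    push Not at hc
    exact absurd (ciSup_le hc) (not_le.2 h0)
  obtain ⟨e, he⟩ : G.edgeFinset.Nonempty := by
    rw [Finset.nonempty_iff_ne_empty]
    intro he
    simp [density, he] at hA
  obtain ⟨u, v, huv⟩ : ∃ u v, G.Adj u v := by
    induction e with
    | h u v => exact ⟨u, v, by simpa using he⟩
  have hΔ : (1 : ℝ) ≤ G.maxDegree := by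
    have h1 : 0 < G.degree u := (G.degree_pos_iff_exists_adj u).2 ⟨v, huv⟩
    exact_mod_cast h1.trans_le (G.degree_le_maxDegree u)
  have hn : 2 ≤ n := by
    have : u.val ≠ v.val := fun h => huv.ne (Fin.ext h)
    omega
  have hlog : 0 < Real.log n := Real.log_pos (by exact_mod_cast hn)
  have : Nonempty (Fin n) := ⟨u⟩
  set Δ : ℝ := ((G.maxDegree : ℕ) : ℝ) with hΔd
  set lam := density G (S T) with hlam
  have hden : 0 < maxDensity G * ε ^ 2 := by positivity
  have hT0 : 0 < (T : ℝ) := lt_of_lt_of_le (by positivity) hT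
  have hT' : 80 * (Δ * Real.log n) ≤ T * (maxDensity G * ε ^ 2) := by
    rwa [← mul_div_assoc, div_le_iff₀ hden] at hT
  -- the parameters of the potential function
  have hload := hrun.load_le (η := ε / 20 / Δ) (δ := ε / 20) (by positivity)
    (by rw [← hΔd]; field_simp; rfl) (by linarith)
  rw [Fintype.card_fin] at hload
  set B := Real.log n / (ε / 20 / Δ) + T * ((1 + 5 * (ε / 20)) * lam) with hB
  have hB0 : 0 ≤ B := le_trans (by positivity) (hload u)
  have hmax : (T : ℝ) * maxDensity G ≤ B := by
    rw [← le_div_iff₀' hT0]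
    refine ciSup_le fun A => ?_
    rw [le_div_iff₀' hT0]
    rcases A.eq_empty_or_nonempty with rfl | hne
    · simpa [density] using hB0
    · have hc : (0 : ℝ) < A.card := by exact_mod_cast hne.card_pos
      rw [density, ← mul_div_assoc, div_le_iff₀ hc]
      have h1 : ((T * (G.edgeFinset ∩ A.sym2).card : ℕ) : ℝ) ≤ ((∑ v ∈ A, ℓ T v : ℕ) : ℝ) := by
        exact_mod_cast hrun.mul_card_edges_le A le_rfl
      push_cast at h1
      refine h1.trans ((Finset.sum_le_sum fun v _ => hload v).trans_eq ?_)
      rw [Finset.sum_const, nsmul_eq_mul, mul_comm]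
  have h1 : Real.log n / (ε / 20 / Δ) ≤ T * (maxDensity G * (ε / 4)) := by
    rw [div_div_eq_mul_div, div_le_iff₀ (by positivity)]
    nlinarith
  have h2 : (T : ℝ) * maxDensity G ≤
      T * (maxDensity G * (ε / 4) + (1 + 5 * (ε / 20)) * lam) := by
    rw [mul_add]
    linarith
  have h3 := le_of_mul_le_mul_left h2 hT0
  have hl0 : 0 ≤ lam := density_nonneg _
  have h4 : maxDensity G * (1 - ε / 4) ≤ ((1 + ε) * lam) * (1 - ε / 4) := by
    nlinarith [mul_nonneg hl0 (mul_nonneg hε.le (sub_nonneg.2 hε1.le))]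
  exact le_of_mul_le_mul_right h4 (by linarith)

end Approximation

/-! ### Concurrent atomic operations -/

/-- The amount that an atomic operation adds to cell `i` of array `a`. -/
def Req.inc (a i : ℕ) : Req → ℕ
  | .write _ _ _ => 0
  | .fetchAdd a' i' v _ _ => if a' = a ∧ i' = i then v else 0

/-- `1` if an atomic operation delivers a fetched value in cell `j` of array `b`. -/
def Req.hit (b j : ℕ) : Req → ℕ
  | .write _ _ _ => 0
  | .fetchAdd _ _ _ b' j' => if b' = b ∧ j' = j then 1 else 0

/-- `M'` is a possible memory after the requests `L` have taken effect, in some order, on `M`. -/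
def Eff (w : ℕ) (L : List Req) (M M' : Mem) : Prop :=
  ∃ l : List Req, l.Perm L ∧ M' = l.foldl (Req.apply w) M

theorem store_same (w : ℕ) (M : Mem) (a i v : ℕ) : store w M a i v a i = v % 2 ^ w := by
  simp [store]

theorem store_other {w : ℕ} {M : Mem} {a i v a' i' : ℕ} (h : ¬ (a' = a ∧ i' = i)) :
    store w M a i v a' i' = M a' i' := by
  simp [store, h]

/-- No request of `L` stores a value (written or fetched) in cell `i` of array `a`. -/
def NoSet (L : List Req) (a i : ℕ) : Prop :=
  (∀ v, Req.write a i v ∉ L) ∧ ∀ a' i' v, Req.fetchAdd a' i' v a i ∉ L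

/-- No request of `L` is a fetch-and-add on cell `i` of array `a`. -/
def NoAdd (L : List Req) (a i : ℕ) : Prop := ∀ v b j, Req.fetchAdd a i v b j ∉ L

theorem foldl_untouched {w : ℕ} {a i : ℕ} : ∀ (l : List Req) (M : Mem),
    NoSet l a i → NoAdd l a i → l.foldl (Req.apply w) M a i = M a i
  | [], _, _, _ => rfl
  | r :: l, M, hs, ha => by
    have ih := foldl_untouched (w := w) l (Req.apply w M r)
      ⟨fun v h => hs.1 v (List.mem_cons_of_mem _ h),
        fun a' i' v h => hs.2 a' i' v (List.mem_cons_of_mem _ h)⟩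
      (fun v b j h => ha v b j (List.mem_cons_of_mem _ h))
    rw [List.foldl_cons, ih]
    cases r with
    | write a' i' v =>
      refine store_other ?_
      rintro ⟨rfl, rfl⟩
      exact hs.1 v (by simp)
    | fetchAdd a' i' v b j =>
      rw [Req.apply, store_other, store_other]
      · rintro ⟨rfl, rfl⟩
        exact ha v b j (by simp)
      · rintro ⟨rfl, rfl⟩
        exact hs.2 a' i' v (by simp)

theorem Eff.untouched {w : ℕ} {L : List Req} {M M' : Mem} (h : Eff w L M M') {a i : ℕ}
    (hs : NoSet L a i) (ha : NoAdd L a i) : M' a i = M a i := by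
  obtain ⟨l, hl, rfl⟩ := h
  exact foldl_untouched l M
    ⟨fun v h => hs.1 v (hl.mem_iff.1 h), fun a' i' v h => hs.2 a' i' v (hl.mem_iff.1 h)⟩
    (fun v b j h => ha v b j (hl.mem_iff.1 h))

theorem foldl_counter {w : ℕ} {a i : ℕ} : ∀ (l : List Req) (M : Mem), NoSet l a i →
    M a i + (l.map (Req.inc a i)).sum < 2 ^ w →
    l.foldl (Req.apply w) M a i = M a i + (l.map (Req.inc a i)).sum
  | [], _, _, _ => by simp
  | r :: l, M, hs, hlt => by
    have hs' : NoSet l a i := ⟨fun v h => hs.1 v (List.mem_cons_of_mem _ h),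
        fun a' i' v h => hs.2 a' i' v (List.mem_cons_of_mem _ h)⟩
    simp only [List.map_cons, List.sum_cons] at hlt ⊢
    have key : Req.apply w M r a i = M a i + Req.inc a i r := by
      cases r with
      | write a' i' v =>
        rw [Req.apply, store_other]
        · rfl
        · rintro ⟨rfl, rfl⟩
          exact hs.1 v (by simp)
      | fetchAdd a' i' v b j =>
        rw [Req.apply, store_other]
        · simp only [Req.inc] at hlt ⊢
          split_ifs with h
          · obtain ⟨rfl, rfl⟩ := h
            rw [store_same]
            simp only [and_self, if_true] at hlt
            exact Nat.mod_eq_of_lt (by omega)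
          · rw [store_other (by tauto)]
            rfl
        · rintro ⟨rfl, rfl⟩
          exact hs.2 a' i' v (by simp)
    rw [List.foldl_cons, foldl_counter l _ hs' (by rw [key]; omega), key]
    omega

/-- A cell that is only a fetch-and-add counter ends with the sum of all increments. -/
theorem Eff.counter {w : ℕ} {L : List Req} {M M' : Mem} (h : Eff w L M M') {a i : ℕ}
    (hs : NoSet L a i) (hlt : M a i + (L.map (Req.inc a i)).sum < 2 ^ w) :
    M' a i = M a i + (L.map (Req.inc a i)).sum := by
  obtain ⟨l, hl, rfl⟩ := h
  have e : (l.map (Req.inc a i)).sum = (L.map (Req.inc a i)).sum := (hl.map _).sum_eq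
  rw [foldl_counter l M ⟨fun v h => hs.1 v (hl.mem_iff.1 h),
    fun a' i' v h => hs.2 a' i' v (hl.mem_iff.1 h)⟩ (by rw [e]; exact hlt), e]

theorem foldl_write {w : ℕ} {a i : ℕ} : ∀ (l : List Req) (M : Mem), NoAdd l a i →
    (∀ a' i' v, Req.fetchAdd a' i' v a i ∉ l) →
    (∃ v, Req.write a i v ∈ l ∧ l.foldl (Req.apply w) M a i = v % 2 ^ w) ∨
      ((∀ v, Req.write a i v ∉ l) ∧ l.foldl (Req.apply w) M a i = M a i)
  | [], _, _, _ => by simp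
  | r :: l, M, ha, hf => by
    rcases foldl_write (w := w) l (Req.apply w M r)
      (fun v b j h => ha v b j (List.mem_cons_of_mem _ h))
      (fun a' i' v h => hf a' i' v (List.mem_cons_of_mem _ h)) with ⟨v, hv, he⟩ | ⟨hn, he⟩
    · exact Or.inl ⟨v, List.mem_cons_of_mem _ hv, he⟩
    · rw [List.foldl_cons, he]
      cases r with
      | write a' i' v =>
        by_cases h : a = a' ∧ i = i'
        · obtain ⟨rfl, rfl⟩ := h
          exact Or.inl ⟨v, by simp, store_same ..⟩
        · refine Or.inr ⟨fun v' hv' => ?_, store_other h⟩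
          rcases List.mem_cons.1 hv' with h' | h'
          · simp only [Req.write.injEq] at h'
            exact h ⟨h'.1, h'.2.1⟩
          · exact hn v' h'
      | fetchAdd a' i' v b j =>
        refine Or.inr ⟨fun v' hv' => ?_, ?_⟩
        · rcases List.mem_cons.1 hv' with h' | h'
          · cases h'
          · exact hn v' h'
        · rw [Req.apply, store_other, store_other]
          · rintro ⟨rfl, rfl⟩
            exact ha v b j (by simp)
          · rintro ⟨rfl, rfl⟩
            exact hf a' i' v (by simp)

/-- A cell that is only written to ends with one of the written values. -/
theorem Eff.write {w : ℕ} {L : List Req} {M M' : Mem} (h : Eff w L M M') {a i : ℕ}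
    (ha : NoAdd L a i) (hf : ∀ a' i' v, Req.fetchAdd a' i' v a i ∉ L) :
    (∃ v, Req.write a i v ∈ L ∧ M' a i = v % 2 ^ w) ∨
      ((∀ v, Req.write a i v ∉ L) ∧ M' a i = M a i) := by
  obtain ⟨l, hl, rfl⟩ := h
  have := foldl_write (w := w) l M (fun v b j h => ha v b j (hl.mem_iff.1 h))
    (fun a' i' v h => hf a' i' v (hl.mem_iff.1 h))
  simpa only [hl.mem_iff] using this

/-- The tickets handed out by the unit counters in array `a` to the cells of array `b`: the
requests at counter `i` receive, without repetition, exactly the values between the initial and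
the final content of the counter. -/
structure Tickets (L : List Req) (M M' : Mem) (a b : ℕ) : Prop where
  range : ∀ i j, Req.fetchAdd a i 1 b j ∈ L → M a i ≤ M' b j ∧ M' b j < M' a i
  inj : ∀ i j j', Req.fetchAdd a i 1 b j ∈ L → Req.fetchAdd a i 1 b j' ∈ L →
    M' b j = M' b j' → j = j'
  surj : ∀ i c, M a i ≤ c → c < M' a i → ∃ j, Req.fetchAdd a i 1 b j ∈ L ∧ M' b j = c

/-- By induction on the number of operations that have taken effect: the last one to act on a
counter receives the value just below the new content. -/
theorem foldl_tickets {w : ℕ} {a b : ℕ} (hab : b ≠ a) (l : List Req) (M : Mem)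
    (hw : ∀ i v, Req.write a i v ∉ l ∧ Req.write b i v ∉ l)
    (hf : ∀ a' i v b' j, Req.fetchAdd a' i v b' j ∈ l → b' ≠ a ∧ a' ≠ b ∧
      (a' = a ∨ b' = b → a' = a ∧ v = 1 ∧ b' = b))
    (hlt : ∀ i, (l.map (Req.inc a i)).sum ≠ 0 → M a i + (l.map (Req.inc a i)).sum < 2 ^ w)
    (hu : ∀ j, (l.map (Req.hit b j)).sum ≤ 1) :
    Tickets l M (l.foldl (Req.apply w) M) a b := by
  induction l using List.reverseRecOn with
  | nil =>
    refine ⟨by simp, by simp, fun i c h h' => ?_⟩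
    simp only [List.foldl_nil] at h'
    omega
  | append_singleton l r ih =>
    have ih := ih (fun i v => ⟨fun h => (hw i v).1 (by simp [h]), fun h => (hw i v).2 (by simp [h])⟩)
      (fun a' i v b' j h => hf a' i v b' j (by simp [h]))
      (fun i hi => by have := hlt i; simp only [List.map_append, List.sum_append] at this; omega)
      (fun j => by have := hu j; simp only [List.map_append, List.sum_append] at this; omega)
    have hns : ∀ i, NoSet l a i := fun i => ⟨fun v h => (hw i v).1 (by simp [h]),
      fun a' i' v h => (hf a' i' v a i (by simp [h])).1 rfl⟩
    rw [List.foldl_append, List.foldl_cons, List.foldl_nil]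
    set M1 := l.foldl (Req.apply w) M with hM1
    by_cases hr : ∃ i j, r = Req.fetchAdd a i 1 b j
    · obtain ⟨i0, j0, rfl⟩ := hr
      have hlt' := hlt i0
      simp only [List.map_append, List.sum_append, List.map_cons, List.map_nil, List.sum_cons,
        List.sum_nil, Req.inc, and_self, if_true] at hlt'
      have hct : M1 a i0 = M a i0 + (l.map (Req.inc a i0)).sum :=
        foldl_counter l M (hns i0) (by omega)
      have hlt0 : M1 a i0 + 1 < 2 ^ w := by omega
      have hj0 : ∀ i, Req.fetchAdd a i 1 b j0 ∉ l := fun i h => by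
        have := hu j0
        have h1 : 1 ≤ (l.map (Req.hit b j0)).sum :=
          List.single_le_sum (by simp) _ (List.mem_map.2 ⟨_, h, by simp [Req.hit]⟩)
        simp only [List.map_append, List.sum_append, List.map_cons, List.map_nil, List.sum_cons,
          List.sum_nil, Req.hit] at this
        simp at this
        omega
      have eb : ∀ j, (Req.fetchAdd a i0 1 b j0).apply w M1 b j =
          if j = j0 then M1 a i0 else M1 b j := fun j => by
        rw [Req.apply]
        split_ifs with h
        · rw [h, store_same]; exact Nat.mod_eq_of_lt (by omega)
        · rw [store_other (by tauto), store_other (by tauto)]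
      have ea : ∀ i, (Req.fetchAdd a i0 1 b j0).apply w M1 a i =
          if i = i0 then M1 a i0 + 1 else M1 a i := fun i => by
        rw [Req.apply, store_other (by tauto)]
        split_ifs with h
        · rw [h, store_same]; exact Nat.mod_eq_of_lt (by omega)
        · rw [store_other (by tauto)]
      have hmem : ∀ i j, Req.fetchAdd a i 1 b j ∈ l ++ [Req.fetchAdd a i0 1 b j0] ↔
          (Req.fetchAdd a i 1 b j ∈ l ∧ j ≠ j0) ∨ (i = i0 ∧ j = j0) := fun i j => by
        simp only [List.mem_append, List.mem_singleton, Req.fetchAdd.injEq, true_and]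
        constructor
        · rintro (h | h)
          · exact Or.inl ⟨h, fun e => hj0 i (e ▸ h)⟩
          · exact Or.inr h
        · rintro (h | h)
          · exact Or.inl h.1
          · exact Or.inr h
      refine ⟨fun i j h => ?_, fun i j j' h h' he => ?_, fun i c h1 h2 => ?_⟩
      · rw [eb, ea]
        rcases (hmem i j).1 h with ⟨h, hne⟩ | ⟨rfl, rfl⟩
        · have := ih.range i j h
          rw [if_neg hne]
          split_ifs with hi
          · subst hi; omega
          · exact this
        · simp only [if_true]
          omega
      · rw [eb, eb] at he
        rcases (hmem i j).1 h with ⟨hm, hne⟩ | ⟨hi, hj⟩ <;>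
        rcases (hmem _ j').1 h' with ⟨hm', hne'⟩ | ⟨hi', hj'⟩
        · rw [if_neg hne, if_neg hne'] at he
          exact ih.inj i j j' hm hm' he
        · subst hi'
          rw [if_neg hne, if_pos hj'] at he
          have := ih.range _ j hm
          omega
        · subst hi
          rw [if_pos hj, if_neg hne'] at he
          have := ih.range _ j' hm'
          omega
        · rw [hj, hj']
      · rw [ea] at h2
        split_ifs at h2 with hi
        · subst hi
          rcases Nat.lt_succ_iff_lt_or_eq.1 h2 with h2 | h2
          · obtain ⟨j, hj, hc⟩ := ih.surj i c h1 h2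
            have hne : j ≠ j0 := fun e => hj0 i (e ▸ hj)
            exact ⟨j, (hmem i j).2 (Or.inl ⟨hj, hne⟩), by rw [eb, if_neg hne, hc]⟩
          · exact ⟨j0, (hmem i j0).2 (Or.inr ⟨rfl, rfl⟩), by rw [eb, if_pos rfl, h2]⟩
        · obtain ⟨j, hj, hc⟩ := ih.surj i c h1 h2
          have hne : j ≠ j0 := fun e => hj0 i (e ▸ hj)
          exact ⟨j, (hmem i j).2 (Or.inl ⟨hj, hne⟩), by rw [eb, if_neg hne, hc]⟩
    · have ea : ∀ i, r.apply w M1 a i = M1 a i ∧ r.apply w M1 b i = M1 b i := by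
        cases r with
        | write a' i' v =>
          have := hw i' v
          simp only [List.mem_append, List.mem_singleton, Req.write.injEq] at this
          intro i
          constructor <;> refine store_other ?_ <;> rintro ⟨rfl, rfl⟩
          · exact this.1 (Or.inr (by simp))
          · exact this.2 (Or.inr (by simp))
        | fetchAdd a' i' v b' j =>
          obtain ⟨h3, h4, h5⟩ := hf a' i' v b' j (by simp)
          have h2 : a' ≠ a ∧ b' ≠ b := by
            by_contra hc
            have h5 := h5 (by tauto)
            exact hr ⟨i', j, by rw [h5.1, h5.2.1, h5.2.2]⟩
          intro i
          constructor
          · rw [Req.apply, store_other (fun h => h3 h.1.symm), store_other (fun h => h2.1 h.1.symm)]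
          · rw [Req.apply, store_other (fun h => h2.2 h.1.symm), store_other (fun h => h4 h.1.symm)]
      have hmem : ∀ i j, Req.fetchAdd a i 1 b j ∈ l ++ [r] ↔ Req.fetchAdd a i 1 b j ∈ l :=
        fun i j => by
        simp only [List.mem_append, List.mem_singleton, or_iff_left_iff_imp]
        intro h
        exact absurd ⟨i, j, h.symm⟩ hr
      constructor
      · intro i j h
        rw [(ea i).1, (ea j).2]
        exact ih.range i j ((hmem i j).1 h)
      · intro i j j' h h'
        rw [(ea j).2, (ea j').2]
        exact ih.inj i j j' ((hmem i j).1 h) ((hmem i j').1 h')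
      · intro i c h h'
        rw [(ea i).1] at h'
        obtain ⟨j, hj, hc⟩ := ih.surj i c h h'
        exact ⟨j, (hmem i j).2 hj, by rw [(ea j).2, hc]⟩

theorem Eff.tickets {w : ℕ} {L : List Req} {M M' : Mem} (h : Eff w L M M') {a b : ℕ}
    (hab : b ≠ a) (hw : ∀ i v, Req.write a i v ∉ L ∧ Req.write b i v ∉ L)
    (hf : ∀ a' i v b' j, Req.fetchAdd a' i v b' j ∈ L → b' ≠ a ∧ a' ≠ b ∧
      (a' = a ∨ b' = b → a' = a ∧ v = 1 ∧ b' = b))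
    (hlt : ∀ i, (L.map (Req.inc a i)).sum ≠ 0 → M a i + (L.map (Req.inc a i)).sum < 2 ^ w)
    (hu : ∀ j, (L.map (Req.hit b j)).sum ≤ 1) : Tickets L M M' a b := by
  obtain ⟨l, hl, rfl⟩ := h
  have := foldl_tickets (w := w) hab l M (by simpa only [hl.mem_iff] using hw)
    (by simpa only [hl.mem_iff] using hf)
    (fun i => by rw [(hl.map (Req.inc a i)).sum_eq]; exact hlt i)
    (fun i => by rw [(hl.map (Req.hit b i)).sum_eq]; exact hu i)
  exact ⟨by simpa only [hl.mem_iff] using this.range, by simpa only [hl.mem_iff] using this.inj,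
    by simpa only [hl.mem_iff] using this.surj⟩

section Steps

/-! ### Reasoning about parallel steps -/

variable {w : ℕ} {σ : Scheduler} {ω : ℕ → Fin (2 ^ w)} {M M' : Mem}

/-- The sum of `f` over all requests that a parallel step issues. -/
def Par.total (ω : ℕ → Fin (2 ^ w)) (M : Mem) (f : Req → ℕ) : Par → List ℕ → ℕ
  | .skip, _ => 0
  | .write a i v, env => f (.write a (i.eval ω env M) (v.eval ω env M))
  | .fetchAdd a i v b j, env =>
      f (.fetchAdd a (i.eval ω env M) (v.eval ω env M) b (j.eval ω env M))
  | .cond c p q, env => if c.eval ω env M = 0 then q.total ω M f env else p.total ω M f env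
  | .both p q, env => p.total ω M f env + q.total ω M f env
  | .parfor N p, env => ∑ i ∈ Finset.range (N.eval ω env M), p.total ω M f (i :: env)

/-- The parallel step issues the request `r`. -/
def Par.Issues (ω : ℕ → Fin (2 ^ w)) (M : Mem) (r : Req) : Par → List ℕ → Prop
  | .skip, _ => False
  | .write a i v, env => r = .write a (i.eval ω env M) (v.eval ω env M)
  | .fetchAdd a i v b j, env =>
      r = .fetchAdd a (i.eval ω env M) (v.eval ω env M) b (j.eval ω env M)
  | .cond c p q, env => (c.eval ω env M ≠ 0 ∧ p.Issues ω M r env) ∨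
      (c.eval ω env M = 0 ∧ q.Issues ω M r env)
  | .both p q, env => p.Issues ω M r env ∨ q.Issues ω M r env
  | .parfor N p, env => ∃ i < N.eval ω env M, p.Issues ω M r (i :: env)

theorem Par.sum_reqs (f : Req → ℕ) (p : Par) (env : List ℕ) :
    ((p.reqs ω M env).map f).sum = p.total ω M f env := by
  induction p generalizing env with
  | skip => rfl
  | write a i v => simp [Par.reqs, Par.total]
  | fetchAdd a i v b j => simp [Par.reqs, Par.total]
  | cond c p q ihp ihq =>
    simp only [Par.reqs, Par.total]
    split_ifs
    exacts [ihq env, ihp env]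
  | both p q ihp ihq => simp [Par.reqs, Par.total, ihp, ihq]
  | parfor N p ih =>
    simp only [Par.reqs, Par.total]
    induction N.eval ω env M with
    | zero => simp
    | succ k ihk =>
      rw [List.range_succ, List.flatMap_append, List.map_append, List.sum_append, ihk,
        Finset.sum_range_succ, ← ih]
      simp

theorem Par.mem_reqs {r : Req} (p : Par) (env : List ℕ) :
    r ∈ p.reqs ω M env ↔ p.Issues ω M r env := by
  induction p generalizing env with
  | skip => simp [Par.reqs, Par.Issues]
  | write a i v => simp [Par.reqs, Par.Issues]
  | fetchAdd a i v b j => simp [Par.reqs, Par.Issues]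
  | cond c p q ihp ihq =>
    simp only [Par.reqs, Par.Issues, ← ihp, ← ihq]
    split_ifs with h <;> simp [h]
  | both p q ihp ihq => simp [Par.reqs, Par.Issues, ihp, ihq]
  | parfor N p ih => simp [Par.reqs, Par.Issues, ih]

/-- The arrays that a parallel step writes to. -/
def Par.wrt : Par → List ℕ
  | .skip => []
  | .write a _ _ => [a]
  | .fetchAdd _ _ _ _ _ => []
  | .cond _ p q => p.wrt ++ q.wrt
  | .both p q => p.wrt ++ q.wrt
  | .parfor _ p => p.wrt

/-- The arrays of counters of a parallel step. -/
def Par.ctr : Par → List ℕ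
  | .skip => []
  | .write _ _ _ => []
  | .fetchAdd a _ _ _ _ => [a]
  | .cond _ p q => p.ctr ++ q.ctr
  | .both p q => p.ctr ++ q.ctr
  | .parfor _ p => p.ctr

/-- The arrays to which a parallel step delivers fetched values. -/
def Par.res : Par → List ℕ
  | .skip => []
  | .write _ _ _ => []
  | .fetchAdd _ _ _ b _ => [b]
  | .cond _ p q => p.res ++ q.res
  | .both p q => p.res ++ q.res
  | .parfor _ p => p.res

/-- The fetch-and-adds on array `a` are those that deliver to array `b`, and they add `1`. -/
def Par.ticketing (a b : ℕ) : Par → Bool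
  | .skip => true
  | .write _ _ _ => true
  | .fetchAdd a' _ (.const 1) b' _ => (a' == a) == (b' == b)
  | .fetchAdd a' _ _ b' _ => a' != a && b' != b
  | .cond _ p q => p.ticketing a b && q.ticketing a b
  | .both p q => p.ticketing a b && q.ticketing a b
  | .parfor _ p => p.ticketing a b

theorem Par.mem_wrt {a i v : ℕ} : ∀ {p : Par} {env : List ℕ},
    p.Issues ω M (.write a i v) env → a ∈ p.wrt
  | .skip, _, h => h.elim
  | .write _ _ _, _, h => by
    simp only [Par.Issues, Req.write.injEq] at h
    simp [Par.wrt, h.1]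
  | .fetchAdd _ _ _ _ _, _, h => by simp [Par.Issues] at h
  | .cond _ _ _, _, h => by
    rcases h with h | h
    · exact List.mem_append_left _ (mem_wrt h.2)
    · exact List.mem_append_right _ (mem_wrt h.2)
  | .both _ _, _, h => by
    rcases h with h | h
    · exact List.mem_append_left _ (mem_wrt h)
    · exact List.mem_append_right _ (mem_wrt h)
  | .parfor _ p, _, h => by
    obtain ⟨i, _, h⟩ := h
    exact mem_wrt (p := p) h

theorem Par.mem_ctr_res {a i v b j : ℕ} : ∀ {p : Par} {env : List ℕ},
    p.Issues ω M (.fetchAdd a i v b j) env → a ∈ p.ctr ∧ b ∈ p.res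
  | .skip, _, h => h.elim
  | .write _ _ _, _, h => by simp [Par.Issues] at h
  | .fetchAdd _ _ _ _ _, _, h => by
    simp only [Par.Issues, Req.fetchAdd.injEq] at h
    simp [Par.ctr, Par.res, h]
  | .cond _ _ _, _, h => by
    rcases h with h | h
    · exact ⟨List.mem_append_left _ (mem_ctr_res h.2).1, List.mem_append_left _ (mem_ctr_res h.2).2⟩
    · exact ⟨List.mem_append_right _ (mem_ctr_res h.2).1,
        List.mem_append_right _ (mem_ctr_res h.2).2⟩
  | .both _ _, _, h => by
    rcases h with h | h
    · exact ⟨List.mem_append_left _ (mem_ctr_res h).1, List.mem_append_left _ (mem_ctr_res h).2⟩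
    · exact ⟨List.mem_append_right _ (mem_ctr_res h).1, List.mem_append_right _ (mem_ctr_res h).2⟩
  | .parfor _ p, _, h => by
    obtain ⟨i, _, h⟩ := h
    exact mem_ctr_res (p := p) h

theorem Par.ticketing_spec {a b a' i v b' j : ℕ} : ∀ {p : Par} {env : List ℕ},
    p.ticketing a b = true → p.Issues ω M (.fetchAdd a' i v b' j) env →
    (a' = a ∨ b' = b → a' = a ∧ v = 1 ∧ b' = b)
  | .skip, _, _, h => h.elim
  | .write _ _ _, _, _, h => by simp [Par.Issues] at h
  | .fetchAdd _ _ e _ _, _, ht, h => by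
    simp only [Par.Issues, Req.fetchAdd.injEq] at h
    obtain ⟨rfl, _, rfl, rfl, _⟩ := h
    unfold Par.ticketing at ht
    split at ht
    all_goals first | contradiction | skip
    · rename_i heq
      cases heq
      intro ho
      simp only [beq_iff_eq, Bool.beq_eq_decide_eq, decide_eq_decide] at ht
      have : (a' = a) ↔ (b' = b) := by simpa using ht
      simp only [Expr.eval]
      tauto
    · rename_i heq
      cases heq
      simp at ht
      tauto
  | .cond _ _ _, _, ht, h => by
    simp only [Par.ticketing, Bool.and_eq_true] at ht
    rcases h with h | h
    · exact ticketing_spec ht.1 h.2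
    · exact ticketing_spec ht.2 h.2
  | .both _ _, _, ht, h => by
    simp only [Par.ticketing, Bool.and_eq_true] at ht
    rcases h with h | h
    · exact ticketing_spec ht.1 h
    · exact ticketing_spec ht.2 h
  | .parfor _ p, _, ht, h => by
    obtain ⟨i, _, h⟩ := h
    exact ticketing_spec (p := p) ht h

section Effects

variable {p : Par} {env : List ℕ} {a b i : ℕ}

/-- An array that is not among the targets of a step keeps its content. -/
theorem Par.frame (h : Eff w (p.reqs ω M env) M M') (ha : a ∉ p.wrt ++ (p.ctr ++ p.res)) :
    M' a = M a := by
  simp only [List.mem_append, not_or] at ha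
  funext i
  refine h.untouched ⟨fun v hv => ha.1 (Par.mem_wrt ((Par.mem_reqs _ _).1 hv)),
    fun a' i' v hv => ha.2.2 (Par.mem_ctr_res ((Par.mem_reqs _ _).1 hv)).2⟩
    (fun v b j hv => ha.2.1 (Par.mem_ctr_res ((Par.mem_reqs _ _).1 hv)).1)

/-- A counter grows by the total of the increments. -/
theorem Par.counter (h : Eff w (p.reqs ω M env) M M') (ha : a ∉ p.wrt ++ p.res)
    (hlt : M a i + p.total ω M (Req.inc a i) env < 2 ^ w) :
    M' a i = M a i + p.total ω M (Req.inc a i) env := by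
  simp only [List.mem_append, not_or] at ha
  rw [← Par.sum_reqs] at hlt ⊢
  exact h.counter ⟨fun v hv => ha.1 (Par.mem_wrt ((Par.mem_reqs _ _).1 hv)),
    fun a' i' v hv => ha.2 (Par.mem_ctr_res ((Par.mem_reqs _ _).1 hv)).2⟩ hlt

/-- A cell in an array of plain writes ends with the value of one of the writes to it, or keeps its
content if there are none. -/
theorem Par.written (h : Eff w (p.reqs ω M env) M M') (ha : a ∉ p.ctr ++ p.res) :
    (∃ v, p.Issues ω M (.write a i v) env ∧ M' a i = v % 2 ^ w) ∨
      ((∀ v, ¬ p.Issues ω M (.write a i v) env) ∧ M' a i = M a i) := by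
  simp only [List.mem_append, not_or] at ha
  have := h.write (a := a) (i := i)
    (fun v b j hv => ha.1 (Par.mem_ctr_res ((Par.mem_reqs _ _).1 hv)).1)
    (fun a' i' v hv => ha.2 (Par.mem_ctr_res ((Par.mem_reqs _ _).1 hv)).2)
  simpa only [Par.mem_reqs] using this

theorem Par.written_eq (h : Eff w (p.reqs ω M env) M M') (ha : a ∉ p.ctr ++ p.res) {v : ℕ}
    (h1 : p.Issues ω M (.write a i v) env)
    (h2 : ∀ v', p.Issues ω M (.write a i v') env → v' = v) (hv : v < 2 ^ w) : M' a i = v := by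
  rcases Par.written (i := i) h ha with ⟨v', hv', he⟩ | ⟨hn, _⟩
  · rw [he, h2 v' hv', Nat.mod_eq_of_lt hv]
  · exact absurd h1 (hn v)

theorem Par.not_written (h : Eff w (p.reqs ω M env) M M') (ha : a ∉ p.ctr ++ p.res)
    (h2 : ∀ v', ¬ p.Issues ω M (.write a i v') env) : M' a i = M a i := by
  rcases Par.written (i := i) h ha with ⟨v', hv', he⟩ | ⟨_, he⟩
  · exact absurd hv' (h2 v')
  · exact he

/-- A cell that is not the target of a request keeps its content. -/
theorem Par.not_hit (h : Eff w (p.reqs ω M env) M M') (ha : a ∉ p.wrt ++ p.ctr)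
    (hf : ∀ a' i' v, ¬ p.Issues ω M (.fetchAdd a' i' v a i) env) : M' a i = M a i := by
  simp only [List.mem_append, not_or] at ha
  refine h.untouched ⟨fun v hv => ha.1 (Par.mem_wrt ((Par.mem_reqs _ _).1 hv)),
    fun a' i' v hv => hf a' i' v ((Par.mem_reqs _ _).1 hv)⟩
    (fun v b j hv => ha.2 (Par.mem_ctr_res ((Par.mem_reqs _ _).1 hv)).1)

/-- Unit fetch-and-adds of a step hand out tickets in whatever order they take effect, provided that
no two of them deliver to the same cell. -/
theorem Par.tickets (h : Eff w (p.reqs ω M env) M M') (ht : p.ticketing a b = true) (hab : b ≠ a)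
    (ha : a ∉ p.wrt ++ p.res) (hb : b ∉ p.wrt ++ p.ctr)
    (hlt : ∀ i, p.total ω M (Req.inc a i) env ≠ 0 → M a i + p.total ω M (Req.inc a i) env < 2 ^ w)
    (hu : ∀ j, p.total ω M (Req.hit b j) env ≤ 1) : Tickets (p.reqs ω M env) M M' a b := by
  simp only [List.mem_append, not_or] at ha hb
  refine h.tickets hab (fun i v => ⟨fun hv => ha.1 (Par.mem_wrt ((Par.mem_reqs _ _).1 hv)),
    fun hv => hb.1 (Par.mem_wrt ((Par.mem_reqs _ _).1 hv))⟩) (fun a' i v b' j hv => ?_)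
    (by simpa only [Par.sum_reqs] using hlt) (by simpa only [Par.sum_reqs] using hu)
  have hv := (Par.mem_reqs _ _).1 hv
  refine ⟨?_, ?_, Par.ticketing_spec ht hv⟩
  · rintro rfl
    exact ha.2 (Par.mem_ctr_res hv).2
  · rintro rfl
    exact hb.2 (Par.mem_ctr_res hv).1

end Effects

/-- The number of operations in the text of a parallel step. -/
def Par.size : Par → ℕ
  | .skip => 1
  | .write _ i v => i.size + v.size + 1
  | .fetchAdd _ i v _ j => i.size + v.size + j.size + 1
  | .cond c p q => c.size + 1 + p.size + q.size
  | .both p q => 1 + p.size + q.size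
  | .parfor N p => N.size + 1 + p.size

/-- The number of threads of a parallel step. -/
def Par.count (ω : ℕ → Fin (2 ^ w)) (M : Mem) : Par → List ℕ → ℕ
  | .skip, _ => 1
  | .write _ _ _, _ => 1
  | .fetchAdd _ _ _ _ _, _ => 1
  | .cond c p q, env => if c.eval ω env M = 0 then q.count ω M env else p.count ω M env
  | .both p q, env => p.count ω M env + q.count ω M env
  | .parfor N p, env => 1 + ∑ i ∈ Finset.range (N.eval ω env M), p.count ω M (i :: env)

theorem Par.count_pos (p : Par) (env : List ℕ) : 1 ≤ p.count ω M env := by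
  induction p generalizing env with
  | skip => exact le_rfl
  | write a i v => exact le_rfl
  | fetchAdd a i v b j => exact le_rfl
  | cond c p q ihp ihq =>
    simp only [Par.count]
    split_ifs
    exacts [ihq env, ihp env]
  | both p q ihp ihq => exact le_add_right (ihp env)
  | parfor N p ih => exact Nat.le_add_right _ _

theorem Par.work_le (p : Par) (env : List ℕ) : p.work ω M env ≤ p.size * p.count ω M env := by
  induction p generalizing env with
  | skip => simp [Par.work, Par.size, Par.count]
  | write a i v => simp [Par.work, Par.size, Par.count]
  | fetchAdd a i v b j => simp [Par.work, Par.size, Par.count]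
  | cond c p q ihp ihq =>
    simp only [Par.work, Par.size, Par.count]
    split_ifs
    · have := ihq env
      have := q.count_pos (ω := ω) (M := M) env
      nlinarith [Nat.zero_le (p.size * q.count ω M env), Nat.zero_le (c.size * (q.count ω M env - 1)),
        Nat.mul_le_mul_left (c.size + 1) this]
    · have := ihp env
      have := p.count_pos (ω := ω) (M := M) env
      nlinarith [Nat.zero_le (q.size * p.count ω M env), Nat.mul_le_mul_left (c.size + 1) this]
  | both p q ihp ihq =>
    simp only [Par.work, Par.size, Par.count]
    have := ihp env
    have := ihq env
    have := p.count_pos (ω := ω) (M := M) env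
    nlinarith [Nat.zero_le (q.size * p.count ω M env), Nat.zero_le (p.size * q.count ω M env)]
  | parfor N p ih =>
    simp only [Par.work, Par.size, Par.count]
    have : ∑ i ∈ Finset.range (N.eval ω env M), p.work ω M (i :: env) ≤
        p.size * ∑ i ∈ Finset.range (N.eval ω env M), p.count ω M (i :: env) := by
      rw [Finset.mul_sum]
      exact Finset.sum_le_sum fun i _ => ih _
    nlinarith [Nat.zero_le ((N.size + 1) *
      ∑ i ∈ Finset.range (N.eval ω env M), p.count ω M (i :: env))]

theorem Par.depth_le (p : Par) (env : List ℕ) : p.depth ω M env ≤ p.size := by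
  induction p generalizing env with
  | skip => simp [Par.depth, Par.size]
  | write a i v => simp [Par.depth, Par.size]
  | fetchAdd a i v b j => simp [Par.depth, Par.size]
  | cond c p q ihp ihq =>
    simp only [Par.depth, Par.size]
    have := ihp env
    have := ihq env
    split_ifs <;> omega
  | both p q ihp ihq =>
    simp only [Par.depth, Par.size]
    have := ihp env
    have := ihq env
    omega
  | parfor N p ih =>
    simp only [Par.depth, Par.size]
    have := Finset.sup_le (s := Finset.range (N.eval ω env M))
      (f := fun i => p.depth ω M (i :: env)) (a := p.size) fun i _ => ih _
    omega

/-! ### Total correctness with costs -/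

/-- Started on the memory `M`, the command `c` halts with a memory `M'` and costs of at most `W`
work and `D` depth such that `Q M' W D`. -/
def wp (σ : Scheduler) (ω : ℕ → Fin (2 ^ w)) (c : Cmd) (Q : Mem → ℕ → ℕ → Prop) (M : Mem) : Prop :=
  ∀ s : State, s.mem = M → ∃ s' W D, Exec σ ω c s s' ∧ Q s'.mem W D ∧
    s'.work ≤ s.work + W ∧ s'.depth ≤ s.depth + D

theorem wp_mono {c : Cmd} {Q Q' : Mem → ℕ → ℕ → Prop} (h : wp σ ω c Q M)
    (hQ : ∀ M' W D, Q M' W D → Q' M' W D) : wp σ ω c Q' M := fun s hs => by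
  obtain ⟨s', W, D, h1, h2, h3⟩ := h s hs
  exact ⟨s', W, D, h1, hQ _ _ _ h2, h3⟩

theorem wp_par {p : Par} {Q : Mem → ℕ → ℕ → Prop} {N : ℕ} (hN : p.count ω M [] ≤ N)
    (h : ∀ M', Eff w (p.reqs ω M []) M M' → Q M' (p.size * N) p.size) :
    wp σ ω (.par p) Q M := by
  rintro s rfl
  refine ⟨_, _, _, Exec.par p s, h _ ⟨_, σ.perm s _, rfl⟩, ?_, ?_⟩
  · exact Nat.add_le_add_left ((p.work_le []).trans (Nat.mul_le_mul_left _ hN)) _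
  · exact Nat.add_le_add_left (p.depth_le []) _

theorem wp_seq {c c' : Cmd} {Q : Mem → ℕ → ℕ → Prop}
    (h : wp σ ω c (fun M1 W1 D1 => wp σ ω c' (fun M2 W2 D2 => Q M2 (W1 + W2) (D1 + D2)) M1) M) :
    wp σ ω (.seq c c') Q M := fun s hs => by
  obtain ⟨s1, W1, D1, e1, h1, w1, d1⟩ := h s hs
  obtain ⟨s2, W2, D2, e2, h2, w2, d2⟩ := h1 s1 rfl
  exact ⟨s2, _, _, Exec.seq e1 e2, h2, by omega, by omega⟩

theorem wp_cond {e : Expr} {c c' : Cmd} {Q : Mem → ℕ → ℕ → Prop}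
    (h1 : e.eval ω [] M ≠ 0 → wp σ ω c (fun M1 W1 D1 => Q M1 (e.size + W1) (e.size + D1)) M)
    (h2 : e.eval ω [] M = 0 → wp σ ω c' (fun M1 W1 D1 => Q M1 (e.size + W1) (e.size + D1)) M) :
    wp σ ω (.cond e c c') Q M := by
  rintro s rfl
  by_cases he : e.eval ω [] s.mem = 0
  · obtain ⟨s1, W1, D1, x, q, wk, dp⟩ := h2 he (s.charge e) rfl
    simp only [State.charge] at wk dp
    exact ⟨s1, _, _, Exec.condFalse he x, q, by omega, by omega⟩
  · obtain ⟨s1, W1, D1, x, q, wk, dp⟩ := h1 he (s.charge e) rfl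
    simp only [State.charge] at wk dp
    exact ⟨s1, _, _, Exec.condTrue he x, q, by omega, by omega⟩

/-- Loops: the invariant `I` sees the costs accumulated so far, and `μ` decreases. -/
theorem wp_loop {e : Expr} {c : Cmd} (I : Mem → ℕ → ℕ → Prop) (μ : Mem → ℕ)
    (hbody : ∀ M W D, I M W D → e.eval ω [] M ≠ 0 → wp σ ω c (fun M' W' D' =>
      I M' (W + (e.size + W')) (D + (e.size + D')) ∧ μ M' < μ M) M)
    {Q : Mem → ℕ → ℕ → Prop}
    (hexit : ∀ M W D, I M W D → e.eval ω [] M = 0 → Q M (W + e.size) (D + e.size))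
    (h0 : I M 0 0) : wp σ ω (.loop e c) Q M := by
  suffices H : ∀ k M W D, μ M ≤ k → I M W D →
      wp σ ω (.loop e c) (fun M' W' D' => Q M' (W + W') (D + D')) M by
    simpa using H (μ M) M 0 0 le_rfl h0
  intro k
  induction k with
  | zero =>
    rintro _ W D hk hI s rfl
    by_cases he : e.eval ω [] s.mem = 0
    · exact ⟨_, _, _, Exec.loopFalse he, hexit _ _ _ hI he, le_rfl, le_rfl⟩
    · obtain ⟨s1, W1, D1, _, q, _⟩ := hbody _ _ _ hI he (s.charge e) rfl
      omega
  | succ k ih =>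
    rintro _ W D hk hI s rfl
    by_cases he : e.eval ω [] s.mem = 0
    · exact ⟨_, _, _, Exec.loopFalse he, hexit _ _ _ hI he, le_rfl, le_rfl⟩
    · obtain ⟨s1, W1, D1, x, q, wk, dp⟩ := hbody _ _ _ hI he (s.charge e) rfl
      obtain ⟨s2, W2, D2, x2, q2, wk2, dp2⟩ := ih s1.mem _ _ (by omega) q.1 s1 rfl
      simp only [State.charge] at wk dp
      refine ⟨s2, e.size + W1 + W2, e.size + D1 + D2, Exec.loopTrue he x x2, ?_,
        by omega, by omega⟩
      simpa only [add_assoc] using q2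

/-! ### Notation for expressions -/

instance (k : ℕ) : OfNat Expr k := ⟨.const k⟩
instance : Add Expr := ⟨.op .add⟩
instance : Sub Expr := ⟨.op .sub⟩
instance : Mul Expr := ⟨.op .mul⟩
instance : Div Expr := ⟨.op .div⟩

section Eval

variable (env : List ℕ) (x y : Expr) (k a : ℕ)

@[simp] theorem eval_zero : (0 : Expr).eval ω env M = 0 := rfl
@[simp] theorem eval_one : (1 : Expr).eval ω env M = 1 := rfl
@[simp] theorem eval_two : (2 : Expr).eval ω env M = 2 := rfl
@[simp] theorem eval_add : (x + y).eval ω env M = x.eval ω env M + y.eval ω env M := rfl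
@[simp] theorem eval_sub : (x - y).eval ω env M = x.eval ω env M - y.eval ω env M := rfl
@[simp] theorem eval_mul : (x * y).eval ω env M = x.eval ω env M * y.eval ω env M := rfl
@[simp] theorem eval_div : (x / y).eval ω env M = x.eval ω env M / y.eval ω env M := rfl
@[simp] theorem eval_lt : (Expr.op .lt x y).eval ω env M =
    if x.eval ω env M < y.eval ω env M then 1 else 0 := rfl
@[simp] theorem eval_eq : (Expr.op .eq x y).eval ω env M =
    if x.eval ω env M = y.eval ω env M then 1 else 0 := rfl
@[simp] theorem eval_read : (Expr.read a x).eval ω env M = M a (x.eval ω env M) := rfl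
@[simp] theorem eval_idx_zero : (Expr.idx 0).eval ω (k :: env) M = k := rfl
@[simp] theorem eval_idx_one (b : ℕ) : (Expr.idx 1).eval ω (a :: b :: env) M = b := rfl

@[simp] theorem size_zero : (0 : Expr).size = 1 := rfl
@[simp] theorem size_one : (1 : Expr).size = 1 := rfl
@[simp] theorem size_two : (2 : Expr).size = 1 := rfl
@[simp] theorem size_add : (x + y).size = x.size + y.size + 1 := rfl
@[simp] theorem size_sub : (x - y).size = x.size + y.size + 1 := rfl
@[simp] theorem size_mul : (x * y).size = x.size + y.size + 1 := rfl
@[simp] theorem size_div : (x / y).size = x.size + y.size + 1 := rfl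

end Eval

end Steps

section Search

variable {w : ℕ} {σ : Scheduler} {ω : ℕ → Fin (2 ^ w)} {M M' : Mem}

/-! ### Doubling search -/

/-- Raise the flag `21` if the event `ev` occurs at an offset in the current block. -/
def checkBlock (ev : Expr → Expr) : Par :=
  .parfor (.read 20 0) (.cond (ev (.read 19 0 + .idx 0)) (.write 21 0 1) .skip)

/-- Find the least offset at which the event `ev` occurs, and store it in array `19`. Blocks of
doubling length (in array `20`) are tested until one contains an event; halving the length then
locates the first event. -/
def search (ev : Expr → Expr) : Cmd :=
  .seq (.par (.both (.write 19 0 0) (.both (.write 20 0 1) (.write 21 0 0))))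
  (.seq (.par (checkBlock ev))
  (.seq (.loop (.op .eq (.read 21 0) 0)
    (.seq (.par (.both (.write 19 0 (.read 19 0 + .read 20 0))
      (.write 20 0 (.read 20 0 + .read 20 0)))) (.par (checkBlock ev))))
  (.loop (.op .lt 1 (.read 20 0))
    (.seq (.par (.both (.write 21 0 0) (.write 20 0 (.read 20 0 / 2))))
    (.seq (.par (checkBlock ev))
    (.par (.cond (.read 21 0) .skip (.write 19 0 (.read 19 0 + .read 20 0)))))))))

/-- `M'` agrees with `M` outside the arrays of the doubling search. -/
def SearchFrame (M M' : Mem) : Prop := ∀ a, a ≠ 19 → a ≠ 20 → a ≠ 21 → M' a = M a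

/-- The expression `ev` tests whether the event `E` occurs at an offset. -/
def Tests (ω : ℕ → Fin (2 ^ w)) (M : Mem) (ev : Expr → Expr) (E : ℕ → Prop) : Prop :=
  ∀ M', SearchFrame M M' → ∀ e env, (ev e).eval ω env M' ≠ 0 ↔ E (e.eval ω env M')

theorem checkBlock_effect {ev : Expr → Expr} {E : ℕ → Prop} {M0 : Mem} (hE : Tests ω M0 ev E)
    (hM : SearchFrame M0 M) (hw : 1 < 2 ^ w) (hf : M 21 0 = 0)
    (h : Eff w ((checkBlock ev).reqs ω M []) M M') :
    (∀ a, a ≠ 21 → M' a = M a) ∧ (M' 21 0 ≠ 0 ↔ ∃ i < M 20 0, E (M 19 0 + i)) := by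
  have h21 : ∀ i v, (checkBlock ev).Issues ω M (.write 21 i v) [] ↔
      (i = 0 ∧ v = 1 ∧ ∃ i < M 20 0, E (M 19 0 + i)) := by
    intro i v
    simp only [checkBlock, Par.Issues, hE M hM, Req.write.injEq]
    simp
    tauto
  refine ⟨fun a ha => Par.frame h (by simp [checkBlock, Par.wrt, Par.ctr, Par.res, ha]), ?_⟩
  have hc : 21 ∉ (checkBlock ev).ctr ++ (checkBlock ev).res := by
    simp [checkBlock, Par.ctr, Par.res]
  rcases Par.written (i := 0) h hc with ⟨v, hv, he⟩ | ⟨hn, he⟩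
  · obtain ⟨_, rfl, hx⟩ := (h21 0 v).1 hv
    rw [he, Nat.mod_eq_of_lt hw]
    simpa using hx
  · rw [he, hf]
    simp only [ne_eq, not_true_eq_false, false_iff]
    intro hx
    exact hn 1 ((h21 0 1).2 ⟨rfl, rfl, hx⟩)

theorem checkBlock_count (ev : Expr → Expr) : (checkBlock ev).count ω M [] ≤ 1 + M 20 0 := by
  simp only [checkBlock, Par.count, eval_read, eval_zero, ite_self]
  simp

/-- The search for the event at offset `o` costs `O(o + 1)` work, by the geometric growth of the
blocks, and `O(log (o + 1))` depth. -/
theorem wp_search {ev : Expr → Expr} {E : ℕ → Prop} {o : ℕ} (hE : Tests ω M ev E)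
    (ho : E o) (hlt : ∀ i < o, ¬ E i) (hw : 4 * (o + 1) < 2 ^ w) :
    wp σ ω (search ev) (fun M' W D => M' 19 0 = o ∧ SearchFrame M M' ∧
      W ≤ 16 * ((checkBlock ev).size + 60) * (o + 1) ∧
      D ≤ 16 * ((checkBlock ev).size + 60) * (Nat.log 2 (o + 1) + 1)) M := by
  set A := (checkBlock ev).size + 60 with hA
  have hw1 : 1 < 2 ^ w := by omega
  refine wp_seq (wp_par le_rfl fun M1 h1 => ?_)
  have f1 : SearchFrame M M1 := fun a h19 h20 h21 =>
    Par.frame h1 (by simp [Par.wrt, Par.ctr, Par.res, h19, h20, h21])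
  have o1 : M1 19 0 = 0 := Par.written_eq h1 (by decide) (by simp [Par.Issues])
    (by simp [Par.Issues]) (by omega)
  have k1 : M1 20 0 = 1 := Par.written_eq h1 (by decide) (by simp [Par.Issues])
    (by simp [Par.Issues]) (by omega)
  have g1 : M1 21 0 = 0 := Par.written_eq h1 (by decide) (by simp [Par.Issues])
    (by simp [Par.Issues]) (by omega)
  refine wp_seq (wp_par (checkBlock_count ev) fun M2 h2 => ?_)
  obtain ⟨f2, g2⟩ := checkBlock_effect hE f1 hw1 g1 h2
  have o2 : M2 19 0 = 0 := by rw [f2 19 (by decide), o1]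
  have k2 : M2 20 0 = 1 := by rw [f2 20 (by decide), k1]
  have f2' : SearchFrame M M2 := fun a h19 h20 h21 => (f2 a h21).trans (f1 a h19 h20 h21)
  refine wp_seq ?_
  -- the doubling phase
  refine wp_loop (fun N W D => SearchFrame M N ∧ ∃ j, N 20 0 = 2 ^ j ∧ N 19 0 + 1 = 2 ^ j ∧
      N 19 0 ≤ o ∧ (N 21 0 ≠ 0 ↔ ∃ i < N 20 0, E (N 19 0 + i)) ∧
      W ≤ 4 * A * 2 ^ j ∧ D ≤ A * j) (fun N => o - N 19 0) ?_ ?_ ?_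
  · rintro N W D ⟨fN, j, hk, hoj, hle, hf, hW, hD⟩ he
    have hf0 : N 21 0 = 0 := by
      by_contra hne
      simp [hne] at he
    have hno : ∀ i < N 20 0, ¬ E (N 19 0 + i) := by
      intro i hi hEi
      exact (hf.2 ⟨i, hi, hEi⟩) hf0
    have hnew : N 19 0 + N 20 0 ≤ o := by
      by_contra hc
      exact hno (o - N 19 0) (by omega) (by rwa [Nat.add_sub_cancel' hle])
    refine wp_seq (wp_par le_rfl fun N1 e1 => ?_)
    have a1 : N1 19 0 = N 19 0 + N 20 0 := Par.written_eq e1 (by decide) (by simp [Par.Issues])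
      (by simp [Par.Issues]) (by omega)
    have a2 : N1 20 0 = N 20 0 + N 20 0 := Par.written_eq e1 (by decide) (by simp [Par.Issues])
      (by simp [Par.Issues]) (by omega)
    have a3 : ∀ a, a ≠ 19 → a ≠ 20 → N1 a = N a := fun a h19 h20 =>
      Par.frame e1 (by simp [Par.wrt, Par.ctr, Par.res, h19, h20])
    have fN1 : SearchFrame M N1 := fun a h19 h20 h21 =>
      (a3 a h19 h20).trans (fN a h19 h20 h21)
    refine wp_par (checkBlock_count ev) fun N2 e2 => ?_
    obtain ⟨b1, b2⟩ := checkBlock_effect hE fN1 hw1 (by rw [a3 21 (by decide) (by decide), hf0]) e2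
    have b19 : N2 19 0 = N 19 0 + N 20 0 := by rw [b1 19 (by decide), a1]
    have b20 : N2 20 0 = N 20 0 + N 20 0 := by rw [b1 20 (by decide), a2]
    refine ⟨⟨fun a h19 h20 h21 => (b1 a h21).trans (fN1 a h19 h20 h21), j + 1, ?_, ?_, ?_, ?_, ?_,
      ?_⟩, ?_⟩
    · rw [b20, hk, pow_succ]; ring
    · rw [b19, pow_succ]; omega
    · rw [b19]; exact hnew
    · rw [b2, b20, b19, a2, a1]
    · rw [a2, hk]
      simp only [Par.size, Expr.size, Par.count, size_zero, size_one, size_two, size_add, size_div]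
      have : 1 ≤ 2 ^ j := Nat.one_le_two_pow
      rw [pow_succ]
      nlinarith
    · simp only [Par.size, Expr.size, size_zero, size_one, size_two, size_add, size_div]
      rw [mul_add]
      omega
    · rw [b19]
      have : 1 ≤ 2 ^ j := Nat.one_le_two_pow
      omega
  · -- the halving phase
    rintro N W D ⟨fN, j, hk, hoj, hle, hf, hW, hD⟩ he
    have hf0 : N 21 0 ≠ 0 := by
      intro hne
      simp [hne] at he
    obtain ⟨i, hi, hEi⟩ := hf.1 hf0
    have hoi : o < N 19 0 + N 20 0 := by
      by_contra hc
      exact hlt (N 19 0 + i) (by omega) hEi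
    have hjo : j ≤ Nat.log 2 (o + 1) := Nat.le_log_of_pow_le (by norm_num) (by omega)
    refine wp_loop (fun N' W' D' => SearchFrame M N' ∧ ∃ i ≤ j, N' 20 0 = 2 ^ i ∧ N' 19 0 ≤ o ∧
      o < N' 19 0 + N' 20 0 ∧ W' + 4 * A * 2 ^ i ≤ 4 * A * 2 ^ j ∧ D' + A * i ≤ A * j)
      (fun N => N 20 0) ?_ ?_ ?_
    · rintro N' W' D' ⟨fN', i, hij, hk', hle', hlt', hW', hD'⟩ he'
      have hi1 : i ≠ 0 := by
        rintro rfl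
        simp [hk'] at he'
      obtain ⟨i, rfl⟩ := Nat.exists_eq_succ_of_ne_zero hi1
      have hpw : 2 ^ i.succ = 2 * 2 ^ i := by rw [pow_succ]; ring
      have hjj : 2 ^ i.succ ≤ 2 ^ j := Nat.pow_le_pow_right (by norm_num) hij
      rw [hpw] at hk' hW' hjj
      have hpos : 1 ≤ 2 ^ i := Nat.one_le_two_pow
      refine wp_seq (wp_par le_rfl fun N1 e1 => ?_)
      have a1 : N1 21 0 = 0 := Par.written_eq e1 (by decide) (by simp [Par.Issues])
        (by simp [Par.Issues]) (by omega)
      have a2 : N1 20 0 = 2 ^ i := Par.written_eq e1 (by decide) (by simp [Par.Issues, hk'])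
        (by simp [Par.Issues, hk']) (by omega)
      have a3 : ∀ a, a ≠ 21 → a ≠ 20 → N1 a = N' a := fun a h19 h20 =>
        Par.frame e1 (by simp [Par.wrt, Par.ctr, Par.res, h19, h20])
      have fN1 : SearchFrame M N1 := fun a h19 h20 h21 =>
        (a3 a h21 h20).trans (fN' a h19 h20 h21)
      refine wp_seq (wp_par (checkBlock_count ev) fun N2 e2 => ?_)
      obtain ⟨b1, b2⟩ := checkBlock_effect hE fN1 hw1 a1 e2
      have b19 : N2 19 0 = N' 19 0 := by rw [b1 19 (by decide), a3 19 (by decide) (by decide)]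
      have b20 : N2 20 0 = 2 ^ i := by rw [b1 20 (by decide), a2]
      rw [a2, a3 19 (by decide) (by decide)] at b2
      refine wp_par le_rfl fun N3 e3 => ?_
      have c3 : ∀ a, a ≠ 19 → N3 a = N2 a := fun a h19 =>
        Par.frame e3 (by simp [Par.wrt, Par.ctr, Par.res, h19])
      have c20 : N3 20 0 = 2 ^ i := by rw [c3 20 (by decide), b20]
      have c19 : N3 19 0 ≤ o ∧ o < N3 19 0 + 2 ^ i := by
        by_cases hN : N2 21 0 = 0
        · have : N3 19 0 = N' 19 0 + 2 ^ i := Par.written_eq e3 (by decide)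
            (by simp [Par.Issues, hN, b19, b20]) (by simp [Par.Issues, hN, b19, b20]) (by omega)
          have hno : N' 19 0 + 2 ^ i ≤ o := by
            by_contra hc
            exact b2.2 ⟨o - N' 19 0, by omega, by rwa [Nat.add_sub_cancel' hle']⟩ hN
          omega
        · have : N3 19 0 = N2 19 0 := Par.not_written e3 (by decide) (by simp [Par.Issues, hN])
          obtain ⟨x, hx, hEx⟩ := b2.1 hN
          have hox : o < N' 19 0 + 2 ^ i := by
            by_contra hc
            exact hlt (N' 19 0 + x) (by omega) hEx
          omega
      refine ⟨⟨fun a h19 h20 h21 => (c3 a h19).trans ((b1 a h21).trans (fN1 a h19 h20 h21)),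
        i, by omega, c20, c19.1, by rw [c20]; exact c19.2, ?_, ?_⟩, ?_⟩
      · simp only [Par.size, Expr.size, Par.count, ite_self,
          size_zero, size_one, size_two, size_add, size_div]
        rw [a2]
        have e1 : 4 * A * (2 * 2 ^ i) = 8 * (A * 2 ^ i) := by ring
        have e2 : 4 * A * 2 ^ i = 4 * (A * 2 ^ i) := by ring
        have e3 : (checkBlock ev).size * (1 + 2 ^ i) =
          (checkBlock ev).size + (checkBlock ev).size * 2 ^ i := by ring
        have e4 : A * 2 ^ i = (checkBlock ev).size * 2 ^ i + 60 * 2 ^ i := by rw [hA]; ring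
        have e5 : (checkBlock ev).size ≤ (checkBlock ev).size * 2 ^ i :=
          Nat.le_mul_of_pos_right _ hpos
        omega
      · simp only [Par.size, Expr.size, size_zero, size_one, size_two, size_add, size_div]
        rw [Nat.succ_eq_add_one, mul_add] at hD'
        omega
      · change N3 20 0 < N' 20 0
        rw [c20, hk']
        omega
    · rintro N' W' D' ⟨fN', i, hij, hk', hle', hlt', hW', hD'⟩ he'
      have hi0 : i = 0 := by
        by_contra hne
        have : 2 ≤ 2 ^ i := Nat.le_self_pow hne 2
        simp [hk'] at he'
        omega
      subst hi0
      rw [hk'] at hlt'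
      refine ⟨by omega, fN', ?_, ?_⟩
      · simp only [Par.size, Expr.size, Par.count, size_zero, size_one, size_two, size_add, size_div]
        rw [k1]
        have e1 : 4 * A * 2 ^ j ≤ 4 * A * (o + 1) := Nat.mul_le_mul_left _ (by omega)
        have e2 : 16 * A * (o + 1) = 4 * A * (o + 1) + 4 * A * (o + 1) + 8 * A * (o + 1) := by ring
        have e3 : 8 * A ≤ 8 * A * (o + 1) := Nat.le_mul_of_pos_right _ (by omega)
        omega
      · simp only [Par.size, Expr.size, size_zero, size_one, size_two, size_add, size_div]
        have e1 : A * j ≤ A * Nat.log 2 (o + 1) := Nat.mul_le_mul_left _ hjo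
        have e2 : 16 * A * (Nat.log 2 (o + 1) + 1) = 16 * (A * Nat.log 2 (o + 1)) + 16 * A := by
          ring
        omega
    · exact ⟨fN, j, le_rfl, hk, hle, hoi, by omega, by omega⟩
  · refine ⟨f2', 0, by simpa using k2, by simp [o2], by omega, ?_, by omega, by omega⟩
    rw [g2, k1, o1, k2, o2]

end Search

/-! ### The program -/

/-!
The memory is used as follows. Array `0` holds `n`, arrays `1` and `2` the adjacency lists, array
`3` the loads, and array `4` a mark at the vertices outside the best subgraph.

* Arrays `5`, `9`, `10`: for each number `x`, how many intervals `[ℓ v, ℓ v + deg v]` contain `x`,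
  the list of these vertices `v`, and their slots in this list.
* Arrays `6`, `7`: for each number, how many vertices have arrived at this key and have left it.
  Keys only decrease, so an arrival at `x - 1` is a departure from `x`.
* Arrays `8`, `11`: for each vertex, the number of its peeled neighbours, and for each edge of a
  peeled vertex, its rank among the removed edges at the other endpoint.
* Arrays `12`, `13`: the position of each vertex in the peeling order, and the order itself.
* Cells `15`, `16`, `17`, `18`: the next threshold, the start and the end of the current batch in
  the order, and the number of vertices in the order.
* Cells `19`, `20`, `21`: the offset, block length and flag of the doubling search.
* Cells `22`, `23`: the number of leaves of the binary trees, and the current level.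
* Arrays `24`, `25`, `26`, `27`: the tree of sums, the sums to the right of a node, the tree of the
  tournament, and the numbers of edges of the remaining graphs.
* Cells `28`, `29`: the numbers of edges and vertices of the best subgraph.
* Array `14` receives fetched values that are not needed.
-/

/-- The number of vertices. -/
def nE : Expr := .read 0 0

/-- The degree of a vertex. -/
def degE (v : Expr) : Expr := .read 1 (v + 1) - .read 1 v

/-- The load of a vertex plus its degree. -/
def baseE (v : Expr) : Expr := .read 3 v + degE v

/-- The next threshold, one more than the current one. -/
def nextE : Expr := .read 15 0

/-- Count the vertices `v` whose interval `[ℓ v, ℓ v + deg v]` contains `x` in cell `x` of array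
`5`, and assign a slot among them to each. Array `6` counts the vertices by `ℓ v + deg v`. -/
def initCount : Par :=
  .both (.parfor nE (.both (.fetchAdd 6 (baseE (.idx 0)) 1 14 0)
    (.parfor (degE (.idx 0) + 1) (.fetchAdd 5 (.read 3 (.idx 1) + .idx 0) 1 10
      (.read 1 (.idx 1) + .idx 1 + .idx 0)))))
  (.both (.write 15 0 0) (.both (.write 16 0 0) (.both (.write 17 0 0) (.write 18 0 0))))

/-- List the vertices whose interval contains `x` in the cells `x * n + j` of array `9`. -/
def initList : Par :=
  .parfor nE (.parfor (degE (.idx 0) + 1) (.write 9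
    ((.read 3 (.idx 1) + .idx 0) * nE + .read 10 (.read 1 (.idx 1) + .idx 1 + .idx 0)) (.idx 1)))

/-- The event at which the rightward search stops: there is a vertex with the key in question, or
no interval contains it. -/
def rightEv (e : Expr) : Expr :=
  (1 - .op .eq (.read 6 (nextE + e)) (.read 7 (nextE + e))) + .op .eq (.read 5 (nextE + e)) 0

/-- The load of the vertex at the current position of the previous peeling order. -/
def jumpE : Expr := .read 3 (.read 13 (.read 16 0))

/-- The event at which the leftward search stops: the left end of a union of intervals. -/
def leftEv (e : Expr) : Expr :=
  .op .eq (jumpE - e) 0 + .op .eq (.read 5 (jumpE - e - 1)) 0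

/-- Advance the threshold to the next event. -/
def advance : Cmd := .seq (search rightEv) (.par (.write 15 0 (nextE + .read 19 0)))

/-- Jump over a gap between the intervals. -/
def jump : Cmd :=
  .seq (search leftEv) (.seq (.par (.write 15 0 (jumpE - .read 19 0))) advance)

/-- The vertex in a slot of the list for the next threshold. -/
def slotE : Expr := .read 9 (nextE * nE + .idx 0)

/-- Test whether the key of the vertex in a slot is the next threshold. -/
def slotTest : Expr := .op .eq (.read 8 slotE + nextE) (baseE slotE)

/-- Hand out positions to the vertices whose key is the next threshold. -/
def collectPos : Par :=
  .parfor (.read 5 nextE) (.cond slotTest (.fetchAdd 18 0 1 12 slotE) .skip)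

/-- Append the vertices whose key is the next threshold to the peeling order. -/
def collectOrd : Par :=
  .both (.parfor (.read 5 nextE) (.cond slotTest (.write 13 (.read 12 slotE) slotE) .skip))
    (.both (.write 17 0 (.read 18 0)) (.write 15 0 (nextE + 1)))

/-- Raise the threshold until there is a vertex to be peeled. -/
def raise : Cmd :=
  .seq advance (.seq (.cond (.op .eq (.read 5 nextE) 0) jump (.par .skip))
    (.seq (.par collectPos) (.par collectOrd)))

/-- A parallel loop over all edges that leave the current batch. -/
def edgeLoop (body : Par) : Par :=
  .parfor (.read 17 0 - .read 16 0) (.parfor (degE (.read 13 (.read 16 0 + .idx 0))) body)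

/-- The edge handled by a thread of `edgeLoop`. -/
def edgeE : Expr := .read 1 (.read 13 (.read 16 0 + .idx 1)) + .idx 0

/-- The endpoint of the edge handled by a thread of `edgeLoop`. -/
def tgtE : Expr := .read 2 edgeE

/-- The key of the endpoint just before the edge of a thread is removed. -/
def keyE : Expr := baseE tgtE - .read 11 edgeE

/-- Count the removed edges at each vertex. -/
def peelCount : Par := edgeLoop (.fetchAdd 8 tgtE 1 11 edgeE)

/-- Update the numbers of vertices that have arrived at and left each key, and hand out positions
to the vertices that fall below the threshold. -/
def peelMove : Par :=
  edgeLoop (.both (.fetchAdd 7 keyE 1 14 0) (.both (.fetchAdd 6 (keyE - 1) 1 14 0)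
    (.cond (.op .eq keyE nextE) (.fetchAdd 18 0 1 12 tgtE) .skip)))

/-- Append the vertices that fall below the threshold to the peeling order, as the next batch. -/
def peelOrd : Par :=
  .both (edgeLoop (.cond (.op .eq keyE nextE) (.write 13 (.read 12 tgtE) tgtE) .skip))
    (.both (.write 16 0 (.read 17 0)) (.write 17 0 (.read 18 0)))

/-- Peel the current batch. -/
def peelRound : Cmd := .seq (.par peelCount) (.seq (.par peelMove) (.par peelOrd))

/-- Compute a parallel peeling order. -/
def peelLoop : Cmd :=
  .loop (.op .lt (.read 16 0) nE)
    (.seq (.cond (.op .eq (.read 16 0) (.read 17 0)) raise (.par .skip)) peelRound)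

/-- Find a power of two that is at least `n`. -/
def findPow : Cmd :=
  .seq (.par (.write 23 0 1))
    (.loop (.op .lt (.read 23 0) nE) (.par (.write 23 0 (.read 23 0 + .read 23 0))))

/-- Clear the leaves of the tree of sums. -/
def clearLeaves : Par :=
  .both (.write 22 0 (.read 23 0)) (.parfor (.read 23 0) (.write 24 (.read 23 0 + .idx 0) 0))

/-- Clear the arrays that the peeling used, and add to the load of each vertex the number of its
neighbours that come later in the peeling order, which is also stored in a leaf of the tree. -/
def addLoads : Par :=
  .parfor nE (.both (.write 8 (.idx 0) 0) (.both
    (.parfor (degE (.idx 0) + 1) (.both (.write 5 (.read 3 (.idx 1) + .idx 0) 0)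
      (.both (.write 6 (.read 3 (.idx 1) + .idx 0) 0) (.write 7 (.read 3 (.idx 1) + .idx 0) 0))))
    (.parfor (degE (.idx 0)) (.cond
      (.op .lt (.read 12 (.idx 1)) (.read 12 (.read 2 (.read 1 (.idx 1) + .idx 0))))
      (.both (.fetchAdd 3 (.idx 1) 1 14 0)
        (.fetchAdd 24 (.read 22 0 + .read 12 (.idx 1)) 1 14 0)) .skip))))

/-- Fill the inner nodes of a binary tree in array `a` from the leaves to the root. Node `m` has
the children `2 * m` and `2 * m + 1`, and `f m` computes its value. -/
def upSweep (a : ℕ) (f : Expr → Expr) : Cmd :=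
  .seq (.par (.write 23 0 (.read 22 0 / 2)))
    (.loop (.op .lt 0 (.read 23 0)) (.par (.both
      (.parfor (.read 23 0) (.write a (.read 23 0 + .idx 0) (f (.read 23 0 + .idx 0))))
      (.write 23 0 (.read 23 0 / 2)))))

/-- The sum of the values at the children of a node. -/
def sumE (m : Expr) : Expr := .read 24 (2 * m) + .read 24 (2 * m + 1)

/-- Compute, for each node of the tree, the sum of the leaves to the right of its subtree. -/
def downSweep : Cmd :=
  .seq (.par (.both (.write 23 0 1) (.write 25 1 0)))
    (.loop (.op .lt (.read 23 0) (.read 22 0)) (.par (.both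
      (.parfor (.read 23 0) (.both
        (.write 25 (2 * (.read 23 0 + .idx 0))
          (.read 25 (.read 23 0 + .idx 0) + .read 24 (2 * (.read 23 0 + .idx 0) + 1)))
        (.write 25 (2 * (.read 23 0 + .idx 0) + 1) (.read 25 (.read 23 0 + .idx 0)))))
      (.write 23 0 (.read 23 0 + .read 23 0)))))

/-- Store the numbers of remaining edges in array `27`, and the leaves of the tree of indices of
densest graphs in array `26`. -/
def storeEdges : Par :=
  .parfor (.read 22 0) (.both
    (.write 27 (.idx 0) (.read 25 (.read 22 0 + .idx 0) + .read 24 (.read 22 0 + .idx 0)))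
    (.write 26 (.read 22 0 + .idx 0) (.idx 0 * .op .lt (.idx 0) nE)))

/-- Test whether the graph after `y` steps of peeling is denser than that after `x` steps. -/
def denserE (x y : Expr) : Expr :=
  .op .lt (.read 27 x * (nE - y)) (.read 27 y * (nE - x))

/-- The better one of the two indices at the children of a node. -/
def betterE (m : Expr) : Expr :=
  denserE (.read 26 (2 * m)) (.read 26 (2 * m + 1)) * .read 26 (2 * m + 1) +
    (1 - denserE (.read 26 (2 * m)) (.read 26 (2 * m + 1))) * .read 26 (2 * m)

/-- In the first iteration, record the size of the graph itself as that of the best subgraph. -/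
def firstBest : Cmd :=
  .cond (.op .eq (.read 29 0) 0) (.par (.both (.write 28 0 (.read 27 0)) (.write 29 0 nE)))
    (.par .skip)

/-- Update the best subgraph. -/
def updateBest : Cmd :=
  .cond (.op .lt (.read 28 0 * (nE - .read 26 1)) (.read 27 (.read 26 1) * .read 29 0))
    (.par (.both (.parfor nE (.write 4 (.idx 0) (.op .lt (.read 12 (.idx 0)) (.read 26 1))))
      (.both (.write 28 0 (.read 27 (.read 26 1))) (.write 29 0 (nE - .read 26 1)))))
    (.par .skip)

/-- One iteration of ParallelGreedy++. -/
def program : Cmd :=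
  .seq (.par initCount) (.seq (.par initList) (.seq peelLoop
    (.seq findPow (.seq (.par clearLeaves) (.seq (.par addLoads)
    (.seq (upSweep 24 sumE) (.seq downSweep (.seq (.par storeEdges)
    (.seq (upSweep 26 betterE) (.seq firstBest updateBest))))))))))

/-! ### Adjacency lists in memory -/

section Rep

variable {n : ℕ} {G : SimpleGraph (Fin n)} [DecidableRel G.Adj]

/-- `st v` is the position where the adjacency list of `v` starts, and `tg e` is the vertex at
position `e` of the concatenated adjacency lists. -/
structure Rep (G : SimpleGraph (Fin n)) [DecidableRel G.Adj] (st : ℕ → ℕ) (tg : ℕ → Fin n) :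
    Prop where
  succ : ∀ v : Fin n, st (v + 1) = st v + G.degree v
  card : ∀ v u : Fin n, ((Finset.range (G.degree v)).filter (fun j => tg (st v + j) = u)).card =
    if G.Adj v u then 1 else 0

/-- The memory holds the adjacency lists. -/
structure InMem (G : SimpleGraph (Fin n)) [DecidableRel G.Adj] (st : ℕ → ℕ) (tg : ℕ → Fin n)
    (M : Mem) : Prop where
  size : M 0 0 = n
  start : ∀ v ≤ n, M 1 v = st v
  target : ∀ v : Fin n, ∀ j < G.degree v, M 2 (st v + j) = tg (st v + j)

variable {st : ℕ → ℕ} {tg : ℕ → Fin n}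

theorem Rep.mono (h : Rep G st tg) {v u : ℕ} (hvu : v ≤ u) (hu : u ≤ n) : st v ≤ st u := by
  induction u, hvu using Nat.le_induction with
  | base => exact le_rfl
  | succ u hvu ih =>
    have := h.succ ⟨u, hu⟩
    simp only at this
    have := ih (by omega)
    omega

theorem Rep.unique (h : Rep G st tg) {v v' : Fin n} {j j' : ℕ} (hj : j < G.degree v)
    (hj' : j' < G.degree v') (he : st v + j = st v' + j') : v = v' ∧ j = j' := by
  have h1 := h.succ v
  have h2 := h.succ v'
  rcases lt_trichotomy v v' with hlt | rfl | hlt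
  · have := h.mono (v := v + 1) (u := v') hlt v'.2.le
    omega
  · exact ⟨rfl, by omega⟩
  · have := h.mono (v := v' + 1) (u := v) hlt v.2.le
    omega

/-- The edges that leave the vertices of `B`, as positions in the adjacency lists. -/
def edgesOf (G : SimpleGraph (Fin n)) [DecidableRel G.Adj] (st : ℕ → ℕ) (B : Finset (Fin n)) :
    Finset ℕ :=
  B.biUnion (fun v => (Finset.range (G.degree v)).image (fun j => st v + j))

theorem mem_edgesOf {B : Finset (Fin n)} {e : ℕ} :
    e ∈ edgesOf G st B ↔ ∃ v ∈ B, ∃ j < G.degree v, e = st v + j := by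
  simp [edgesOf, eq_comm]

theorem Rep.sum_edgesOf (h : Rep G st tg) (B : Finset (Fin n)) (g : ℕ → ℕ) :
    ∑ e ∈ edgesOf G st B, g e = ∑ v ∈ B, ∑ j ∈ Finset.range (G.degree v), g (st v + j) := by
  rw [edgesOf, Finset.sum_biUnion]
  · refine Finset.sum_congr rfl fun v _ => ?_
    rw [Finset.sum_image]
    intro j _ j' _ he
    simpa using he
  · intro v _ v' _ hne
    rw [Function.onFun, Finset.disjoint_left]
    intro e he he'
    simp only [Finset.mem_image, Finset.mem_range] at he he'
    obtain ⟨j, hj, rfl⟩ := he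
    obtain ⟨j', hj', he⟩ := he'
    exact hne (h.unique hj hj' he.symm).1

theorem Rep.card_target (h : Rep G st tg) (B : Finset (Fin n)) (u : Fin n) :
    ((edgesOf G st B).filter (fun e => tg e = u)).card = degIn G B u := by
  rw [Finset.card_filter, h.sum_edgesOf, degIn, Finset.card_filter]
  refine Finset.sum_congr rfl fun v _ => ?_
  rw [← Finset.card_filter, h.card]
  simp only [G.adj_comm]

variable {w : ℕ} {ω : ℕ → Fin (2 ^ w)} {M : Mem}

theorem InMem.degE (h : InMem G st tg M) (hR : Rep G st tg) {e : Expr} {env : List ℕ} {v : Fin n}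
    (hv : e.eval ω env M = v) : (degE e).eval ω env M = G.degree v := by
  simp only [ParGreedy.degE, eval_sub, eval_read, eval_add, eval_one, hv]
  rw [h.start _ v.2, h.start _ v.2.le, hR.succ]
  omega

end Rep

/-! ### Peeling a batch -/

section Peel

variable {n : ℕ} {G : SimpleGraph (Fin n)} [DecidableRel G.Adj] {st : ℕ → ℕ} {tg : ℕ → Fin n}
  {w : ℕ} {σ : Scheduler} {ω : ℕ → Fin (2 ^ w)} {M M' : Mem} {ℓ : Fin n → ℕ}

/-- The key of a vertex, its load plus its degree in the remaining graph, when the vertices of `A`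
have been peeled. -/
def key (G : SimpleGraph (Fin n)) [DecidableRel G.Adj] (ℓ : Fin n → ℕ) (A : Finset (Fin n))
    (v : Fin n) : ℕ :=
  ℓ v + G.degree v - degIn G A v

/-- The number of vertices whose interval `[ℓ v, ℓ v + deg v]` contains `y`. -/
def tot (G : SimpleGraph (Fin n)) [DecidableRel G.Adj] (ℓ : Fin n → ℕ) (y : ℕ) : ℕ :=
  (Finset.univ.filter (fun v => ℓ v ≤ y ∧ y ≤ ℓ v + G.degree v)).card

theorem key_le (A : Finset (Fin n)) (v : Fin n) : key G ℓ A v ≤ ℓ v + G.degree v :=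
  Nat.sub_le _ _

theorem le_key (A : Finset (Fin n)) (v : Fin n) : ℓ v ≤ key G ℓ A v := by
  have := degIn_le_degree (G := G) A v
  rw [key]
  omega

theorem key_anti {A B : Finset (Fin n)} (h : A ⊆ B) (v : Fin n) : key G ℓ B v ≤ key G ℓ A v :=
  Nat.sub_le_sub_left (degIn_mono h v) _

theorem degIn_union {A B : Finset (Fin n)} (h : Disjoint A B) (v : Fin n) :
    degIn G (A ∪ B) v = degIn G A v + degIn G B v := by
  rw [degIn, Finset.filter_union, Finset.card_union_of_disjoint (Finset.disjoint_filter_filter h)]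
  rfl

theorem key_eq_compl (A : Finset (Fin n)) (v : Fin n) :
    key G ℓ A v = ℓ v + degIn G (Finset.univ \ A) v := by
  have h : degIn G (A ∪ (Finset.univ \ A)) v = degIn G A v + degIn G (Finset.univ \ A) v :=
    degIn_union Finset.disjoint_sdiff v
  rw [Finset.union_sdiff_of_subset (Finset.subset_univ A), degIn_univ] at h
  rw [key]
  omega

theorem card_le_n (p : Fin n → Prop) [DecidablePred p] : (Finset.univ.filter p).card ≤ n :=
  (Finset.card_le_univ _).trans_eq (Fintype.card_fin n)

theorem degree_lt (v : Fin n) : G.degree v < n := by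
  simpa using G.degree_lt_card_verts v

/-- The part of the memory that does not change during the peeling: the graph, the loads, and the
lists of the vertices whose interval contains a given number. -/
structure Static (G : SimpleGraph (Fin n)) [DecidableRel G.Adj] (st : ℕ → ℕ) (tg : ℕ → Fin n)
    (ℓ : Fin n → ℕ) (M : Mem) : Prop where
  inMem : InMem G st tg M
  load : ∀ v : Fin n, M 3 v = ℓ v
  count : ∀ y, M 5 y = tot G ℓ y
  list : ∀ v y, ℓ v ≤ y → y ≤ ℓ v + G.degree v → ∃ j < tot G ℓ y, M 9 (y * n + j) = v

theorem InMem.congr (h : InMem G st tg M) (h0 : M' 0 = M 0) (h1 : M' 1 = M 1) (h2 : M' 2 = M 2) :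
    InMem G st tg M' :=
  ⟨by rw [h0]; exact h.size, by rw [h1]; exact h.start, by rw [h2]; exact h.target⟩

theorem Static.congr (h : Static G st tg ℓ M)
    (hM : ∀ a, a ∈ [0, 1, 2, 3, 5, 9] → M' a = M a) : Static G st tg ℓ M' :=
  ⟨h.inMem.congr (hM 0 (by decide)) (hM 1 (by decide)) (hM 2 (by decide)),
    by rw [hM 3 (by decide)]; exact h.load, by rw [hM 5 (by decide)]; exact h.count,
    by rw [hM 9 (by decide)]; exact h.list⟩

theorem Static.baseE (h : Static G st tg ℓ M) (hR : Rep G st tg) {e : Expr} {env : List ℕ}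
    {v : Fin n} (hv : e.eval ω env M = v) :
    (baseE e).eval ω env M = ℓ v + G.degree v := by
  rw [ParGreedy.baseE, eval_add, h.inMem.degE hR hv, eval_read, hv, h.load]

/-- The vertices in `P` from position `lo` on are the current batch. -/
structure Batch (G : SimpleGraph (Fin n)) [DecidableRel G.Adj] (st : ℕ → ℕ) (tg : ℕ → Fin n)
    (P : List (Fin n)) (lo : ℕ) (M : Mem) : Prop where
  inMem : InMem G st tg M
  ord : ∀ i, ∀ h : i < P.length, M 13 i = P[i]
  nodup : P.Nodup
  loMem : M 16 0 = lo
  hiMem : M 17 0 = P.length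
  le : lo ≤ P.length

variable {P : List (Fin n)} {lo : ℕ}

theorem Batch.congr (h : Batch G st tg P lo M)
    (hM : ∀ a, a ∈ [0, 1, 2, 13, 16, 17] → M' a = M a) : Batch G st tg P lo M' :=
  ⟨h.inMem.congr (hM 0 (by decide)) (hM 1 (by decide)) (hM 2 (by decide)),
    by rw [hM 13 (by decide)]; exact h.ord, h.nodup, by rw [hM 16 (by decide)]; exact h.loMem,
    by rw [hM 17 (by decide)]; exact h.hiMem, h.le⟩

/-- The vertices of the current batch. -/
def batch (P : List (Fin n)) (lo : ℕ) : Finset (Fin n) := (P.drop lo).toFinset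

/-- The vertices of the earlier batches. -/
def peeled (P : List (Fin n)) (lo : ℕ) : Finset (Fin n) := (P.take lo).toFinset

theorem peeled_union_batch (P : List (Fin n)) (lo : ℕ) :
    peeled P lo ∪ batch P lo = P.toFinset := by
  rw [peeled, batch, ← List.toFinset_append, List.take_append_drop]

theorem disjoint_peeled_batch (h : P.Nodup) (lo : ℕ) : Disjoint (peeled P lo) (batch P lo) := by
  rw [peeled, batch, List.disjoint_toFinset_iff_disjoint]
  rw [← List.take_append_drop lo P] at h
  exact (List.nodup_append'.1 h).2.2

theorem sum_list {L : List (Fin n)} (hL : L.Nodup) {f : Fin n → ℕ} {g : ℕ → ℕ}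
    (h : ∀ i, ∀ hi : i < L.length, g i = f L[i]) :
    ∑ i ∈ Finset.range L.length, g i = ∑ v ∈ L.toFinset, f v := by
  rw [List.sum_toFinset _ hL, Finset.sum_range, ← Fin.sum_univ_fun_getElem]
  exact Finset.sum_congr rfl fun i _ => h i i.2

theorem Batch.mem (h : Batch G st tg P lo M) {v : Fin n} :
    v ∈ batch P lo ↔ ∃ i < M 17 0 - M 16 0, M 13 (M 16 0 + i) = v := by
  rw [batch, List.mem_toFinset, List.mem_drop_iff_getElem, h.hiMem, h.loMem]
  constructor
  · rintro ⟨i, hi, rfl⟩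
    exact ⟨i, by omega, by rw [h.ord _ (by omega)]⟩
  · rintro ⟨i, hi, he⟩
    rw [h.ord _ (by omega)] at he
    exact ⟨i, by omega, Fin.ext he⟩

theorem Batch.get (h : Batch G st tg P lo M) {i : ℕ} (hi : i < M 17 0 - M 16 0) :
    ∃ v ∈ batch P lo, M 13 (M 16 0 + i) = v := by
  have hi' : i < P.length - lo := by rwa [h.hiMem, h.loMem] at hi
  have := h.ord (lo + i) (by omega)
  have := (congrArg (fun x => M 13 (x + i)) h.loMem).trans this
  exact ⟨_, h.mem.2 ⟨i, hi, this⟩, this⟩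

theorem Batch.sum (h : Batch G st tg P lo M) {f : Fin n → ℕ} {g : ℕ → ℕ}
    (hg : ∀ i, ∀ v ∈ batch P lo, M 13 (M 16 0 + i) = v → g i = f v) :
    ∑ i ∈ Finset.range (M 17 0 - M 16 0), g i = ∑ v ∈ batch P lo, f v := by
  rw [h.hiMem, h.loMem, ← List.length_drop]
  refine sum_list (h.nodup.sublist (List.drop_sublist _ _)) fun i hi => ?_
  rw [List.length_drop] at hi
  have := h.ord (lo + i) (by omega)
  rw [List.getElem_drop]
  refine hg i _ ?_ (by rw [h.loMem, this])
  rw [h.mem]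
  exact ⟨i, by rw [h.hiMem, h.loMem]; exact hi, by rw [h.loMem, this]⟩

theorem edgeLoop_total (h : Batch G st tg P lo M) (hR : Rep G st tg) {body : Par} {f : Req → ℕ}
    {g : ℕ → ℕ} (hb : ∀ i j, ∀ v : Fin n, M 13 (M 16 0 + i) = v → j < G.degree v →
      body.total ω M f [j, i] = g (st v + j)) :
    (edgeLoop body).total ω M f [] = ∑ e ∈ edgesOf G st (batch P lo), g e := by
  rw [hR.sum_edgesOf]
  simp only [edgeLoop, Par.total, eval_sub, eval_read, eval_zero]
  refine h.sum fun i v _ hv => ?_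
  rw [h.inMem.degE hR (v := v) (by simp [hv])]
  exact Finset.sum_congr rfl fun j hj => hb i j v hv (Finset.mem_range.1 hj)

theorem edgeLoop_issues (h : Batch G st tg P lo M) (hR : Rep G st tg) {body : Par} {r : Req}
    {Φ : ℕ → Prop} (hb : ∀ i j, ∀ v : Fin n, M 13 (M 16 0 + i) = v → j < G.degree v →
      (body.Issues ω M r [j, i] ↔ Φ (st v + j))) :
    (edgeLoop body).Issues ω M r [] ↔ ∃ e ∈ edgesOf G st (batch P lo), Φ e := by
  simp only [edgeLoop, Par.Issues, eval_sub, eval_read, eval_zero, mem_edgesOf]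
  constructor
  · rintro ⟨i, hi, j, hj, hr⟩
    obtain ⟨v, hv, he⟩ := h.get hi
    rw [h.inMem.degE hR (v := v) (by simp [he])] at hj
    exact ⟨_, ⟨v, hv, j, hj, rfl⟩, (hb i j v he hj).1 hr⟩
  · rintro ⟨_, ⟨v, hv, j, hj, rfl⟩, hr⟩
    obtain ⟨i, hi, he⟩ := h.mem.1 hv
    refine ⟨i, hi, j, ?_, (hb i j v he hj).2 hr⟩
    rw [h.inMem.degE hR (v := v) (by simp [he])]
    exact hj

theorem edgeLoop_count (h : Batch G st tg P lo M) (hR : Rep G st tg) {body : Par}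
    (hb : ∀ env, body.count ω M env ≤ 3) :
    (edgeLoop body).count ω M [] ≤ 1 + ∑ v ∈ batch P lo, 3 * (G.degree v + 1) := by
  simp only [edgeLoop, Par.count, eval_sub, eval_read, eval_zero]
  refine Nat.add_le_add_left (le_of_le_of_eq (Finset.sum_le_sum (g := fun i =>
    1 + 3 * (degE (.read 13 (.read 16 0 + .idx 0))).eval ω [i] M) fun i _ => ?_)
    (h.sum (f := fun v => 1 + 3 * G.degree v) fun i v _ hv => ?_) |>.trans ?_) _
  · refine Nat.add_le_add_left ((Finset.sum_le_sum fun j _ => hb _).trans_eq ?_) _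
    rw [Finset.sum_const, Finset.card_range, smul_eq_mul, mul_comm]
  · rw [h.inMem.degE hR (v := v) (by simp [hv])]
  · exact Finset.sum_le_sum fun v _ => by omega

theorem Batch.edgeE (h : Batch G st tg P lo M) {i j : ℕ} {v : Fin n}
    (hv : M 13 (M 16 0 + i) = v) : edgeE.eval ω [j, i] M = st v + j := by
  simp [ParGreedy.edgeE, hv, h.inMem.start v v.2.le]

theorem Batch.tgtE (h : Batch G st tg P lo M) {i j : ℕ} {v : Fin n}
    (hv : M 13 (M 16 0 + i) = v) (hj : j < G.degree v) :
    tgtE.eval ω [j, i] M = tg (st v + j) := by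
  rw [ParGreedy.tgtE, eval_read, h.edgeE hv, h.inMem.target v j hj]

/-- The values fetched by the edges that leave the batch: at each vertex, they are the numbers from
its old to its new number of peeled neighbours. -/
structure Fetched (G : SimpleGraph (Fin n)) [DecidableRel G.Adj] (st : ℕ → ℕ) (tg : ℕ → Fin n)
    (P : List (Fin n)) (lo : ℕ) (r : ℕ → ℕ) : Prop where
  range : ∀ e ∈ edgesOf G st (batch P lo),
    degIn G (peeled P lo) (tg e) ≤ r e ∧ r e < degIn G P.toFinset (tg e)
  inj : ∀ e ∈ edgesOf G st (batch P lo), ∀ e' ∈ edgesOf G st (batch P lo),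
    tg e = tg e' → r e = r e' → e = e'
  surj : ∀ u c, degIn G (peeled P lo) u ≤ c → c < degIn G P.toFinset u →
    ∃ e ∈ edgesOf G st (batch P lo), tg e = u ∧ r e = c

theorem peelCount_effect (h : Batch G st tg P lo M) (hR : Rep G st tg) (hn : n < 2 ^ w)
    (hdec : ∀ v : Fin n, M 8 v = degIn G (peeled P lo) v)
    (he : Eff w (peelCount.reqs ω M []) M M') :
    (∀ a, a ≠ 8 → a ≠ 11 → M' a = M a) ∧ (∀ v : Fin n, M' 8 v = degIn G P.toFinset v) ∧
      Fetched G st tg P lo (M' 11) := by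
  have htot : ∀ i, peelCount.total ω M (Req.inc 8 i) [] =
      ∑ e ∈ edgesOf G st (batch P lo), if (tg e : ℕ) = i then 1 else 0 := fun i => by
    refine edgeLoop_total h hR fun i' j v hv hj => ?_
    simp [Par.total, Req.inc, h.tgtE hv hj]
  have hunion : ∀ v, degIn G P.toFinset v = degIn G (peeled P lo) v + degIn G (batch P lo) v := by
    intro v
    rw [← peeled_union_batch P lo, degIn_union (disjoint_peeled_batch h.nodup lo)]
  have htot' : ∀ v : Fin n, peelCount.total ω M (Req.inc 8 v) [] = degIn G (batch P lo) v := by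
    intro v
    rw [htot, ← hR.card_target, Finset.card_filter]
    simp [Fin.ext_iff]
  have hlt : ∀ i, peelCount.total ω M (Req.inc 8 i) [] ≠ 0 →
      M 8 i + peelCount.total ω M (Req.inc 8 i) [] < 2 ^ w := by
    intro i hi
    rw [htot] at hi
    obtain ⟨e, _, hne⟩ := Finset.exists_ne_zero_of_sum_ne_zero hi
    have hei : (tg e : ℕ) = i := by
      by_contra hc
      simp [hc] at hne
    subst hei
    rw [htot', hdec, ← hunion]
    have := degIn_le_degree (G := G) P.toFinset (tg e)
    have := degree_lt (G := G) (tg e)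
    omega
  have hctr : ∀ v : Fin n, M' 8 v = degIn G P.toFinset v := by
    intro v
    rw [Par.counter he (by decide), htot', hdec, ← hunion]
    rw [htot', hdec, ← hunion]
    have := degIn_le_degree (G := G) P.toFinset v
    have := degree_lt (G := G) v
    omega
  have htick := Par.tickets (a := 8) (b := 11) he (by decide) (by decide) (by decide) (by decide)
    hlt (fun j => by
      have : peelCount.total ω M (Req.hit 11 j) [] =
          ∑ e ∈ edgesOf G st (batch P lo), if e = j then 1 else 0 := by
        refine edgeLoop_total h hR fun i' j v hv hj => ?_
        simp [Par.total, Req.hit, h.edgeE hv]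
      rw [this, Finset.sum_ite_eq']
      split_ifs <;> simp)
  have hiss : ∀ i j, Req.fetchAdd 8 i 1 11 j ∈ peelCount.reqs ω M [] ↔
      ∃ e ∈ edgesOf G st (batch P lo), (tg e : ℕ) = i ∧ e = j := by
    intro i j
    rw [Par.mem_reqs]
    refine edgeLoop_issues h hR fun i' j' v hv hj => ?_
    simp only [Par.Issues, Req.fetchAdd.injEq, h.tgtE hv hj, h.edgeE hv, eval_one]
    simp [eq_comm]
  refine ⟨fun a h8 h11 => Par.frame he (by
    simp [peelCount, edgeLoop, Par.wrt, Par.ctr, Par.res, h8, h11]), hctr, ?_, ?_, ?_⟩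
  · intro e hE
    have := htick.range (tg e) e ((hiss _ _).2 ⟨e, hE, rfl, rfl⟩)
    rwa [hdec, hctr] at this
  · intro e hE e' hE' ht hr
    exact htick.inj (tg e) e e' ((hiss _ _).2 ⟨e, hE, rfl, rfl⟩)
      ((hiss _ _).2 ⟨e', hE', by rw [ht], rfl⟩) hr
  · intro u c h1 h2
    rw [← hdec] at h1
    rw [← hctr] at h2
    obtain ⟨j, hj, hc⟩ := htick.surj u c h1 h2
    obtain ⟨e, hE, he1, rfl⟩ := (hiss _ _).1 hj
    exact ⟨e, hE, Fin.ext he1, hc⟩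

/-- Each vertex passes each key between its old and its new one exactly once. -/
theorem Fetched.card {r : ℕ → ℕ} (h : Fetched G st tg P lo r) (y : ℕ) :
    ((edgesOf G st (batch P lo)).filter
      (fun e => ℓ (tg e) + G.degree (tg e) - r e = y)).card =
    (Finset.univ.filter
      (fun u => key G ℓ P.toFinset u < y ∧ y ≤ key G ℓ (peeled P lo) u)).card := by
  refine Finset.card_bij (fun e _ => tg e) ?_ ?_ ?_
  · intro e he
    rw [Finset.mem_filter] at he
    have := he.2
    have := h.range e he.1
    have := degIn_le_degree (G := G) P.toFinset (tg e)
    rw [Finset.mem_filter]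
    simp only [Finset.mem_univ, true_and, key]
    omega
  · intro e he e' he' ht
    rw [Finset.mem_filter] at he he'
    have h1 := h.range e he.1
    have h2 := h.range e' he'.1
    have := degIn_le_degree (G := G) P.toFinset (tg e)
    refine h.inj e he.1 e' he'.1 ht ?_
    rw [ht] at this he h1
    omega
  · intro u hu
    rw [Finset.mem_filter] at hu
    simp only [Finset.mem_univ, true_and, key] at hu
    have := degIn_le_degree (G := G) P.toFinset u
    obtain ⟨e, he, rfl, hr⟩ := h.surj u (ℓ u + G.degree u - y) (by omega) (by omega)
    exact ⟨e, Finset.mem_filter.2 ⟨he, by omega⟩, rfl⟩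

/-- The positions handed out to the vertices of `U` are the numbers from `c` to `c'`. -/
structure Positions (U : Fin n → Prop) (c c' : ℕ) (pos : ℕ → ℕ) : Prop where
  range : ∀ u, U u → c ≤ pos u ∧ pos u < c'
  inj : ∀ u v, U u → U v → pos u = pos v → u = v
  surj : ∀ i, c ≤ i → i < c' → ∃ u, U u ∧ pos u = i

theorem Positions.list {U : Fin n → Prop} {c c' : ℕ} {pos : ℕ → ℕ}
    (h : Positions U c c' pos) (hc : c ≤ c') : ∃ Q : List (Fin n), Q.Nodup ∧ (∀ u, u ∈ Q ↔ U u) ∧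
      c' = c + Q.length ∧ ∀ i, ∀ hi : i < Q.length, pos Q[i] = c + i := by
  have hs : ∀ i : Fin (c' - c), ∃ u, U u ∧ pos u = c + i := fun i =>
    h.surj (c + i) (by omega) (by omega)
  choose f hf using hs
  refine ⟨List.ofFn f, ?_, ?_, ?_, ?_⟩
  · rw [List.nodup_ofFn]
    intro i j hij
    have h1 := (hf i).2
    have h2 := (hf j).2
    rw [hij] at h1
    exact Fin.ext (by omega)
  · intro u
    rw [List.mem_ofFn]
    constructor
    · rintro ⟨i, rfl⟩
      exact (hf i).1
    · intro hu
      have := h.range u hu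
      refine ⟨⟨pos u - c, by omega⟩, h.inj _ _ (hf _).1 hu ?_⟩
      rw [(hf _).2]
      simp only
      omega
  · rw [List.length_ofFn]
    omega
  · intro i hi
    rw [List.getElem_ofFn]
    exact (hf _).2

theorem sum_ite_le_one {s : Finset ℕ} {p : ℕ → Prop} [DecidablePred p]
    (h : ∀ x ∈ s, ∀ y ∈ s, p x → p y → x = y) : ∑ x ∈ s, (if p x then 1 else 0) ≤ 1 := by
  rw [← Finset.card_filter, Finset.card_le_one]
  intro a ha b hb
  rw [Finset.mem_filter] at ha hb
  exact h a ha.1 b hb.1 ha.2 hb.2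

section Move

variable {X : ℕ}

/-- A vertex falls below the next threshold `X` when the current batch is peeled. -/
def Falls (G : SimpleGraph (Fin n)) [DecidableRel G.Adj] (ℓ : Fin n → ℕ) (P : List (Fin n))
    (lo X : ℕ) (u : Fin n) : Prop :=
  key G ℓ P.toFinset u < X ∧ X ≤ key G ℓ (peeled P lo) u

theorem Static.keyE (hS : Static G st tg ℓ M) (h : Batch G st tg P lo M) (hR : Rep G st tg)
    {i j : ℕ} {v : Fin n} (hv : M 13 (M 16 0 + i) = v) (hj : j < G.degree v) :
    keyE.eval ω [j, i] M =
      ℓ (tg (st v + j)) + G.degree (tg (st v + j)) - M 11 (st v + j) := by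
  rw [ParGreedy.keyE, eval_sub, hS.baseE hR (h.tgtE hv hj), eval_read, h.edgeE hv]

theorem Fetched.falls {r : ℕ → ℕ} (h : Fetched G st tg P lo r) {u : Fin n} :
    Falls G ℓ P lo X u ↔ ∃ e ∈ edgesOf G st (batch P lo),
      ℓ (tg e) + G.degree (tg e) - r e = X ∧ tg e = u := by
  constructor
  · rintro ⟨h1, h2⟩
    simp only [key] at h1 h2
    have := degIn_le_degree (G := G) P.toFinset u
    obtain ⟨e, he, rfl, hr⟩ := h.surj u (ℓ u + G.degree u - X) (by omega) (by omega)
    exact ⟨e, he, by omega, rfl⟩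
  · rintro ⟨e, he, rfl, rfl⟩
    have := h.range e he
    have := degIn_le_degree (G := G) P.toFinset (tg e)
    simp only [Falls, key]
    omega

theorem Fetched.unique {r : ℕ → ℕ} (h : Fetched G st tg P lo r) {e e' : ℕ}
    (he : e ∈ edgesOf G st (batch P lo)) (he' : e' ∈ edgesOf G st (batch P lo))
    (hX : ℓ (tg e) + G.degree (tg e) - r e = X) (hX' : ℓ (tg e') + G.degree (tg e') - r e' = X)
    (ht : tg e = tg e') : e = e' := by
  have h1 := h.range e he
  have h2 := h.range e' he'
  have := degIn_le_degree (G := G) P.toFinset (tg e)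
  refine h.inj e he e' he' ht ?_
  rw [ht] at this hX h1
  omega

theorem peelMove_effect (hS : Static G st tg ℓ M) (h : Batch G st tg P lo M) (hR : Rep G st tg)
    (hn : n < 2 ^ w) (hX : M 15 0 = X) (hf : Fetched G st tg P lo (M 11))
    (hcnt : M 18 0 = P.length)
    (hP : ∀ v ∈ P, key G ℓ (peeled P lo) v < X)
    (hins : ∀ y, M 6 y = (Finset.univ.filter
      (fun v => key G ℓ (peeled P lo) v ≤ y ∧ y ≤ ℓ v + G.degree v)).card)
    (hdel : ∀ y, M 7 y = (Finset.univ.filter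
      (fun v => key G ℓ (peeled P lo) v < y ∧ y ≤ ℓ v + G.degree v)).card)
    (he : Eff w (peelMove.reqs ω M []) M M') :
    (∀ a, a ≠ 6 → a ≠ 7 → a ≠ 12 → a ≠ 14 → a ≠ 18 → M' a = M a) ∧
    (∀ y, M' 6 y = (Finset.univ.filter
      (fun v => key G ℓ P.toFinset v ≤ y ∧ y ≤ ℓ v + G.degree v)).card) ∧
    (∀ y, M' 7 y = (Finset.univ.filter
      (fun v => key G ℓ P.toFinset v < y ∧ y ≤ ℓ v + G.degree v)).card) ∧
    (∀ v : Fin n, ¬ Falls G ℓ P lo X v → M' 12 v = M 12 v) ∧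
    P.length ≤ M' 18 0 ∧ Positions (Falls G ℓ P lo X) P.length (M' 18 0) (M' 12) := by
  have hsub : peeled P lo ⊆ P.toFinset := by
    rw [← peeled_union_batch P lo]
    exact Finset.subset_union_left
  have hpos : ∀ e ∈ edgesOf G st (batch P lo), 0 < ℓ (tg e) + G.degree (tg e) - M 11 e := by
    intro e hE
    have := hf.range e hE
    have := degIn_le_degree (G := G) P.toFinset (tg e)
    omega
  -- the counter of departures
  have t7 : ∀ y, peelMove.total ω M (Req.inc 7 y) [] = (Finset.univ.filter (fun u =>
      key G ℓ P.toFinset u < y ∧ y ≤ key G ℓ (peeled P lo) u)).card := by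
    intro y
    rw [← hf.card, Finset.card_filter]
    refine edgeLoop_total h hR fun i j v hv hj => ?_
    simp [Par.total, Req.inc, hS.keyE h hR hv hj]
  have s7 : ∀ y, M 7 y + peelMove.total ω M (Req.inc 7 y) [] = (Finset.univ.filter
      (fun v => key G ℓ P.toFinset v < y ∧ y ≤ ℓ v + G.degree v)).card := by
    intro y
    rw [t7, hdel, ← Finset.card_union_of_disjoint]
    · congr 1
      ext v
      have h1 := key_anti (G := G) (ℓ := ℓ) hsub v
      have h2 := key_le (G := G) (ℓ := ℓ) (peeled P lo) v
      simp only [Finset.mem_union, Finset.mem_filter, Finset.mem_univ, true_and]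
      omega
    · rw [Finset.disjoint_left]
      intro v
      simp only [Finset.mem_filter, Finset.mem_univ, true_and]
      omega
  -- the counter of arrivals
  have t6 : ∀ y, peelMove.total ω M (Req.inc 6 y) [] = (Finset.univ.filter (fun u =>
      key G ℓ P.toFinset u < y + 1 ∧ y + 1 ≤ key G ℓ (peeled P lo) u)).card := by
    intro y
    rw [← hf.card, Finset.card_filter]
    have : peelMove.total ω M (Req.inc 6 y) [] = ∑ e ∈ edgesOf G st (batch P lo),
        if ℓ (tg e) + G.degree (tg e) - M 11 e - 1 = y then 1 else 0 :=
      edgeLoop_total h hR fun i j v hv hj => by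
        simp [Par.total, Req.inc, hS.keyE h hR hv hj]
    rw [this]
    refine Finset.sum_congr rfl fun e hE => ?_
    have := hpos e hE
    congr 1
    apply propext
    omega
  have s6 : ∀ y, M 6 y + peelMove.total ω M (Req.inc 6 y) [] = (Finset.univ.filter
      (fun v => key G ℓ P.toFinset v ≤ y ∧ y ≤ ℓ v + G.degree v)).card := by
    intro y
    rw [t6, hins, ← Finset.card_union_of_disjoint]
    · congr 1
      ext v
      have h1 := key_anti (G := G) (ℓ := ℓ) hsub v
      have h2 := key_le (G := G) (ℓ := ℓ) (peeled P lo) v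
      simp only [Finset.mem_union, Finset.mem_filter, Finset.mem_univ, true_and]
      omega
    · rw [Finset.disjoint_left]
      intro v
      simp only [Finset.mem_filter, Finset.mem_univ, true_and]
      omega
  -- the positions
  have t18 : ∀ i, peelMove.total ω M (Req.inc 18 i) [] = if 0 = i then
      (Finset.univ.filter (fun u =>
        key G ℓ P.toFinset u < X ∧ X ≤ key G ℓ (peeled P lo) u)).card else 0 := by
    intro i
    have : peelMove.total ω M (Req.inc 18 i) [] = ∑ e ∈ edgesOf G st (batch P lo),
        if 0 = i then if ℓ (tg e) + G.degree (tg e) - M 11 e = X then 1 else 0 else 0 :=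
      edgeLoop_total h hR fun i' j v hv hj => by
        simp only [Par.total, Req.inc, eval_eq, hS.keyE h hR hv hj, nextE, eval_read, eval_zero,
          hX, eval_one]
        by_cases h1 : ℓ (tg (st v + j)) + G.degree (tg (st v + j)) - M 11 (st v + j) = X <;>
        rcases eq_or_ne 0 i with rfl | h2 <;> simp [h1, *]
    rw [this]
    split_ifs with hi
    · rw [← hf.card, Finset.card_filter]
    · simp
  have hlt18 : ∀ i, peelMove.total ω M (Req.inc 18 i) [] ≠ 0 →
      M 18 i + peelMove.total ω M (Req.inc 18 i) [] < 2 ^ w := by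
    intro i hi
    rw [t18] at hi ⊢
    split_ifs at hi ⊢ with h0
    · rw [← h0, hcnt]
      refine lt_of_le_of_lt ?_ hn
      rw [← List.toFinset_card_of_nodup h.nodup, ← Finset.card_union_of_disjoint]
      · exact (Finset.card_le_univ _).trans_eq (Fintype.card_fin n)
      · rw [Finset.disjoint_left]
        intro v hv
        rw [List.mem_toFinset] at hv
        have := hP v hv
        simp only [Finset.mem_filter, Finset.mem_univ, true_and]
        omega
    · exact absurd rfl hi
  have hi12 : ∀ i j, Req.fetchAdd 18 i 1 12 j ∈ peelMove.reqs ω M [] ↔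
      i = 0 ∧ ∃ u : Fin n, Falls G ℓ P lo X u ∧ j = u := by
    intro i j
    rw [Par.mem_reqs]
    refine (edgeLoop_issues h hR (Φ := fun e => ℓ (tg e) + G.degree (tg e) - M 11 e = X ∧ i = 0 ∧
      j = tg e) fun i' j' v hv hj => ?_).trans ?_
    · simp [Par.Issues, hS.keyE h hR hv hj, nextE, hX, h.tgtE hv hj]
    · constructor
      · rintro ⟨e, hE, h1, h2, h3⟩
        exact ⟨h2, _, hf.falls.2 ⟨e, hE, h1, rfl⟩, h3⟩
      · rintro ⟨h2, u, hu, h3⟩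
        obtain ⟨e, hE, h1, rfl⟩ := hf.falls.1 hu
        exact ⟨e, hE, h1, h2, h3⟩
  have htick := Par.tickets (a := 18) (b := 12) he (by decide) (by decide) (by decide) (by decide)
    hlt18 (fun u => by
      have : peelMove.total ω M (Req.hit 12 u) [] = ∑ e ∈ edgesOf G st (batch P lo),
          if ℓ (tg e) + G.degree (tg e) - M 11 e = X ∧ (tg e : ℕ) = u then 1 else 0 :=
        edgeLoop_total h hR fun i' j v hv hj => by
          simp only [Par.total, Req.hit, eval_eq, hS.keyE h hR hv hj, nextE, eval_read, eval_zero,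
            hX, h.tgtE hv hj]
          by_cases h1 : ℓ (tg (st v + j)) + G.degree (tg (st v + j)) - M 11 (st v + j) = X <;>
          simp [h1]
      rw [this]
      refine sum_ite_le_one fun e hE e' hE' h1 h2 => ?_
      exact hf.unique hE hE' h1.1 h2.1 (Fin.ext (h1.2.trans h2.2.symm)))
  have c18 : M' 18 0 = M 18 0 + peelMove.total ω M (Req.inc 18 0) [] := by
    by_cases h0 : peelMove.total ω M (Req.inc 18 0) [] = 0
    · refine Par.counter he (by decide) ?_
      rw [h0, hcnt]
      have := h.nodup.length_le_card
      rw [Fintype.card_fin] at this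
      omega
    · exact Par.counter he (by decide) (hlt18 0 h0)
  refine ⟨fun a h6 h7 h12 h14 h18 => Par.frame he (by
      simp [peelMove, edgeLoop, Par.wrt, Par.ctr, Par.res, h6, h7, h12, h14, h18]),
    fun y => ?_, fun y => ?_, fun v hv => ?_, by omega, ?_, ?_, ?_⟩
  · rw [Par.counter he (by decide), s6]
    rw [s6]
    exact (card_le_n _).trans_lt hn
  · rw [Par.counter he (by decide), s7]
    rw [s7]
    exact (card_le_n _).trans_lt hn
  · refine Par.not_hit he (by decide) fun a' i' x hi => ?_
    have : a' = 18 ∧ x = 1 := by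
      have := Par.ticketing_spec (a := 18) (b := 12) (by decide) hi (Or.inr rfl)
      exact ⟨this.1, this.2.1⟩
    rw [this.1, this.2, ← Par.mem_reqs, hi12] at hi
    obtain ⟨_, u, hu, h3⟩ := hi
    exact hv (Fin.ext h3 ▸ hu)
  · intro u hu
    have := htick.range 0 u ((hi12 _ _).2 ⟨rfl, u, hu, rfl⟩)
    rwa [hcnt] at this
  · intro u v hu hv hp
    exact Fin.ext (htick.inj 0 u v ((hi12 _ _).2 ⟨rfl, u, hu, rfl⟩)
      ((hi12 _ _).2 ⟨rfl, v, hv, rfl⟩) hp)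
  · intro i h1 h2
    rw [← hcnt] at h1
    obtain ⟨j, hj, hc⟩ := htick.surj 0 i h1 h2
    obtain ⟨_, u, hu, rfl⟩ := (hi12 _ _).1 hj
    exact ⟨u, hu, hc⟩

end Move

end Peel

section Peel

variable {n : ℕ} {G : SimpleGraph (Fin n)} [DecidableRel G.Adj] {st : ℕ → ℕ} {tg : ℕ → Fin n}
  {w : ℕ} {σ : Scheduler} {ω : ℕ → Fin (2 ^ w)} {M0 M M' : Mem} {ℓ : Fin n → ℕ}
  {P : List (Fin n)} {lo X : ℕ}

/-- The invariant of the peeling loop. The vertices in `P` are those whose key is below the next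
threshold `X`, in the order of their batches; from position `lo` on, they are still to be peeled.
The rest of array `13` holds the previous peeling order. `M0` is the memory before the loop. -/
structure PeelInv (G : SimpleGraph (Fin n)) [DecidableRel G.Adj] (st : ℕ → ℕ) (tg : ℕ → Fin n)
    (ℓ : Fin n → ℕ) (M0 : Mem) (P : List (Fin n)) (lo X : ℕ) (M : Mem) : Prop where
  static : Static G st tg ℓ M
  batch : Batch G st tg P lo M
  cnt : M 18 0 = P.length
  next : M 15 0 = X
  pos : ∀ i, ∀ h : i < P.length, M 12 P[i] = i
  old : ∀ i, P.length ≤ i → M 13 i = M0 13 i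
  dec : ∀ v : Fin n, M 8 v = degIn G (peeled P lo) v
  mem : ∀ v, v ∈ P ↔ key G ℓ (peeled P lo) v < X
  ins : ∀ y, M 6 y = (Finset.univ.filter
    (fun v => key G ℓ (peeled P lo) v ≤ y ∧ y ≤ ℓ v + G.degree v)).card
  del : ∀ y, M 7 y = (Finset.univ.filter
    (fun v => key G ℓ (peeled P lo) v < y ∧ y ≤ ℓ v + G.degree v)).card
  keep : ∀ a, a ∈ [4, 28, 29] → M a = M0 a

/-- The threshold may be advanced over numbers that are not keys. -/
theorem PeelInv.setNext (h : PeelInv G st tg ℓ M0 P lo X M) {x : ℕ}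
    (hM : ∀ a, a ∈ [0, 1, 2, 3, 4, 5, 6, 7, 8, 9, 12, 13, 16, 17, 18, 28, 29] → M' a = M a)
    (hx : M' 15 0 = x) (hmem : ∀ v, key G ℓ (peeled P lo) v < X ↔ key G ℓ (peeled P lo) v < x) :
    PeelInv G st tg ℓ M0 P lo x M' where
  static := h.static.congr fun a ha => hM a (by fin_cases ha <;> decide)
  batch := h.batch.congr fun a ha => hM a (by fin_cases ha <;> decide)
  cnt := by rw [hM 18 (by decide)]; exact h.cnt
  next := hx
  pos := by rw [hM 12 (by decide)]; exact h.pos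
  old := by rw [hM 13 (by decide)]; exact h.old
  dec := by rw [hM 8 (by decide)]; exact h.dec
  mem := fun v => (h.mem v).trans (hmem v)
  ins := by rw [hM 6 (by decide)]; exact h.ins
  del := by rw [hM 7 (by decide)]; exact h.del
  keep := fun a ha => (hM a (by fin_cases ha <;> decide)).trans (h.keep a ha)

theorem PeelInv.length_le (h : PeelInv G st tg ℓ M0 P lo X M) : P.length ≤ n := by
  simpa using h.batch.nodup.length_le_card

/-- Appending the vertices of `U` to the order, at the positions they have been given. -/
theorem append_order {pos : ℕ → ℕ} {U : Fin n → Prop} {c' : ℕ} {Q : List (Fin n)}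
    (hn : n < 2 ^ w) {p : Par} (he : Eff w (p.reqs ω M []) M M') (hp : 13 ∉ p.ctr ++ p.res)
    (hiss : ∀ i x, p.Issues ω M (.write 13 i x) [] ↔ ∃ u, U u ∧ i = pos u ∧ x = u)
    (hpos : Positions U P.length c' pos) (hQ : ∀ u, u ∈ Q ↔ U u)
    (hQpos : ∀ i, ∀ hi : i < Q.length, pos Q[i] = P.length + i)
    (hP : ∀ i, ∀ h : i < P.length, M 13 i = P[i])
    (hold : ∀ i, P.length ≤ i → M 13 i = M0 13 i) (hc' : c' = P.length + Q.length) :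
    (∀ i, ∀ h : i < (P ++ Q).length, M' 13 i = (P ++ Q)[i]) ∧
      ∀ i, (P ++ Q).length ≤ i → M' 13 i = M0 13 i := by
  refine ⟨fun i hi => ?_, fun i hi => ?_⟩
  · by_cases hlt : i < P.length
    · rw [List.getElem_append_left hlt, ← hP i hlt]
      refine Par.not_written he hp fun x hx => ?_
      obtain ⟨u, hu, rfl, _⟩ := (hiss _ _).1 hx
      have := hpos.range u hu
      omega
    · rw [List.length_append] at hi
      rw [List.getElem_append_right (by omega)]
      have hq := hQpos (i - P.length) (by omega)
      refine Par.written_eq he hp ((hiss _ _).2 ⟨_, (hQ _).1 (List.getElem_mem _), ?_, rfl⟩)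
        (fun x hx => ?_) ((Fin.is_lt _).trans hn)
      · rw [hq]
        omega
      · obtain ⟨u, hu, hi', rfl⟩ := (hiss _ _).1 hx
        rw [hpos.inj u _ hu ((hQ _).1 (List.getElem_mem _)) (by rw [hq, ← hi']; omega)]
  · rw [List.length_append] at hi
    rw [← hold i (by omega)]
    refine Par.not_written he hp fun x hx => ?_
    obtain ⟨u, hu, rfl, _⟩ := (hiss _ _).1 hx
    have := hpos.range u hu
    omega

theorem pos_append {Q : List (Fin n)} {pos pos' : ℕ → ℕ}
    (hP : ∀ i, ∀ h : i < P.length, pos P[i] = i)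
    (hQ : ∀ i, ∀ hi : i < Q.length, pos' Q[i] = P.length + i)
    (hkeep : ∀ v ∈ P, pos' (v : ℕ) = pos v) :
    ∀ i, ∀ h : i < (P ++ Q).length, pos' (P ++ Q)[i] = i := by
  intro i hi
  by_cases hlt : i < P.length
  · rw [List.getElem_append_left hlt, hkeep _ (List.getElem_mem _), hP i hlt]
  · rw [List.length_append] at hi
    rw [List.getElem_append_right (by omega), hQ]
    omega

theorem peeled_append (P Q : List (Fin n)) : peeled (P ++ Q) P.length = P.toFinset := by
  simp [peeled]

/-- Peeling the current batch costs work proportional to the degrees of its vertices, and constant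
depth. The vertices that fall below the threshold form the next batch `Q`, which may be empty. -/
theorem wp_peelRound (hI : PeelInv G st tg ℓ M0 P lo X M) (hR : Rep G st tg) (hn : n < 2 ^ w) :
    wp σ ω peelRound (fun M' W D => ∃ Q, PeelInv G st tg ℓ M0 (P ++ Q) P.length X M' ∧
      W ≤ 3000 * (1 + ∑ v ∈ batch P lo, (G.degree v + 1)) ∧ D ≤ 3000) M := by
  have hsub : peeled P lo ⊆ P.toFinset := by
    rw [← peeled_union_batch P lo]
    exact Finset.subset_union_left
  have hfr : ∀ a ∈ [0, 1, 2, 13, 16, 17], a ≠ 6 ∧ a ≠ 7 ∧ a ≠ 8 ∧ a ≠ 11 ∧ a ≠ 12 ∧ a ≠ 14 ∧ a ≠ 18 :=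
    by decide
  have hfr' : ∀ a ∈ [0, 1, 2, 3, 5, 9], a ≠ 6 ∧ a ≠ 7 ∧ a ≠ 8 ∧ a ≠ 11 ∧ a ≠ 12 ∧ a ≠ 13 ∧
    a ≠ 14 ∧ a ≠ 16 ∧ a ≠ 17 ∧ a ≠ 18 := by decide
  have hfr4 : ∀ a ∈ [4, 28, 29], a ≠ 6 ∧ a ≠ 7 ∧ a ≠ 8 ∧ a ≠ 11 ∧ a ≠ 12 ∧ a ≠ 13 ∧
    a ≠ 14 ∧ a ≠ 16 ∧ a ≠ 17 ∧ a ≠ 18 := by decide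
  -- count the removed edges
  refine wp_seq (wp_par (edgeLoop_count hI.batch hR fun env => by simp [Par.count])
    fun M1 e1 => ?_)
  obtain ⟨f1, d1, F1⟩ := peelCount_effect hI.batch hR hn hI.dec e1
  have B1 : Batch G st tg P lo M1 := hI.batch.congr fun a ha =>
    f1 a (hfr a ha).2.2.1 (hfr a ha).2.2.2.1
  have S1 : Static G st tg ℓ M1 := hI.static.congr fun a ha =>
    f1 a (hfr' a ha).2.2.1 (hfr' a ha).2.2.2.1
  -- update the keys
  refine wp_seq (wp_par (edgeLoop_count B1 hR fun env => by
    simp only [Par.count, ite_self]; decide) fun M2 e2 => ?_)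
  obtain ⟨f2, i2, l2, p2, c2, pos2⟩ := peelMove_effect S1 B1 hR hn
    (by rw [f1 15 (by decide) (by decide)]; exact hI.next) F1
    (by rw [f1 18 (by decide) (by decide)]; exact hI.cnt) (fun v hv => (hI.mem v).1 hv)
    (by rw [f1 6 (by decide) (by decide)]; exact hI.ins)
    (by rw [f1 7 (by decide) (by decide)]; exact hI.del) e2
  obtain ⟨Q, Qnd, Qmem, Qlen, Qpos⟩ := pos2.list c2
  have B2 : Batch G st tg P lo M2 := B1.congr fun a ha => by
    have := hfr a ha
    exact f2 a this.1 this.2.1 this.2.2.2.2.1 this.2.2.2.2.2.1 this.2.2.2.2.2.2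
  have S2 : Static G st tg ℓ M2 := S1.congr fun a ha => by
    have := hfr' a ha
    exact f2 a this.1 this.2.1 this.2.2.2.2.1 this.2.2.2.2.2.2.1 this.2.2.2.2.2.2.2.2.2
  have F2 : Fetched G st tg P lo (M2 11) := by
    rw [f2 11 (by decide) (by decide) (by decide) (by decide) (by decide)]
    exact F1
  have X2 : M2 15 0 = X := by
    rw [f2 15 (by decide) (by decide) (by decide) (by decide) (by decide),
      f1 15 (by decide) (by decide)]
    exact hI.next
  have hPQ : (P ++ Q).Nodup := by
    refine List.nodup_append'.2 ⟨hI.batch.nodup, Qnd, fun v hv hv' => ?_⟩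
    have h1 := (hI.mem v).1 hv
    have h2 := ((Qmem v).1 hv').2
    omega
  have hlen : (P ++ Q).length ≤ n := by simpa using hPQ.length_le_card
  rw [List.length_append] at hlen
  -- append the next batch
  have hcount : peelOrd.count ω M2 [] ≤ 3 + ∑ v ∈ batch P lo, 3 * (G.degree v + 1) := by
    have := edgeLoop_count B2 hR (ω := ω) (body := .cond (.op .eq keyE nextE)
      (.write 13 (.read 12 tgtE) tgtE) .skip) fun env => by
        simp only [Par.count, ite_self]; decide
    simp only [peelOrd, Par.count] at this ⊢
    omega
  refine wp_par hcount fun M3 e3 => ?_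
  have hiss : ∀ i x, peelOrd.Issues ω M2 (.write 13 i x) [] ↔
      ∃ u : Fin n, Falls G ℓ P lo X u ∧ i = M2 12 u ∧ x = u := by
    intro i x
    simp only [peelOrd, Par.Issues, Req.write.injEq]
    simp only [Nat.reduceEqDiff, false_and, or_false]
    rw [edgeLoop_issues B2 hR (Φ := fun e => ℓ (tg e) + G.degree (tg e) - M2 11 e = X ∧
      i = M2 12 (tg e) ∧ x = tg e)]
    · constructor
      · rintro ⟨e, hE, h1, h2, h3⟩
        exact ⟨_, F2.falls.2 ⟨e, hE, h1, rfl⟩, h2, h3⟩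
      · rintro ⟨u, hu, h2, h3⟩
        obtain ⟨e, hE, h1, rfl⟩ := F2.falls.1 hu
        exact ⟨e, hE, h1, h2, h3⟩
    · intro i' j v hv hj
      simp [Par.Issues, S2.keyE B2 hR hv hj, nextE, X2, B2.tgtE hv hj]
  have f3 : ∀ a, a ≠ 13 → a ≠ 16 → a ≠ 17 → M3 a = M2 a := fun a h1 h2 h3 => Par.frame e3 (by
    simp [peelOrd, edgeLoop, Par.wrt, Par.ctr, Par.res, h1, h2, h3])
  obtain ⟨o1, o2⟩ := append_order (M0 := M0) hn e3 (by decide) hiss pos2 Qmem Qpos B2.ord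
    (fun i hi => by
      rw [f2 13 (by decide) (by decide) (by decide) (by decide) (by decide),
        f1 13 (by decide) (by decide)]
      exact hI.old i hi) Qlen
  have hno : ∀ a i x, a ≠ 13 → ¬ (edgeLoop (.cond (.op .eq keyE nextE)
      (.write 13 (.read 12 tgtE) tgtE) .skip)).Issues ω M2 (.write a i x) [] := by
    intro a i x ha h
    have := Par.mem_wrt h
    simp [edgeLoop, Par.wrt] at this
    exact ha this
  have lo3 : M3 16 0 = P.length := by
    refine Par.written_eq e3 (by decide) ?_ ?_ (by omega)
    · simp [peelOrd, Par.Issues, B2.hiMem]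
    · intro v hv
      simp only [peelOrd, Par.Issues, hno 16 0 v (by decide)] at hv
      simpa [B2.hiMem] using hv
  have hi3 : M3 17 0 = (P ++ Q).length := by
    rw [List.length_append, ← Qlen]
    refine Par.written_eq e3 (by decide) ?_ ?_ (by omega)
    · simp [peelOrd, Par.Issues]
    · intro v hv
      simp only [peelOrd, Par.Issues, hno 17 0 v (by decide)] at hv
      simpa using hv
  have hd3 : M3 18 0 = (P ++ Q).length := by
    rw [f3 18 (by decide) (by decide) (by decide), List.length_append, Qlen]
  have S3 : Static G st tg ℓ M3 := S2.congr fun a ha => by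
    have := hfr' a ha
    exact f3 a this.2.2.2.2.2.1 this.2.2.2.2.2.2.2.1 this.2.2.2.2.2.2.2.2.1
  refine ⟨Q, ⟨S3, ⟨S3.inMem, o1, hPQ, lo3, hi3, by simp⟩, hd3, ?_, ?_, o2, ?_, ?_, ?_, ?_, ?_⟩,
    ?_, ?_⟩
  · rw [f3 15 (by decide) (by decide) (by decide), X2]
  · rw [f3 12 (by decide) (by decide) (by decide)]
    refine pos_append hI.pos Qpos fun v hv => ?_
    rw [p2 v (fun h => by have h1 := (hI.mem v).1 hv; have h2 := h.2; omega),
      f1 12 (by decide) (by decide)]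
  · intro v
    rw [f3 8 (by decide) (by decide) (by decide),
      f2 8 (by decide) (by decide) (by decide) (by decide) (by decide), d1, peeled_append]
  · intro v
    rw [peeled_append, List.mem_append, hI.mem, Qmem]
    have := key_anti (G := G) (ℓ := ℓ) hsub v
    simp only [Falls]
    omega
  · rw [f3 6 (by decide) (by decide) (by decide), peeled_append]
    exact i2
  · rw [f3 7 (by decide) (by decide) (by decide), peeled_append]
    exact l2
  · intro a ha
    have := hfr4 a ha
    rw [f3 a this.2.2.2.2.2.1 this.2.2.2.2.2.2.2.1 this.2.2.2.2.2.2.2.2.1,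
      f2 a this.1 this.2.1 this.2.2.2.2.1 this.2.2.2.2.2.2.1 this.2.2.2.2.2.2.2.2.2,
      f1 a this.2.2.1 this.2.2.2.1]
    exact hI.keep a ha
  · have z1 : peelCount.size ≤ 100 := by decide
    have z2 : peelMove.size ≤ 300 := by decide
    have z3 : peelOrd.size ≤ 300 := by decide
    rw [← Finset.mul_sum]
    set S := ∑ v ∈ batch P lo, (G.degree v + 1)
    have y1 := Nat.mul_le_mul_right (1 + 3 * S) z1
    have y2 := Nat.mul_le_mul_right (1 + 3 * S) z2
    have y3 := Nat.mul_le_mul_right (3 + 3 * S) z3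
    change peelCount.size * _ + (peelMove.size * _ + peelOrd.size * _) ≤ _
    omega
  · change peelCount.size + (peelMove.size + peelOrd.size) ≤ 3000
    decide

/-! ### Collecting the vertices at a new threshold -/

/-- The list for the number `y` has no other entries than the vertices whose interval contains `y`,
because there are as many of these as slots. -/
theorem Static.slot (hS : Static G st tg ℓ M) (y : ℕ) : ∀ j < tot G ℓ y, ∃ v : Fin n,
    (ℓ v ≤ y ∧ y ≤ ℓ v + G.degree v) ∧ M 9 (y * n + j) = v := by
  set I := Finset.univ.filter (fun v => ℓ v ≤ y ∧ y ≤ ℓ v + G.degree v) with hIdef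
  have hmem : ∀ v ∈ I, ∃ j < tot G ℓ y, M 9 (y * n + j) = v := fun v hv => by
    rw [hIdef, Finset.mem_filter] at hv
    exact hS.list v y hv.2.1 hv.2.2
  intro j hj
  have := Finset.surj_on_of_inj_on_of_card_le (s := I) (t := Finset.range (tot G ℓ y))
    (fun v hv => (hmem v hv).choose)
    (fun v hv => Finset.mem_range.2 (hmem v hv).choose_spec.1)
    (fun v v' hv hv' he => by
      have h1 := (hmem v hv).choose_spec.2
      have h2 := (hmem v' hv').choose_spec.2
      rw [he] at h1
      exact Fin.ext (h1.symm.trans h2))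
    (by rw [Finset.card_range]; exact le_rfl) j (Finset.mem_range.2 hj)
  obtain ⟨v, hv, rfl⟩ := this
  refine ⟨v, ?_, (hmem v hv).choose_spec.2⟩
  rw [hIdef, Finset.mem_filter] at hv
  exact hv.2

theorem Static.sum_slots (hS : Static G st tg ℓ M) (y : ℕ) {f : Fin n → ℕ} {g : ℕ → ℕ}
    (hg : ∀ j, ∀ v : Fin n, M 9 (y * n + j) = v → g j = f v) :
    ∑ j ∈ Finset.range (tot G ℓ y), g j =
      ∑ v ∈ Finset.univ.filter (fun v => ℓ v ≤ y ∧ y ≤ ℓ v + G.degree v), f v := by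
  symm
  refine Finset.sum_bij (fun v hv =>
    (hS.list v y (Finset.mem_filter.1 hv).2.1 (Finset.mem_filter.1 hv).2.2).choose) ?_ ?_ ?_ ?_
  · intro v hv
    exact Finset.mem_range.2 (hS.list v y (Finset.mem_filter.1 hv).2.1
      (Finset.mem_filter.1 hv).2.2).choose_spec.1
  · intro v hv v' hv' he
    have h1 := (hS.list v y (Finset.mem_filter.1 hv).2.1 (Finset.mem_filter.1 hv).2.2).choose_spec.2
    have h2 :=
      (hS.list v' y (Finset.mem_filter.1 hv').2.1 (Finset.mem_filter.1 hv').2.2).choose_spec.2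
    rw [he] at h1
    exact Fin.ext (h1.symm.trans h2)
  · intro j hj
    obtain ⟨v, hv, hj'⟩ := hS.slot y j (Finset.mem_range.1 hj)
    refine ⟨v, Finset.mem_filter.2 ⟨Finset.mem_univ v, hv⟩, ?_⟩
    -- two slots with the same vertex coincide, since there are as many slots as vertices
    have hinj : Set.InjOn (fun j => M 9 (y * n + j)) (Finset.range (tot G ℓ y)) := by
      refine Finset.injOn_of_card_image_eq (le_antisymm Finset.card_image_le ?_)
      rw [Finset.card_range]
      refine (Finset.card_image_of_injective _ Fin.val_injective).ge.trans
        (Finset.card_le_card fun i hi => ?_)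
      obtain ⟨u, hu, rfl⟩ := Finset.mem_image.1 hi
      obtain ⟨j, hj, he⟩ := hS.list u y (Finset.mem_filter.1 hu).2.1 (Finset.mem_filter.1 hu).2.2
      exact Finset.mem_image.2 ⟨j, Finset.mem_range.2 hj, he⟩
    have hc := (hS.list v y hv.1 hv.2).choose_spec
    exact hinj (Finset.mem_coe.2 (Finset.mem_range.2 hc.1)) hj (hc.2.trans hj'.symm)
  · intro v hv
    exact (hg _ v (hS.list v y (Finset.mem_filter.1 hv).2.1
      (Finset.mem_filter.1 hv).2.2).choose_spec.2).symm

theorem PeelInv.key_add (h : PeelInv G st tg ℓ M0 P lo X M) (v : Fin n) :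
    M 8 v + X = ℓ v + G.degree v ↔ key G ℓ (peeled P lo) v = X := by
  have := degIn_le_degree (G := G) (peeled P lo) v
  rw [h.dec, key]
  omega

theorem PeelInv.slotTest (h : PeelInv G st tg ℓ M0 P lo X M) (hR : Rep G st tg) {j : ℕ}
    {v : Fin n} (hv : M 9 (X * n + j) = v) :
    slotE.eval ω [j] M = v ∧ slotTest.eval ω [j] M =
      if key G ℓ (peeled P lo) v = X then 1 else 0 := by
  have h1 : slotE.eval ω [j] M = v := by
    simp [slotE, nextE, nE, h.next, h.static.inMem.size, hv]
  refine ⟨h1, ?_⟩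
  rw [ParGreedy.slotTest, eval_eq, h.static.baseE hR h1, eval_add, eval_read, h1]
  simp only [nextE, eval_read, eval_zero, h.next]
  exact if_congr (h.key_add v) rfl rfl

/-- The vertices whose key is the next threshold `X` form a new batch `Q`. They are found among the
`tot G ℓ X` vertices whose interval contains `X`. -/
theorem wp_collect (hI : PeelInv G st tg ℓ M0 P P.length X M) (hR : Rep G st tg) (hn : n < 2 ^ w)
    (hX : X + 1 < 2 ^ w) :
    wp σ ω (.seq (.par collectPos) (.par collectOrd)) (fun M' W D => ∃ Q,
      PeelInv G st tg ℓ M0 (P ++ Q) P.length (X + 1) M' ∧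
      (∀ v, v ∈ Q ↔ key G ℓ (peeled P P.length) v = X) ∧
      W ≤ 3000 * (1 + tot G ℓ X) ∧ D ≤ 3000) M := by
  have hN : ∀ {M1 : Mem}, PeelInv G st tg ℓ M0 P P.length X M1 →
      (Expr.read 5 nextE).eval ω [] M1 = tot G ℓ X := fun h1 => by
    simp [nextE, h1.next, h1.static.count]
  have hkr : ∀ v, key G ℓ (peeled P P.length) v = X → ℓ v ≤ X ∧ X ≤ ℓ v + G.degree v := by
    rintro v rfl
    exact ⟨le_key _ _, key_le _ _⟩
  have hcount1 : collectPos.count ω M [] ≤ 1 + tot G ℓ X := by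
    simp only [collectPos, Par.count, hN hI, ite_self]
    simp
  refine wp_seq (wp_par hcount1 fun M1 e1 => ?_)
  have f1 : ∀ a, a ≠ 12 → a ≠ 18 → M1 a = M a := fun a h12 h18 =>
    Par.frame e1 (by simp [collectPos, Par.wrt, Par.ctr, Par.res, h12, h18])
  have t18 : ∀ i, collectPos.total ω M (Req.inc 18 i) [] = if 0 = i then
      (Finset.univ.filter (fun v => key G ℓ (peeled P P.length) v = X)).card else 0 := by
    intro i
    simp only [collectPos, Par.total, hN hI]
    rw [hI.static.sum_slots X (f := fun v => if 0 = i then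
      if key G ℓ (peeled P P.length) v = X then 1 else 0 else 0)]
    · split_ifs with hi
      · rw [← Finset.card_filter, Finset.filter_filter]
        congr 1
        ext v
        simp only [Finset.mem_filter, Finset.mem_univ, true_and]
        exact ⟨fun h => h.2, fun h => ⟨hkr v h, h⟩⟩
      · simp
    · intro j v hv
      rw [(hI.slotTest hR hv).2]
      by_cases h1 : key G ℓ (peeled P P.length) v = X <;>
      rcases eq_or_ne 0 i with rfl | h2 <;> simp [h1, Req.inc, *]
  have hle : P.length +
      (Finset.univ.filter (fun v => key G ℓ (peeled P P.length) v = X)).card ≤ n := by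
    refine le_of_eq_of_le (congrArg (· + _) (List.toFinset_card_of_nodup hI.batch.nodup).symm) ?_
    rw [← Finset.card_union_of_disjoint]
    · exact (Finset.card_le_univ _).trans_eq (Fintype.card_fin n)
    · rw [Finset.disjoint_left]
      intro v hv hv'
      rw [List.mem_toFinset, hI.mem] at hv
      rw [Finset.mem_filter] at hv'
      have := hv'.2
      omega
  have hlt18 : ∀ i, collectPos.total ω M (Req.inc 18 i) [] ≠ 0 →
      M 18 i + collectPos.total ω M (Req.inc 18 i) [] < 2 ^ w := by
    intro i hi
    rw [t18] at hi ⊢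
    split_ifs at hi ⊢ with h0
    · rw [← h0, hI.cnt]
      omega
    · exact absurd rfl hi
  have c18 : M1 18 0 = P.length +
      (Finset.univ.filter (fun v => key G ℓ (peeled P P.length) v = X)).card := by
    rw [Par.counter e1 (by decide), t18, hI.cnt, if_pos rfl]
    rw [t18, hI.cnt, if_pos rfl]
    omega
  have hi12 : ∀ i j, Req.fetchAdd 18 i 1 12 j ∈ collectPos.reqs ω M [] ↔
      i = 0 ∧ ∃ u : Fin n, key G ℓ (peeled P P.length) u = X ∧ j = u := by
    intro i j
    rw [Par.mem_reqs]
    simp only [collectPos, Par.Issues, hN hI]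
    constructor
    · rintro ⟨k, hk, h⟩
      obtain ⟨v, _, hv⟩ := hI.static.slot X k hk
      obtain ⟨s1, s2⟩ := hI.slotTest (ω := ω) hR hv
      rw [s1, s2] at h
      simp at h
      exact ⟨h.2.1, v, h.1, h.2.2⟩
    · rintro ⟨rfl, u, hu, rfl⟩
      obtain ⟨k, hk, hv⟩ := hI.static.list u X (hkr u hu).1 (hkr u hu).2
      obtain ⟨s1, s2⟩ := hI.slotTest (ω := ω) hR hv
      refine ⟨k, hk, ?_⟩
      rw [s1, s2]
      simp [hu]
  have htick := Par.tickets (a := 18) (b := 12) e1 (by decide) (by decide) (by decide) (by decide)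
    hlt18 (fun u => by
      simp only [collectPos, Par.total, hN hI]
      rw [hI.static.sum_slots X (f := fun v => if (v : ℕ) = u ∧
        key G ℓ (peeled P P.length) v = X then 1 else 0)]
      · rw [← Finset.card_filter, Finset.card_le_one]
        intro a ha b hb
        rw [Finset.mem_filter] at ha hb
        exact Fin.ext (ha.2.1.trans hb.2.1.symm)
      · intro j v hv
        rw [(hI.slotTest hR hv).2, (hI.slotTest hR hv).1]
        by_cases h1 : key G ℓ (peeled P P.length) v = X <;> simp [h1, Req.hit])
  have pos1 : Positions (fun u => key G ℓ (peeled P P.length) u = X) P.length (M1 18 0) (M1 12) := by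
    refine ⟨fun u hu => ?_, fun u v hu hv hp => ?_, fun i h1 h2 => ?_⟩
    · have := htick.range 0 u ((hi12 _ _).2 ⟨rfl, u, hu, rfl⟩)
      rwa [hI.cnt] at this
    · exact Fin.ext (htick.inj 0 u v ((hi12 _ _).2 ⟨rfl, u, hu, rfl⟩)
        ((hi12 _ _).2 ⟨rfl, v, hv, rfl⟩) hp)
    · rw [← hI.cnt] at h1
      obtain ⟨j, hj, hc⟩ := htick.surj 0 i h1 h2
      obtain ⟨_, u, hu, rfl⟩ := (hi12 _ _).1 hj
      exact ⟨u, hu, hc⟩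
  obtain ⟨Q, Qnd, Qmem, Qlen, Qpos⟩ := pos1.list (by omega)
  have hPQ : (P ++ Q).Nodup := by
    refine List.nodup_append'.2 ⟨hI.batch.nodup, Qnd, fun v hv hv' => ?_⟩
    have h1 := (hI.mem v).1 hv
    have h2 := (Qmem v).1 hv'
    omega
  have hlen : (P ++ Q).length ≤ n := by simpa using hPQ.length_le_card
  rw [List.length_append] at hlen
  have S1 : Static G st tg ℓ M1 := hI.static.congr fun a ha =>
    f1 a (by rintro rfl; simp at ha) (by rintro rfl; simp at ha)
  have X1 : M1 15 0 = X := by rw [f1 15 (by decide) (by decide)]; exact hI.next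
  have N1 : (Expr.read 5 nextE).eval ω [] M1 = tot G ℓ X := by simp [nextE, X1, S1.count]
  have t1 : ∀ {j : ℕ} {v : Fin n}, M1 9 (X * n + j) = v → slotE.eval ω [j] M1 = v ∧
      slotTest.eval ω [j] M1 = if key G ℓ (peeled P P.length) v = X then 1 else 0 := by
    intro j v hv
    have h1 : slotE.eval ω [j] M1 = v := by
      simp [slotE, nextE, nE, X1, S1.inMem.size, hv]
    refine ⟨h1, ?_⟩
    rw [ParGreedy.slotTest, eval_eq, S1.baseE hR h1, eval_add, eval_read, h1,
      f1 8 (by decide) (by decide)]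
    simp only [nextE, eval_read, eval_zero, X1]
    exact if_congr (hI.key_add v) rfl rfl
  have hcount2 : collectOrd.count ω M1 [] ≤ 3 + tot G ℓ X := by
    simp only [collectOrd, Par.count, N1, ite_self]
    simp
    omega
  refine wp_par hcount2 fun M2 e2 => ?_
  have f2 : ∀ a, a ≠ 13 → a ≠ 15 → a ≠ 17 → M2 a = M1 a := fun a h1 h2 h3 =>
    Par.frame e2 (by simp [collectOrd, Par.wrt, Par.ctr, Par.res, h1, h2, h3])
  have hiss : ∀ i x, collectOrd.Issues ω M1 (.write 13 i x) [] ↔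
      ∃ u : Fin n, key G ℓ (peeled P P.length) u = X ∧ i = M1 12 u ∧ x = u := by
    intro i x
    simp only [collectOrd, Par.Issues, N1, Req.write.injEq]
    simp only [Nat.reduceEqDiff, false_and, or_false]
    constructor
    · rintro ⟨k, hk, h⟩
      obtain ⟨v, _, hv⟩ := S1.slot X k hk
      obtain ⟨s1, s2⟩ := t1 hv
      rw [eval_read, s1, s2] at h
      simp at h
      exact ⟨v, h.1, h.2.1, h.2.2⟩
    · rintro ⟨u, hu, rfl, rfl⟩
      obtain ⟨k, hk, hv⟩ := S1.list u X (hkr u hu).1 (hkr u hu).2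
      obtain ⟨s1, s2⟩ := t1 hv
      refine ⟨k, hk, ?_⟩
      rw [eval_read, s1, s2]
      simp [hu]
  obtain ⟨o1, o2⟩ := append_order (M0 := M0) hn e2 (by decide) hiss pos1 Qmem Qpos
    (by rw [f1 13 (by decide) (by decide)]; exact hI.batch.ord)
    (by rw [f1 13 (by decide) (by decide)]; exact hI.old) Qlen
  have lo2 : M2 16 0 = P.length := by
    rw [f2 16 (by decide) (by decide) (by decide), f1 16 (by decide) (by decide)]
    exact hI.batch.loMem
  have hi2 : M2 17 0 = (P ++ Q).length := by
    rw [List.length_append, ← Qlen]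
    exact Par.written_eq e2 (by decide) (by simp [collectOrd, Par.Issues])
      (by simp [collectOrd, Par.Issues]) (by omega)
  have x2 : M2 15 0 = X + 1 := Par.written_eq e2 (by decide)
      (by simp [collectOrd, Par.Issues, nextE, X1])
      (by simp [collectOrd, Par.Issues, nextE, X1]) (by omega)
  have S2 : Static G st tg ℓ M2 := S1.congr fun a ha =>
    f2 a (by rintro rfl; simp at ha) (by rintro rfl; simp at ha) (by rintro rfl; simp at ha)
  have hpp : peeled P P.length = P.toFinset := by simp [peeled]
  refine ⟨Q, ⟨S2, ⟨S2.inMem, o1, hPQ, lo2, hi2, by simp⟩, ?_, x2, ?_, o2, ?_, ?_, ?_, ?_, ?_⟩,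
    Qmem, ?_, ?_⟩
  · rw [f2 18 (by decide) (by decide) (by decide), List.length_append, Qlen]
  · rw [f2 12 (by decide) (by decide) (by decide)]
    refine pos_append hI.pos Qpos fun v hv => ?_
    refine Par.not_hit e1 (by decide) fun a' i' x hi => ?_
    have : a' = 18 ∧ x = 1 := by
      have := Par.ticketing_spec (a := 18) (b := 12) (by decide) hi (Or.inr rfl)
      exact ⟨this.1, this.2.1⟩
    rw [this.1, this.2, ← Par.mem_reqs, hi12] at hi
    obtain ⟨_, u, hu, h3⟩ := hi
    have h1 := (hI.mem v).1 hv
    rw [Fin.ext h3, hu] at h1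
    exact lt_irrefl _ h1
  · intro v
    rw [f2 8 (by decide) (by decide) (by decide), f1 8 (by decide) (by decide), hI.dec, hpp,
      peeled_append]
  · intro v
    rw [List.mem_append, hI.mem, Qmem, peeled_append, hpp]
    omega
  · rw [f2 6 (by decide) (by decide) (by decide), f1 6 (by decide) (by decide), peeled_append, ← hpp]
    exact hI.ins
  · rw [f2 7 (by decide) (by decide) (by decide), f1 7 (by decide) (by decide), peeled_append, ← hpp]
    exact hI.del
  · intro a ha
    rw [f2 a (by rintro rfl; simp at ha) (by rintro rfl; simp at ha) (by rintro rfl; simp at ha),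
      f1 a (by rintro rfl; simp at ha) (by rintro rfl; simp at ha)]
    exact hI.keep a ha
  · have z1 : collectPos.size ≤ 100 := by decide
    have z2 : collectOrd.size ≤ 200 := by decide
    have y1 := Nat.mul_le_mul_right (1 + tot G ℓ X) z1
    have y2 := Nat.mul_le_mul_right (3 + tot G ℓ X) z2
    omega
  · decide

end Peel

/-! ### Raising the threshold -/

section Raise

variable {n : ℕ} {G : SimpleGraph (Fin n)} [DecidableRel G.Adj] {st : ℕ → ℕ} {tg : ℕ → Fin n}
  {w : ℕ} {σ : Scheduler} {ω : ℕ → Fin (2 ^ w)} {M0 M M' : Mem} {ℓ : Fin n → ℕ}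
  {P : List (Fin n)} {lo X B : ℕ}

theorem tot_eq_zero {y : ℕ} : tot G ℓ y = 0 ↔ ∀ v, ℓ v ≤ y → ℓ v + G.degree v < y := by
  rw [tot, Finset.card_eq_zero, Finset.filter_eq_empty_iff]
  refine ⟨fun h v hv => ?_, fun h v _ hv => ?_⟩
  · have := h (Finset.mem_univ v)
    omega
  · have := h v hv.1
    omega

/-- The potential of the peeling loop at the threshold `X`: it pays for the thresholds that the
rightward searches pass, for the list entries that are read, and, by the numbers connected to `X`
through the union of the intervals, for the leftward searches. -/
def pot (G : SimpleGraph (Fin n)) [DecidableRel G.Adj] (ℓ : Fin n → ℕ) (X : ℕ) : ℕ :=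
  ∑ y ∈ Finset.range X, tot G ℓ y +
    ((Finset.univ.biUnion fun v => Finset.Icc (ℓ v) (ℓ v + G.degree v)).filter
      (fun y => y < X ∨ ∀ z ∈ Finset.Icc X y, tot G ℓ z ≠ 0)).card

theorem pot_le : pot G ℓ X ≤ 2 * ∑ v, (G.degree v + 1) := by
  have h1 : ∑ y ∈ Finset.range X, tot G ℓ y ≤ ∑ v, (G.degree v + 1) := by
    simp only [tot, Finset.card_filter]
    rw [Finset.sum_comm]
    refine Finset.sum_le_sum fun v _ => ?_
    rw [← Finset.card_filter]
    refine (Finset.card_le_card (t := Finset.Icc (ℓ v) (ℓ v + G.degree v)) fun y hy => ?_).trans ?_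
    · rw [Finset.mem_filter] at hy
      exact Finset.mem_Icc.2 hy.2
    · rw [Nat.card_Icc]
      omega
  have h2 : (Finset.univ.biUnion fun v => Finset.Icc (ℓ v) (ℓ v + G.degree v)).card ≤
      ∑ v, (G.degree v + 1) := by
    refine Finset.card_biUnion_le.trans (Finset.sum_le_sum fun v _ => ?_)
    rw [Nat.card_Icc]
    omega
  have h3 := Finset.card_filter_le
    (Finset.univ.biUnion fun v => Finset.Icc (ℓ v) (ℓ v + G.degree v))
    (fun y => y < X ∨ ∀ z ∈ Finset.Icc X y, tot G ℓ z ≠ 0)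
  rw [pot]
  omega

/-- A rightward step from `X` to `x`. -/
theorem pot_add_sum_le {x : ℕ} (h : X ≤ x) :
    pot G ℓ X + ∑ y ∈ Finset.Ico X x, tot G ℓ y ≤ pot G ℓ x := by
  rw [pot, pot, ← Finset.sum_range_add_sum_Ico _ h]
  have : ((Finset.univ.biUnion fun v => Finset.Icc (ℓ v) (ℓ v + G.degree v)).filter
      (fun y => y < X ∨ ∀ z ∈ Finset.Icc X y, tot G ℓ z ≠ 0)).card ≤
      ((Finset.univ.biUnion fun v => Finset.Icc (ℓ v) (ℓ v + G.degree v)).filter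
      (fun y => y < x ∨ ∀ z ∈ Finset.Icc x y, tot G ℓ z ≠ 0)).card := by
    refine Finset.card_le_card (Finset.monotone_filter_right _ fun y _ hy => ?_)
    rcases hy with hy | hy
    · exact Or.inl (by omega)
    · refine Or.inr fun z hz => hy z ?_
      rw [Finset.mem_Icc] at hz ⊢
      omega
  omega

theorem pot_add_le {x : ℕ} (h : X ≤ x) (ht : ∀ y, X ≤ y → y < x → tot G ℓ y ≠ 0) :
    pot G ℓ X + (x - X) ≤ pot G ℓ x := by
  refine le_trans ?_ (pot_add_sum_le h)
  have := Finset.card_nsmul_le_sum (Finset.Ico X x) (fun y => tot G ℓ y) 1 fun y hy => by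
    rw [Finset.mem_Ico] at hy
    exact Nat.one_le_iff_ne_zero.2 (ht y hy.1 hy.2)
  simp at this
  omega

/-- A jump from the gap `x` to `y`, where the numbers from `y` to `z` are covered. -/
theorem pot_add_jump_le {x y z : ℕ} (hx : tot G ℓ x = 0) (hxy : x < y)
    (ht : ∀ i, y ≤ i → i ≤ z → tot G ℓ i ≠ 0) : pot G ℓ x + (z + 1 - y) ≤ pot G ℓ y := by
  set U := Finset.univ.biUnion fun v => Finset.Icc (ℓ v) (ℓ v + G.degree v) with hU
  have hmem : ∀ i, tot G ℓ i ≠ 0 → i ∈ U := by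
    intro i hi
    rw [tot, Finset.card_ne_zero] at hi
    obtain ⟨v, hv⟩ := hi
    rw [Finset.mem_filter] at hv
    exact Finset.mem_biUnion.2 ⟨v, Finset.mem_univ v, Finset.mem_Icc.2 hv.2⟩
  have h1 : (U.filter (fun i => i < x ∨ ∀ j ∈ Finset.Icc x i, tot G ℓ j ≠ 0)) ∪ Finset.Icc y z ⊆
      U.filter (fun i => i < y ∨ ∀ j ∈ Finset.Icc y i, tot G ℓ j ≠ 0) := by
    intro i hi
    rw [Finset.mem_union, Finset.mem_filter, Finset.mem_Icc] at hi
    rw [Finset.mem_filter]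
    rcases hi with ⟨hi, hlt | hc⟩ | hi
    · exact ⟨hi, Or.inl (by omega)⟩
    · refine ⟨hi, ?_⟩
      by_contra hne
      push Not at hne
      exact hc x (Finset.mem_Icc.2 (by omega)) hx
    · exact ⟨hmem i (ht i hi.1 hi.2), Or.inr fun j hj => by
        rw [Finset.mem_Icc] at hj
        exact ht j hj.1 (by omega)⟩
  have h2 := Finset.card_le_card h1
  rw [Finset.card_union_of_disjoint, Nat.card_Icc] at h2
  · have h3 : ∑ i ∈ Finset.range x, tot G ℓ i ≤ ∑ i ∈ Finset.range y, tot G ℓ i :=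
      Finset.sum_le_sum_of_subset (Finset.range_mono hxy.le)
    rw [pot, pot, ← hU]
    omega
  · rw [Finset.disjoint_left]
    intro i hi hi'
    rw [Finset.mem_filter] at hi
    rw [Finset.mem_Icc] at hi'
    rcases hi.2 with hlt | hc
    · omega
    · exact hc x (Finset.mem_Icc.2 (by omega)) hx

/-- At each number `y` that is not covered by the intervals, the list `o` splits into the vertices
with `ℓ v + deg v < y` and the others. -/
def JumpOK (G : SimpleGraph (Fin n)) [DecidableRel G.Adj] (ℓ : Fin n → ℕ) (o : ℕ → ℕ) : Prop :=
  ∀ y, tot G ℓ y = 0 → ∀ i < n, ∃ u : Fin n, o i = u ∧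
    (i < (Finset.univ.filter (fun v => ℓ v + G.degree v < y)).card ↔ ℓ u + G.degree u < y)

/-- The two counters at `y` differ by the number of vertices with the key `y`. -/
theorem PeelInv.ins_eq_del (h : PeelInv G st tg ℓ M0 P lo X M) (y : ℕ) :
    M 6 y = M 7 y ↔ ∀ v, key G ℓ (peeled P lo) v ≠ y := by
  have hs : (Finset.univ.filter
      (fun v => key G ℓ (peeled P lo) v < y ∧ y ≤ ℓ v + G.degree v)) ⊆ (Finset.univ.filter
      (fun v => key G ℓ (peeled P lo) v ≤ y ∧ y ≤ ℓ v + G.degree v)) :=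
    Finset.monotone_filter_right _ fun v _ hv => ⟨hv.1.le, hv.2⟩
  rw [h.ins, h.del]
  constructor
  · intro he v hv
    have := Finset.eq_of_subset_of_card_le hs he.le
    have hm : v ∈ Finset.univ.filter
        (fun v => key G ℓ (peeled P lo) v ≤ y ∧ y ≤ ℓ v + G.degree v) :=
      Finset.mem_filter.2 ⟨Finset.mem_univ v, hv.le, hv ▸ key_le _ _⟩
    rw [← this, Finset.mem_filter] at hm
    exact hm.2.1.ne hv
  · intro hk
    congr 1
    refine Finset.Subset.antisymm (fun v hv => ?_) hs
    rw [Finset.mem_filter] at hv ⊢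
    exact ⟨hv.1, lt_of_le_of_ne hv.2.1 (hk v), hv.2.2⟩

theorem tests_rightEv (hX : M 15 0 = X) : Tests ω M rightEv
    (fun o => M 6 (X + o) ≠ M 7 (X + o) ∨ M 5 (X + o) = 0) := by
  intro M' hM e env
  simp only [rightEv, nextE, eval_add, eval_sub, eval_one, eval_eq, eval_read, eval_zero,
    hM 15 (by decide) (by decide) (by decide), hM 6 (by decide) (by decide) (by decide),
    hM 7 (by decide) (by decide) (by decide), hM 5 (by decide) (by decide) (by decide), hX]
  split_ifs <;> simp_all

theorem tests_leftEv {x : ℕ} (hx : M 3 (M 13 (M 16 0)) = x) : Tests ω M leftEv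
    (fun o => x - o = 0 ∨ M 5 (x - o - 1) = 0) := by
  intro M' hM e env
  simp only [leftEv, jumpE, eval_add, eval_sub, eval_one, eval_eq, eval_read, eval_zero,
    hM 3 (by decide) (by decide) (by decide), hM 13 (by decide) (by decide) (by decide),
    hM 16 (by decide) (by decide) (by decide), hM 5 (by decide) (by decide) (by decide), hx]
  split_ifs <;> simp_all

theorem wp_setNext {e : Expr} {x : ℕ} {Q : Mem → ℕ → ℕ → Prop}
    (hI : PeelInv G st tg ℓ M0 P lo X M) (hM : SearchFrame M M')
    (he : e.eval ω [] M' = x) (hx : x < 2 ^ w)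
    (hmem : ∀ v, key G ℓ (peeled P lo) v < X ↔ key G ℓ (peeled P lo) v < x)
    (hQ : ∀ M2, PeelInv G st tg ℓ M0 P lo x M2 → Q M2 (e.size + 2) (e.size + 2)) :
    wp σ ω (.par (.write 15 0 e)) Q M' := by
  refine wp_par (N := 1) le_rfl fun M2 e2 => ?_
  have hsz : (Par.write 15 0 e).size = e.size + 2 := by
    simp only [Par.size, size_zero]
    omega
  rw [hsz, mul_one]
  refine hQ M2 (hI.setNext (fun a ha => ?_) ?_ hmem)
  · have h15 : ∀ a ∈ [0, 1, 2, 3, 4, 5, 6, 7, 8, 9, 12, 13, 16, 17, 18, 28, 29],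
        a ≠ 15 ∧ a ≠ 19 ∧ a ≠ 20 ∧ a ≠ 21 := by decide
    have := h15 a ha
    rw [Par.frame e2 (by simp [Par.wrt, Par.ctr, Par.res, this.1]),
      hM a this.2.1 this.2.2.1 this.2.2.2]
  · exact Par.written_eq e2 (by simp [Par.ctr, Par.res]) (by simp [Par.Issues, he])
      (by simp [Par.Issues, he]) hx

/-- The threshold advances to the next number `x` that is a key or a gap. The numbers passed are
covered by intervals, so `pot` pays for the work. -/
theorem wp_advance (hI : PeelInv G st tg ℓ M0 P lo X M)
    (hB : ∀ v, ℓ v + G.degree v < B) (hw : 4 * (B + 1) < 2 ^ w) (hX : X ≤ B) :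
    wp σ ω advance (fun M' W D => ∃ x, X ≤ x ∧ x ≤ B ∧ PeelInv G st tg ℓ M0 P lo x M' ∧
      ((∃ v, key G ℓ (peeled P lo) v = x) ∨ tot G ℓ x = 0) ∧
      (∀ y, X ≤ y → y < x → tot G ℓ y ≠ 0 ∧ ∀ v, key G ℓ (peeled P lo) v ≠ y) ∧
      W ≤ 5000 * (x - X + 1) ∧ D ≤ 5000 * (Nat.log 2 (x - X + 1) + 1)) M := by
  have hex : ∃ o, M 6 (X + o) ≠ M 7 (X + o) ∨ M 5 (X + o) = 0 := by
    refine ⟨B - X, Or.inr ?_⟩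
    rw [Nat.add_sub_cancel' hX, hI.static.count, tot_eq_zero]
    exact fun v _ => hB v
  classical
  obtain ⟨o, ho, hmin⟩ : ∃ o, (M 6 (X + o) ≠ M 7 (X + o) ∨ M 5 (X + o) = 0) ∧
      ∀ i < o, ¬ (M 6 (X + i) ≠ M 7 (X + i) ∨ M 5 (X + i) = 0) :=
    ⟨Nat.find hex, Nat.find_spec hex, fun i hi => Nat.find_min hex hi⟩
  have hoB : o ≤ B - X := by
    by_contra hc
    refine hmin (B - X) (by omega) (Or.inr ?_)
    rw [Nat.add_sub_cancel' hX, hI.static.count, tot_eq_zero]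
    exact fun v _ => hB v
  have hpass : ∀ y, X ≤ y → y < X + o → tot G ℓ y ≠ 0 ∧ ∀ v, key G ℓ (peeled P lo) v ≠ y := by
    intro y h1 h2
    have := hmin (y - X) (by omega)
    rw [Nat.add_sub_cancel' h1, hI.static.count, ne_eq, hI.ins_eq_del] at this
    push Not at this
    exact ⟨this.2, this.1⟩
  obtain ⟨A, hA⟩ : ∃ A, A = (checkBlock rightEv).size + 60 := ⟨_, rfl⟩
  have hsize : A ≤ 200 := by rw [hA]; decide
  refine wp_seq (wp_mono (wp_search (tests_rightEv hI.next) ho hmin (by omega))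
    fun M1 W D h => ?_)
  obtain ⟨h19, hfr, hW, hD⟩ := h
  rw [← hA] at hW hD
  refine wp_setNext hI hfr (x := X + o) ?_ (by omega) ?_ fun M2 hM2 =>
    ⟨X + o, by omega, by omega, hM2, ?_, hpass, ?_, ?_⟩
  · simp [nextE, h19, hfr 15 (by decide) (by decide) (by decide), hI.next]
  · intro v
    refine ⟨fun h => by omega, fun h => ?_⟩
    by_contra hc
    exact (hpass _ (by omega) h).2 v rfl
  · rw [hI.static.count, ne_eq, hI.ins_eq_del] at ho
    push Not at ho
    exact ho
  · have h1 := Nat.mul_le_mul_right (o + 1) (Nat.mul_le_mul_left 16 hsize)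
    rw [Nat.add_sub_cancel_left]
    simp only [nextE, Expr.size, size_add, size_zero]
    omega
  · have h1 := Nat.mul_le_mul_right (Nat.log 2 (o + 1) + 1) (Nat.mul_le_mul_left 16 hsize)
    rw [Nat.add_sub_cancel_left]
    simp only [nextE, Expr.size, size_add, size_zero]
    omega

/-- As long as the order is incomplete, some key is not below the next threshold. -/
theorem PeelInv.exists_le_key (hI : PeelInv G st tg ℓ M0 P lo X M) (hlt : P.length < n) :
    ∃ v, X ≤ key G ℓ (peeled P lo) v := by
  by_contra hc
  push Not at hc
  have : (Finset.univ : Finset (Fin n)) ⊆ P.toFinset := fun v _ =>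
    List.mem_toFinset.2 ((hI.mem v).2 (hc v))
  have := (Finset.card_le_card this).trans (List.toFinset_card_le P)
  rw [Finset.card_univ, Fintype.card_fin] at this
  omega

/-- At a gap, the vertex at the current position of the previous order lies beyond the gap, and
no vertex that is not yet in the order has a load below the left end of the component of the union
of intervals that contains this vertex's load. -/
theorem PeelInv.gap (hI : PeelInv G st tg ℓ M0 P P.length X M) (hlt : P.length < n)
    (hJ : JumpOK G ℓ (M0 13)) (ht : tot G ℓ X = 0) :
    ∃ u : Fin n, M 13 (M 16 0) = u ∧ X < ℓ u ∧ ∀ y, X ≤ y → y < ℓ u → tot G ℓ y = 0 →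
      ∀ v, v ∉ P → y < ℓ v := by
  have hP : P.toFinset = Finset.univ.filter (fun v => ℓ v + G.degree v < X) := by
    ext v
    rw [List.mem_toFinset, hI.mem, Finset.mem_filter]
    constructor
    · intro h
      exact ⟨Finset.mem_univ v, tot_eq_zero.1 ht v ((le_key _ v).trans h.le)⟩
    · intro h
      exact lt_of_le_of_lt (key_le _ v) h.2
  have hlen : (Finset.univ.filter (fun v => ℓ v + G.degree v < X)).card = P.length := by
    rw [← hP, List.toFinset_card_of_nodup hI.batch.nodup]
  obtain ⟨u, hu, hiff⟩ := hJ X ht P.length hlt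
  rw [hlen] at hiff
  have hbase : X ≤ ℓ u + G.degree u := by
    by_contra hc
    have := hiff.2 (by omega)
    omega
  have hXu : X < ℓ u := by
    by_contra hc
    have := tot_eq_zero.1 ht u (by omega)
    omega
  refine ⟨u, by rw [hI.batch.loMem, hI.old _ le_rfl, hu], hXu, fun y hXy hyu hy v hv => ?_⟩
  obtain ⟨u', hu', hiff'⟩ := hJ y hy P.length hlt
  obtain rfl : u' = u := Fin.ext (hu'.symm.trans hu)
  have hle : (Finset.univ.filter (fun v => ℓ v + G.degree v < y)).card ≤ P.length := by
    by_contra hc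
    have := hiff'.1 (by omega)
    omega
  rw [← hlen] at hle
  have heq := Finset.eq_of_subset_of_card_le (Finset.monotone_filter_right Finset.univ
    fun v _ (h : ℓ v + G.degree v < X) => lt_of_lt_of_le h hXy) hle
  by_contra hc
  have := tot_eq_zero.1 hy v (by omega)
  apply hv
  rw [← List.mem_toFinset, hP, heq, Finset.mem_filter]
  exact ⟨Finset.mem_univ v, this⟩

/-- From a gap, the threshold jumps to the left end of the component that contains the load of the
next vertex of the previous order, and then advances to a key. -/
theorem wp_jump (hI : PeelInv G st tg ℓ M0 P P.length X M) (hlt : P.length < n)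
    (hJ : JumpOK G ℓ (M0 13)) (ht : tot G ℓ X = 0)
    (hB : ∀ v, ℓ v + G.degree v < B) (hw : 4 * (B + 1) < 2 ^ w) :
    wp σ ω jump (fun M' W D => ∃ x, X ≤ x ∧ x ≤ B ∧ PeelInv G st tg ℓ M0 P P.length x M' ∧
      (∃ v, key G ℓ (peeled P P.length) v = x) ∧
      W + 10000 * pot G ℓ X ≤ 10000 * (pot G ℓ x + 1) ∧
      D ≤ 10000 * (Nat.log 2 (2 * (∑ v, (G.degree v + 1)) + 1) + 1)) M := by
  obtain ⟨u, hu, hXu, hgap⟩ := hI.gap hlt hJ ht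
  have hload : M 3 (M 13 (M 16 0)) = ℓ u := by rw [hu, hI.static.load]
  have hex : ∃ o, ℓ u - o = 0 ∨ M 5 (ℓ u - o - 1) = 0 := ⟨ℓ u, Or.inl (by omega)⟩
  classical
  obtain ⟨o, ho, hmin⟩ : ∃ o, (ℓ u - o = 0 ∨ M 5 (ℓ u - o - 1) = 0) ∧
      ∀ i < o, ¬ (ℓ u - i = 0 ∨ M 5 (ℓ u - i - 1) = 0) :=
    ⟨Nat.find hex, Nat.find_spec hex, fun i hi => Nat.find_min hex hi⟩
  have hoX : o ≤ ℓ u - X - 1 := by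
    by_contra hc
    refine hmin (ℓ u - X - 1) (by omega) (Or.inr ?_)
    rw [hI.static.count, ← ht]
    congr 1
    omega
  have hxu := hB u
  -- the left end of the component
  set y := ℓ u - o with hy
  have hy0 : tot G ℓ (y - 1) = 0 := by
    rw [hI.static.count] at ho
    rcases ho with ho | ho
    · omega
    · exact ho
  have hcov : ∀ i, y ≤ i → i ≤ ℓ u + G.degree u → tot G ℓ i ≠ 0 := by
    intro i h1 h2
    by_cases h3 : ℓ u ≤ i
    · rw [ne_eq, tot_eq_zero]
      intro h
      have := h u h3
      omega
    · have := hmin (ℓ u - i - 1) (by omega)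
      rw [hI.static.count] at this
      push Not at this
      rw [show ℓ u - (ℓ u - i - 1) - 1 = i by omega] at this
      exact this.2
  have hkey : ∀ v, v ∉ P → y ≤ key G ℓ (peeled P P.length) v := fun v hv => by
    have := hgap (y - 1) (by omega) (by omega) hy0 v hv
    have := le_key (G := G) (ℓ := ℓ) (peeled P P.length) v
    omega
  have hpot := pot_add_jump_le (G := G) (ℓ := ℓ) (x := X) (y := y) (z := ℓ u) ht (by omega)
    (fun i h1 h2 => hcov i h1 (by omega))
  have hle := pot_le (G := G) (ℓ := ℓ) (X := y)
  obtain ⟨A, hA⟩ : ∃ A, A = (checkBlock leftEv).size + 60 := ⟨_, rfl⟩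
  have hsize : A ≤ 200 := by rw [hA]; decide
  refine wp_seq (wp_mono (wp_search (tests_leftEv hload) ho hmin (by omega)) fun M1 W D h => ?_)
  obtain ⟨h19, hfr, hW, hD⟩ := h
  rw [← hA] at hW hD
  refine wp_seq (wp_setNext hI hfr (x := y) ?_ (by omega) ?_ fun M2 hM2 => ?_)
  · simp only [jumpE, eval_sub, eval_read, eval_zero, h19,
      hfr 3 (by decide) (by decide) (by decide), hfr 13 (by decide) (by decide) (by decide),
      hfr 16 (by decide) (by decide) (by decide), hload]
    rfl
  · intro v
    refine ⟨fun h => by omega, fun h => ?_⟩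
    by_contra hc
    have := hkey v (fun hv => hc ((hI.mem v).1 hv))
    omega
  refine wp_mono (wp_advance hM2 hB hw (by omega)) fun M3 W3 D3 h => ?_
  obtain ⟨x, hyx, hxB, hM3, hev, hpass, hW3, hD3⟩ := h
  have hu' : u ∉ P := fun hv => by
    have := (hI.mem u).1 hv
    have := le_key (G := G) (ℓ := ℓ) (peeled P P.length) u
    omega
  have hxk : x ≤ key G ℓ (peeled P P.length) u := by
    by_contra hc
    exact (hpass _ (hkey u hu') (by omega)).2 u rfl
  have htx : tot G ℓ x ≠ 0 := hcov x hyx (hxk.trans (key_le _ _))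
  have hpot2 := pot_add_le (G := G) (ℓ := ℓ) hyx fun i h1 h2 => (hpass i h1 h2).1
  have hle2 := pot_le (G := G) (ℓ := ℓ) (X := x)
  have hl1 : Nat.log 2 (o + 1) ≤ Nat.log 2 (2 * (∑ v, (G.degree v + 1)) + 1) :=
    Nat.log_mono_right (by omega)
  have hl2 : Nat.log 2 (x - y + 1) ≤ Nat.log 2 (2 * (∑ v, (G.degree v + 1)) + 1) :=
    Nat.log_mono_right (by omega)
  refine ⟨x, by omega, hxB, hM3, hev.resolve_right htx, ?_, ?_⟩
  · have h1 := Nat.mul_le_mul_right (o + 1) (Nat.mul_le_mul_left 16 hsize)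
    simp only [jumpE, Expr.size, size_sub, size_zero]
    omega
  · have h1 := Nat.mul_le_mul_right (Nat.log 2 (o + 1) + 1) (Nat.mul_le_mul_left 16 hsize)
    simp only [jumpE, Expr.size, size_sub, size_zero]
    omega

/-- Raising the threshold yields a nonempty batch, and the growth of `pot` pays for the work. -/
theorem wp_raise (hI : PeelInv G st tg ℓ M0 P P.length X M) (hR : Rep G st tg)
    (hlt : P.length < n) (hJ : JumpOK G ℓ (M0 13))
    (hB : ∀ v, ℓ v + G.degree v < B) (hw : 4 * (B + 1) < 2 ^ w) (hn : n < 2 ^ w) :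
    wp σ ω raise (fun M' W D => ∃ x Q, X ≤ x ∧ Q ≠ [] ∧
      PeelInv G st tg ℓ M0 (P ++ Q) P.length (x + 1) M' ∧
      (∀ v, v ∉ P → x ≤ key G ℓ (peeled P P.length) v) ∧
      W + 20000 * pot G ℓ X ≤ 20000 * (pot G ℓ (x + 1) + 1) ∧
      D ≤ 20000 * (Nat.log 2 (2 * (∑ v, (G.degree v + 1)) + 1) + 1)) M := by
  obtain ⟨v0, hv0⟩ := PeelInv.exists_le_key hI hlt
  have hXB : X ≤ B := (hv0.trans (key_le _ _)).trans (hB v0).le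
  refine wp_seq (wp_mono (wp_advance hI hB hw hXB) fun M1 W1 D1 h => ?_)
  obtain ⟨x, hXx, hxB, hM1, hev, hpass, hW1, hD1⟩ := h
  have hpot1 := pot_add_le (G := G) (ℓ := ℓ) hXx fun i h1 h2 => (hpass i h1 h2).1
  have hle1 := pot_le (G := G) (ℓ := ℓ) (X := x)
  have hl1 : Nat.log 2 (x - X + 1) ≤ Nat.log 2 (2 * (∑ v, (G.degree v + 1)) + 1) :=
    Nat.log_mono_right (by omega)
  have heval : (Expr.op .eq (.read 5 nextE) 0).eval ω [] M1 = if tot G ℓ x = 0 then 1 else 0 := by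
    simp [nextE, hM1.next, hM1.static.count]
  have hsz : (Expr.op .eq (.read 5 nextE) 0).size ≤ 10 := by decide
  -- collecting the vertices at the threshold
  have hfin : ∀ M2 y W D, PeelInv G st tg ℓ M0 P P.length y M2 → x ≤ y → y ≤ B →
      (∃ v, key G ℓ (peeled P P.length) v = y) →
      W + 10000 * pot G ℓ x ≤ 10000 * (pot G ℓ y + 1) →
      D ≤ 10000 * (Nat.log 2 (2 * (∑ v, (G.degree v + 1)) + 1) + 1) →
      wp σ ω (.seq (.par collectPos) (.par collectOrd)) (fun M' W' D' => ∃ x Q, X ≤ x ∧ Q ≠ [] ∧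
        PeelInv G st tg ℓ M0 (P ++ Q) P.length (x + 1) M' ∧
        (∀ v, v ∉ P → x ≤ key G ℓ (peeled P P.length) v) ∧
        W1 + ((Expr.op .eq (.read 5 nextE) 0).size + W + W') + 20000 * pot G ℓ X ≤
          20000 * (pot G ℓ (x + 1) + 1) ∧
        D1 + ((Expr.op .eq (.read 5 nextE) 0).size + D + D') ≤
          20000 * (Nat.log 2 (2 * (∑ v, (G.degree v + 1)) + 1) + 1)) M2 := by
    intro M2 y W D hM2 hxy hyB hk hW hD
    refine wp_mono (wp_collect hM2 hR hn (by omega)) fun M3 W3 D3 h => ?_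
    obtain ⟨Q, hM3, hQ, hW3, hD3⟩ := h
    have hpot3 := pot_add_sum_le (G := G) (ℓ := ℓ) (Nat.le_succ y)
    have hpot4 := pot_add_sum_le (G := G) (ℓ := ℓ) hxy
    rw [Nat.succ_eq_add_one, Nat.Ico_succ_singleton, Finset.sum_singleton] at hpot3
    refine ⟨y, Q, by omega, ?_, hM3, fun v hv => ?_, by omega, by omega⟩
    · rintro rfl
      obtain ⟨v, hv⟩ := hk
      exact List.not_mem_nil ((hQ v).2 hv)
    · by_contra hc
      exact hv ((hM2.mem v).2 (by omega))
  refine wp_seq (wp_cond (fun he => ?_) fun he => ?_)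
  · have ht : tot G ℓ x = 0 := by
      by_contra hc
      rw [heval, if_neg hc] at he
      exact he rfl
    refine wp_mono (wp_jump hM1 hlt hJ ht hB hw) fun M2 W2 D2 h => ?_
    obtain ⟨y, hxy, hyB, hM2, hk, hW2, hD2⟩ := h
    exact hfin M2 y W2 D2 hM2 hxy hyB hk hW2 hD2
  · have ht : tot G ℓ x ≠ 0 := by
      intro hc
      rw [heval, if_pos hc] at he
      exact absurd he (by decide)
    refine wp_par (N := 1) le_rfl fun M2 e2 => ?_
    have hM : M2 = M1 := funext fun a => Par.frame e2 (by simp [Par.wrt, Par.ctr, Par.res])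
    rw [hM]
    have hsk : Par.skip.size = 1 := rfl
    exact hfin M1 x _ _ hM1 le_rfl hxB (hev.resolve_right ht) (by rw [hsk]; omega)
      (by rw [hsk]; omega)

end Raise

/-! ### The peeling loop -/

section PeelRoundsLemmas

variable {V : Type*} [Fintype V] [DecidableEq V] {G : SimpleGraph V} [DecidableRel G.Adj]
  {ℓ : V → ℕ}

/-- The threshold may be raised at once to a lower bound on the keys of the remaining vertices. -/
theorem PeelRounds.raise_to {R : Finset V} {d x : ℕ} {Bs : List (Finset V)} (hR : R.Nonempty)
    (hd : d ≤ x) (hx : ∀ v ∈ R, x ≤ ℓ v + degIn G R v) (h : PeelRounds G ℓ R x Bs) :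
    PeelRounds G ℓ R d Bs := by
  induction hd using Nat.decreasingInduction with
  | self => exact h
  | of_succ k hk ih =>
    refine PeelRounds.raise hR (Finset.filter_eq_empty_iff.2 fun v hv => ?_) ih
    have := hx v hv
    omega

end PeelRoundsLemmas

section Loop

variable {n : ℕ} {G : SimpleGraph (Fin n)} [DecidableRel G.Adj] {st : ℕ → ℕ} {tg : ℕ → Fin n}
  {w : ℕ} {σ : Scheduler} {ω : ℕ → Fin (2 ^ w)} {M0 M M' : Mem} {ℓ : Fin n → ℕ}
  {P : List (Fin n)} {lo X B : ℕ}

theorem PeelInv.below_eq (hI : PeelInv G st tg ℓ M0 P lo X M) (hX : 1 ≤ X) :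
    below G ℓ (Finset.univ \ peeled P lo) (X - 1) = ParGreedy.batch P lo := by
  have hd := disjoint_peeled_batch hI.batch.nodup lo
  have hu := peeled_union_batch P lo
  ext v
  have h1 := hI.mem v
  rw [← List.mem_toFinset, ← hu, Finset.mem_union, key_eq_compl] at h1
  rw [below, Finset.mem_filter, Finset.mem_sdiff]
  constructor
  · rintro ⟨h2, h3⟩
    exact (h1.2 (by omega)).resolve_left h2.2
  · intro h
    refine ⟨⟨Finset.mem_univ v, Finset.disjoint_right.1 hd h⟩, ?_⟩
    have := h1.1 (Or.inr h)
    omega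

/-- The batches `Ls` lead from the graph `G` to the remaining graph after `P.take lo`, where the
next threshold is `X`. -/
def Reached (G : SimpleGraph (Fin n)) [DecidableRel G.Adj] (ℓ : Fin n → ℕ) (P : List (Fin n))
    (lo X : ℕ) (Ls : List (List (Fin n))) : Prop :=
  P.take lo = Ls.flatten ∧ Ls.length ≤ lo ∧
    ∀ Bs, PeelRounds G ℓ (Finset.univ \ peeled P lo) (X - 1) Bs →
      PeelRounds G ℓ Finset.univ 0 (Ls.map List.toFinset ++ Bs)

/-- Peeling the current batch appends a round. -/
theorem Reached.peel {Ls : List (List (Fin n))} (h : Reached G ℓ P lo X Ls)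
    (hI : PeelInv G st tg ℓ M0 P lo X M) (hlo : lo < P.length) (Q : List (Fin n)) :
    Reached G ℓ (P ++ Q) P.length X (Ls ++ [P.drop lo]) := by
  have hb : (batch P lo).Nonempty := by
    refine ⟨P[lo], ?_⟩
    rw [batch, List.mem_toFinset, List.drop_eq_getElem_cons hlo]
    exact List.mem_cons_self
  have hX : 1 ≤ X := by
    have := (hI.mem P[lo]).1 (List.getElem_mem _)
    omega
  obtain ⟨h1, h2, h3⟩ := h
  refine ⟨?_, ?_, fun Bs hBs => ?_⟩
  · rw [List.take_left', List.flatten_append, ← h1]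
    · simp
    · rfl
  · rw [List.length_append, List.length_singleton]
    omega
  · rw [List.map_append, List.append_assoc]
    refine h3 _ ?_
    have hbel := hI.below_eq hX
    have := PeelRounds.peel (Bs := Bs) (G := G) (ℓ := ℓ) (R := Finset.univ \ peeled P lo)
      (d := X - 1) (by rw [hbel]; exact hb) (by
        rw [hbel, sdiff_sdiff_left, Finset.sup_eq_union, peeled_union_batch]
        rwa [peeled_append] at hBs)
    rw [hbel] at this
    exact this

/-- Raising the threshold appends no round. -/
theorem Reached.raise {Ls : List (List (Fin n))} (h : Reached G ℓ P P.length X Ls) {x : ℕ}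
    (hXx : X ≤ x) (hlt : P.length < n) (hx : ∀ v, v ∉ P → x ≤ key G ℓ (peeled P P.length) v)
    (Q : List (Fin n)) : Reached G ℓ (P ++ Q) P.length (x + 1) Ls := by
  obtain ⟨h1, h2, h3⟩ := h
  have hp : peeled P P.length = P.toFinset := by simp [peeled]
  refine ⟨?_, h2, fun Bs hBs => h3 _ (PeelRounds.raise_to ?_ (by omega) (x := x) ?_ ?_)⟩
  · rw [← h1, List.take_left', List.take_length]
    rfl
  · by_contra hc
    rw [Finset.not_nonempty_iff_eq_empty, Finset.sdiff_eq_empty_iff_subset, hp] at hc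
    have := (Finset.card_le_card hc).trans (List.toFinset_card_le P)
    rw [Finset.card_univ, Fintype.card_fin] at this
    omega
  · intro v hv
    rw [← key_eq_compl]
    refine hx v fun hP => ?_
    rw [Finset.mem_sdiff, hp, List.mem_toFinset] at hv
    exact hv.2 hP
  · rw [peeled_append] at hBs
    rwa [hp]

/-- The work of the peeling up to now is paid for by the potential, the batches, and the degrees of
the vertices in them. -/
def paid (G : SimpleGraph (Fin n)) [DecidableRel G.Adj] (ℓ : Fin n → ℕ) (P : List (Fin n))
    (lo X : ℕ) : ℕ :=
  lo + pot G ℓ X + ∑ v ∈ peeled P lo, (G.degree v + 1)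

/-- Each round has depth `O(log)`, including the preceding raise of the threshold, and the total
work is linear: the batches pay for the rounds, and `pot` for the raises. -/
theorem wp_peelLoop (hI : PeelInv G st tg ℓ M0 [] 0 0 M) (hR : Rep G st tg)
    (hJ : JumpOK G ℓ (M0 13))
    (hB : ∀ v, ℓ v + G.degree v < B) (hw : 4 * (B + 1) < 2 ^ w) (hn : n < 2 ^ w) :
    wp σ ω peelLoop (fun M' W D => ∃ P X c, PeelInv G st tg ℓ M0 P P.length X M' ∧ P.length = n ∧
      IsPeelingOrder G ℓ P c ∧
      W ≤ 200000 * ∑ v, (G.degree v + 1) + 10 ∧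
      D ≤ 40000 * c * (Nat.log 2 (2 * (∑ v, (G.degree v + 1)) + 1) + 1) + 10) M := by
  set S := ∑ v, (G.degree v + 1) with hS
  set L := Nat.log 2 (2 * S + 1) with hL
  have hnS : n ≤ S := by
    have : ∑ _v : Fin n, 1 ≤ S := Finset.sum_le_sum fun v _ => by omega
    simpa using this
  have hs1 : (Expr.op .lt (.read 16 0) nE).size ≤ 10 := by decide
  have hs2 : (Expr.op .eq (.read 16 0) (.read 17 0)).size ≤ 10 := by decide
  refine wp_loop (fun N W D => ∃ P lo X Ls, PeelInv G st tg ℓ M0 P lo X N ∧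
    Reached G ℓ P lo X Ls ∧ W + 40000 * pot G ℓ 0 ≤ 40000 * paid G ℓ P lo X ∧
    D ≤ 40000 * Ls.length * (L + 1)) (fun N => n - N 16 0) ?_ ?_ ?_
  · rintro N W D ⟨P, lo, X, Ls, hN, hRe, hW, hD⟩ he
    have hlo : lo < n := by
      by_contra hc
      simp [nE, hN.batch.loMem, hN.static.inMem.size, hc] at he
    -- peeling a batch
    have hpeel : ∀ N1 P1 X1 W1 D1, PeelInv G st tg ℓ M0 P1 lo X1 N1 → Reached G ℓ P1 lo X1 Ls →
        lo < P1.length → peeled P1 lo = peeled P lo →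
        W1 + 20000 * pot G ℓ X ≤ 20000 * (pot G ℓ X1 + 1) + 10 →
        pot G ℓ X ≤ pot G ℓ X1 → D1 ≤ 20000 * (L + 1) + 10 →
        wp σ ω peelRound (fun M' W' D' => (∃ P lo X Ls, PeelInv G st tg ℓ M0 P lo X M' ∧
          Reached G ℓ P lo X Ls ∧
          W + ((Expr.op .lt (.read 16 0) nE).size + (W1 + W')) + 40000 * pot G ℓ 0 ≤
            40000 * paid G ℓ P lo X ∧
          D + ((Expr.op .lt (.read 16 0) nE).size + (D1 + D')) ≤ 40000 * Ls.length * (L + 1)) ∧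
          n - M' 16 0 < n - N 16 0) N1 := by
      intro N1 P1 X1 W1 D1 hN1 hRe1 hlt hpe hW1 hpot hD1
      refine wp_mono (wp_peelRound hN1 hR hn) fun N2 W2 D2 h => ?_
      obtain ⟨Q, hN2, hW2, hD2⟩ := h
      refine ⟨⟨P1 ++ Q, P1.length, X1, _, hN2, hRe1.peel hN1 hlt Q, ?_, ?_⟩, ?_⟩
      · have hsum : ∑ v ∈ P1.toFinset, (G.degree v + 1) = ∑ v ∈ peeled P lo, (G.degree v + 1) +
            ∑ v ∈ batch P1 lo, (G.degree v + 1) := by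
          rw [← hpe, ← Finset.sum_union (disjoint_peeled_batch hN1.batch.nodup lo),
            peeled_union_batch]
        rw [paid] at hW ⊢
        rw [peeled_append, hsum]
        omega
      · rw [List.length_append, List.length_singleton]
        have e1 : 40000 * (Ls.length + 1) * (L + 1) =
          40000 * Ls.length * (L + 1) + 40000 * (L + 1) := by ring
        omega
      · rw [hN2.batch.loMem, hN.batch.loMem]
        omega
    refine wp_seq (wp_cond (fun he2 => ?_) fun he2 => ?_)
    · obtain rfl : lo = P.length := by
        by_contra hc
        simp [hN.batch.loMem, hN.batch.hiMem, hc] at he2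
      refine wp_mono (wp_raise hN hR hlo hJ hB hw hn) fun N1 W1 D1 h => ?_
      obtain ⟨x, Q, hXx, hQ, hN1, hx, hW1, hD1⟩ := h
      rw [← hS, ← hL] at hD1
      have hQ' := List.length_pos_of_ne_nil hQ
      have hpot := pot_add_sum_le (G := G) (ℓ := ℓ) (X := X) (x := x + 1) (by omega)
      refine hpeel N1 (P ++ Q) (x + 1) _ _ hN1 (hRe.raise hXx hlo hx Q) ?_ ?_ ?_ ?_ ?_
      · rw [List.length_append]
        omega
      · rw [peeled_append]
        simp [peeled]
      · omega
      · omega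
      · omega
    · have hne : lo ≠ P.length := by
        intro hc
        simp [hN.batch.loMem, hN.batch.hiMem, hc] at he2
      have hle := hN.batch.le
      refine wp_par (N := 1) le_rfl fun N1 e1 => ?_
      have hM : N1 = N := funext fun a => Par.frame e1 (by simp [Par.wrt, Par.ctr, Par.res])
      have hsk : Par.skip.size = 1 := rfl
      rw [hM]
      refine hpeel N P X _ _ hN hRe (by omega) rfl ?_ le_rfl ?_
      · rw [hsk]
        omega
      · rw [hsk]
        omega
  · rintro N W D ⟨P, lo, X, Ls, hN, ⟨h1, h2, h3⟩, hW, hD⟩ he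
    have hlo : n ≤ lo := by
      by_contra hc
      simp [nE, hN.batch.loMem, hN.static.inMem.size, not_le.1 hc] at he
    have hle := hN.batch.le
    have hlen := hN.length_le
    have hPn : P.length = n := by omega
    obtain rfl : lo = P.length := by omega
    have hpu : peeled P P.length = Finset.univ := by
      refine (Finset.card_eq_iff_eq_univ _).1 ?_
      rw [Fintype.card_fin, peeled, List.take_length,
        List.toFinset_card_of_nodup hN.batch.nodup, hPn]
    refine ⟨P, X, Ls.length, hN, hPn, ⟨Ls, ?_, ?_, ?_, rfl⟩, ?_, ?_⟩
    · have := h3 [] (by rw [hpu, Finset.sdiff_self]; exact PeelRounds.done _)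
      rwa [List.append_nil] at this
    · intro L hL
      have hnd := hN.batch.nodup.sublist (List.take_sublist P.length P)
      rw [h1, List.nodup_flatten] at hnd
      exact hnd.1 L hL
    · rw [← h1, List.take_length]
    · rw [paid, hpu, ← hS] at hW
      have := pot_le (G := G) (ℓ := ℓ) (X := X)
      omega
    · omega
  · refine ⟨[], 0, 0, [], hI, ⟨rfl, le_rfl, fun Bs hBs => ?_⟩, ?_, by simp⟩
    · simpa [peeled] using hBs
    · rw [paid]
      omega

end Loop

/-! ### The start of an iteration -/

section Init

variable {n : ℕ} {G : SimpleGraph (Fin n)} [DecidableRel G.Adj] {st : ℕ → ℕ} {tg : ℕ → Fin n}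
  {w : ℕ} {σ : Scheduler} {ω : ℕ → Fin (2 ^ w)} {M0 M M' : Mem} {ℓ : Fin n → ℕ}
  {S : Finset (Fin n)} {B : ℕ}

/-- The state between two iterations: the loads `ℓ` and the best subgraph `S` are held in memory,
with the numbers of its edges and vertices in arrays `28` and `29` (the latter is zero as long as
`S` has not been replaced), and the counters of the peeling are cleared. -/
structure IterInv (G : SimpleGraph (Fin n)) [DecidableRel G.Adj] (st : ℕ → ℕ) (tg : ℕ → Fin n)
    (ℓ : Fin n → ℕ) (S : Finset (Fin n)) (M : Mem) : Prop where
  inMem : InMem G st tg M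
  load : ∀ v : Fin n, M 3 v = ℓ v
  flag : ∀ v : Fin n, M 4 v = 0 ↔ v ∈ S
  count : ∀ y, M 5 y = 0
  ins : ∀ y, M 6 y = 0
  del : ∀ y, M 7 y = 0
  dec : ∀ v : Fin n, M 8 v = 0
  jump : JumpOK G ℓ (M 13)
  best : (M 29 0 = 0 ∧ S = Finset.univ) ∨
    (M 29 0 = S.card ∧ S.Nonempty ∧ M 28 0 = (G.edgeFinset ∩ S.sym2).card)

theorem InMem.nE (h : InMem G st tg M) (env : List ℕ) : nE.eval ω env M = n := by
  simp [ParGreedy.nE, h.size]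

theorem InMem.vertexLoop_total (h : InMem G st tg M) {p : Par} {f : Req → ℕ} {env : List ℕ} :
    (Par.parfor ParGreedy.nE p).total ω M f env = ∑ v : Fin n, p.total ω M f ((v : ℕ) :: env) := by
  rw [Par.total, h.nE, Finset.sum_range]

theorem InMem.vertexLoop_issues (h : InMem G st tg M) {p : Par} {r : Req} {env : List ℕ} :
    (Par.parfor ParGreedy.nE p).Issues ω M r env ↔ ∃ v : Fin n, p.Issues ω M r ((v : ℕ) :: env) := by
  rw [Par.Issues, h.nE]
  exact ⟨fun ⟨i, hi, hr⟩ => ⟨⟨i, hi⟩, hr⟩, fun ⟨v, hr⟩ => ⟨v, v.2, hr⟩⟩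

theorem InMem.vertexLoop_count (h : InMem G st tg M) {p : Par} {env : List ℕ} :
    (Par.parfor ParGreedy.nE p).count ω M env = 1 + ∑ v : Fin n, p.count ω M ((v : ℕ) :: env) := by
  rw [Par.count, h.nE, Finset.sum_range]

/-- The cells of array `10` used by different vertices are different. -/
theorem Rep.unique_slot (h : Rep G st tg) {v v' : Fin n} {j j' : ℕ} (hj : j ≤ G.degree v)
    (hj' : j' ≤ G.degree v') (he : st v + v + j = st v' + v' + j') : v = v' ∧ j = j' := by
  have h1 := h.succ v
  have h2 := h.succ v'
  rcases lt_trichotomy v v' with hlt | rfl | hlt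
  · have := h.mono (v := v + 1) (u := v') hlt v'.2.le
    have : (v : ℕ) < v' := hlt
    omega
  · exact ⟨rfl, by omega⟩
  · have := h.mono (v := v' + 1) (u := v) hlt v.2.le
    have : (v' : ℕ) < v := hlt
    omega

theorem card_interval (ℓ : Fin n → ℕ) (v : Fin n) (y : ℕ) :
    ((Finset.range (G.degree v + 1)).filter (fun j => ℓ v + j = y)).card =
      if ℓ v ≤ y ∧ y ≤ ℓ v + G.degree v then 1 else 0 := by
  rw [Finset.card_filter]
  split_ifs with h
  · rw [Finset.sum_eq_single (y - ℓ v)]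
    · rw [if_pos (by omega)]
    · intro j _ hj
      rw [if_neg (by omega)]
    · intro hj
      rw [Finset.mem_range] at hj
      omega
  · refine Finset.sum_eq_zero fun j hj => if_neg ?_
    rw [Finset.mem_range] at hj
    omega

/-- The slots handed out to the vertices. -/
structure Slots (G : SimpleGraph (Fin n)) [DecidableRel G.Adj] (st : ℕ → ℕ) (ℓ : Fin n → ℕ)
    (r : ℕ → ℕ) : Prop where
  range : ∀ v : Fin n, ∀ j ≤ G.degree v, r (st v + v + j) < tot G ℓ (ℓ v + j)
  inj : ∀ v v' : Fin n, ∀ j ≤ G.degree v, ∀ j' ≤ G.degree v', ℓ v + j = ℓ v' + j' →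
    r (st v + v + j) = r (st v' + v' + j') → v = v'

theorem initCount_effect (h : IterInv G st tg ℓ S M) (hR : Rep G st tg) (hn : n < 2 ^ w)
    (he : Eff w (initCount.reqs ω M []) M M') :
    (∀ a, a ∉ [5, 6, 10, 14, 15, 16, 17, 18] → M' a = M a) ∧
    (∀ y, M' 5 y = tot G ℓ y) ∧
    (∀ y, M' 6 y = (Finset.univ.filter (fun v => ℓ v + G.degree v = y)).card) ∧
    M' 15 0 = 0 ∧ M' 16 0 = 0 ∧ M' 17 0 = 0 ∧ M' 18 0 = 0 ∧ Slots G st ℓ (M' 10) := by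
  have hbase : ∀ v : Fin n, (baseE (.idx 0)).eval ω [(v : ℕ)] M = ℓ v + G.degree v := by
    intro v
    rw [baseE, eval_add, h.inMem.degE hR (v := v) rfl, eval_read, eval_idx_zero, h.load]
  have hdeg : ∀ v : Fin n, (degE (.idx 0)).eval ω [(v : ℕ)] M = G.degree v := fun v =>
    h.inMem.degE hR rfl
  have hx : ∀ (v : Fin n) (j : ℕ), (.read 3 (.idx 1) + .idx 0 : Expr).eval ω [j, (v : ℕ)] M =
      ℓ v + j := by
    intro v j
    rw [eval_add, eval_read, eval_idx_one, eval_idx_zero, h.load]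
  have hs : ∀ (v : Fin n) (j : ℕ), (.read 1 (.idx 1) + .idx 1 + .idx 0 : Expr).eval ω
      [j, (v : ℕ)] M = st v + v + j := by
    intro v j
    rw [eval_add, eval_add, eval_read, eval_idx_one, eval_idx_zero, h.inMem.start v v.2.le]
  have t5 : ∀ y, initCount.total ω M (Req.inc 5 y) [] = tot G ℓ y := by
    intro y
    rw [initCount, Par.total, h.inMem.vertexLoop_total, tot, Finset.card_filter]
    simp only [Par.total, eval_add, hdeg, eval_one, Req.inc]
    simp only [← eval_add, hx]
    simp [card_interval]
  have t6 : ∀ y, initCount.total ω M (Req.inc 6 y) [] =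
      (Finset.univ.filter (fun v => ℓ v + G.degree v = y)).card := by
    intro y
    rw [initCount, Par.total, h.inMem.vertexLoop_total, Finset.card_filter]
    simp only [Par.total, hbase, Req.inc]
    simp
  have t10 : ∀ i, initCount.total ω M (Req.hit 10 i) [] ≤ 1 := by
    intro i
    rw [initCount, Par.total, h.inMem.vertexLoop_total]
    simp only [Par.total, eval_add _ (degE _), hdeg, eval_one, Req.hit, hs]
    simp only [true_and, add_zero, Nat.reduceEqDiff, false_and, if_false, zero_add]
    by_cases hi : ∃ v : Fin n, ∃ j ≤ G.degree v, st v + v + j = i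
    · obtain ⟨v, j, hj, rfl⟩ := hi
      rw [Finset.sum_eq_single v, Finset.sum_eq_single j]
      · simp
      · intro j' _ hj'
        rw [if_neg (by omega)]
      · intro hc
        exact absurd (Finset.mem_range.2 (by omega)) hc
      · intro v' _ hv'
        refine Finset.sum_eq_zero fun j' hj' => if_neg fun hc => hv' ?_
        rw [Finset.mem_range] at hj'
        exact (hR.unique_slot (by omega) hj hc).1
      · intro hc
        exact absurd (Finset.mem_univ v) hc
    · push Not at hi
      refine le_of_eq_of_le (Finset.sum_eq_zero fun v _ => Finset.sum_eq_zero fun j hj =>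
        if_neg (hi v j ?_)) zero_le_one
      rw [Finset.mem_range] at hj
      omega
  have hi10 : ∀ i k, Req.fetchAdd 5 i 1 10 k ∈ initCount.reqs ω M [] ↔
      ∃ v : Fin n, ∃ j ≤ G.degree v, i = ℓ v + j ∧ k = st v + v + j := by
    intro i k
    rw [Par.mem_reqs, initCount, Par.Issues, h.inMem.vertexLoop_issues]
    simp only [Par.Issues, eval_add _ (degE _), hdeg, eval_one, hx, hs, Req.fetchAdd.injEq]
    simp [Nat.lt_succ_iff]
  have htick := Par.tickets (a := 5) (b := 10) he (by decide) (by decide) (by decide) (by decide)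
    (fun i _ => by
      rw [t5, h.count, zero_add]
      exact (card_le_n _).trans_lt hn) t10
  have hc5 : ∀ y, M' 5 y = tot G ℓ y := by
    intro y
    rw [Par.counter he (by decide), t5, h.count, zero_add]
    rw [t5, h.count, zero_add]
    exact (card_le_n _).trans_lt hn
  have hw : ∀ a i x, (Par.parfor nE (.both (.fetchAdd 6 (baseE (.idx 0)) 1 14 0)
    (.parfor (degE (.idx 0) + 1) (.fetchAdd 5 (.read 3 (.idx 1) + .idx 0) 1 10
      (.read 1 (.idx 1) + .idx 1 + .idx 0))))).Issues ω M (.write a i x) [] ↔ False := by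
    intro a i x
    rw [iff_false]
    intro hc
    have := Par.mem_wrt hc
    simp [Par.wrt] at this
  have hzero : ∀ a ∈ [15, 16, 17, 18], M' a 0 = 0 := by
    intro a ha
    have h3 : a ∉ initCount.ctr ++ initCount.res := by
      revert a
      decide
    refine Par.written_eq he h3 ?_ ?_ (by positivity)
    · simp only [initCount, Par.Issues, hw, Req.write.injEq, eval_zero]
      simpa using ha
    · intro v hv
      simp only [initCount, Par.Issues, hw, Req.write.injEq, eval_zero] at hv
      tauto
  refine ⟨fun a ha => Par.frame he ?_, hc5, fun y => ?_, hzero _ (by decide), hzero _ (by decide),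
    hzero _ (by decide), hzero _ (by decide), ?_, ?_⟩
  · simp only [initCount, Par.wrt, Par.ctr, Par.res]
    simp at ha ⊢
    omega
  · rw [Par.counter he (by decide), t6, h.ins, zero_add]
    rw [t6, h.ins, zero_add]
    exact (card_le_n _).trans_lt hn
  · intro v j hj
    have := (htick.range _ _ ((hi10 _ _).2 ⟨v, j, hj, rfl, rfl⟩)).2
    rwa [hc5] at this
  · intro v v' j hj j' hj' hy hr
    have := htick.inj (ℓ v + j) _ _ ((hi10 _ _).2 ⟨v, j, hj, rfl, rfl⟩)
      ((hi10 _ _).2 ⟨v', j', hj', hy, rfl⟩) hr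
    exact (hR.unique_slot hj hj' this).1

/-- The counters and lists for the peeling are set up in work linear in the size of the graph, since
the interval of `v` has `deg v + 1` elements. -/
theorem wp_init {c : Cmd} {Q : Mem → ℕ → ℕ → Prop} (h : IterInv G st tg ℓ S M) (hR : Rep G st tg)
    (hn : n < 2 ^ w) (hc : ∀ M' W D, PeelInv G st tg ℓ M [] 0 0 M' →
      W ≤ 1000 * (∑ v, (G.degree v + 1) + 1) → D ≤ 1000 →
      wp σ ω c (fun M2 W2 D2 => Q M2 (W + W2) (D + D2)) M') :
    wp σ ω (.seq (.par initCount) (.seq (.par initList) c)) Q M := by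
  set s := ∑ v, (G.degree v + 1) with hs
  have hdeg : ∀ v : Fin n, (degE (.idx 0)).eval ω [(v : ℕ)] M = G.degree v := fun v =>
    h.inMem.degE hR rfl
  have hcount1 : initCount.count ω M [] ≤ 5 + 3 * s := by
    rw [initCount, Par.count, h.inMem.vertexLoop_count]
    simp only [Par.count, eval_add _ (degE _), hdeg, eval_one, Finset.sum_const, Finset.card_range,
      smul_eq_mul, mul_one]
    rw [hs, Finset.mul_sum]
    have : ∑ v : Fin n, (1 + (1 + (G.degree v + 1))) ≤ ∑ v, 3 * (G.degree v + 1) :=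
      Finset.sum_le_sum fun v _ => by omega
    omega
  refine wp_seq (wp_par hcount1 fun M1 e1 => ?_)
  obtain ⟨f1, c5, c6, z15, z16, z17, z18, hslot⟩ := initCount_effect h hR hn e1
  have I1 : InMem G st tg M1 := h.inMem.congr (f1 0 (by decide)) (f1 1 (by decide))
    (f1 2 (by decide))
  have L1 : ∀ v : Fin n, M1 3 v = ℓ v := by
    rw [f1 3 (by decide)]
    exact h.load
  have hdeg1 : ∀ v : Fin n, (degE (.idx 0)).eval ω [(v : ℕ)] M1 = G.degree v := fun v =>
    I1.degE hR rfl
  have hcount2 : initList.count ω M1 [] ≤ 1 + 2 * s := by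
    rw [initList, I1.vertexLoop_count]
    simp only [Par.count, eval_add _ (degE _), hdeg1, eval_one, Finset.sum_const,
      Finset.card_range, smul_eq_mul, mul_one]
    rw [hs, Finset.mul_sum]
    exact Nat.add_le_add_left (Finset.sum_le_sum fun v _ => by omega) _
  refine wp_seq (wp_par hcount2 fun M2 e2 => ?_)
  have f2 : ∀ a, a ≠ 9 → M2 a = M1 a := fun a ha =>
    Par.frame e2 (by simp [initList, Par.wrt, Par.ctr, Par.res, ha])
  have hiss : ∀ i x, initList.Issues ω M1 (.write 9 i x) [] ↔ ∃ v : Fin n, ∃ j ≤ G.degree v,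
      i = (ℓ v + j) * n + M1 10 (st v + v + j) ∧ x = v := by
    intro i x
    rw [initList, I1.vertexLoop_issues]
    simp only [Par.Issues, eval_add _ (degE _), hdeg1, eval_one, eval_add, eval_mul, eval_read,
      eval_idx_one, eval_idx_zero, L1, I1.nE, I1.start _ (Fin.is_lt _).le, Req.write.injEq]
    simp [Nat.lt_succ_iff]
  have htn : ∀ y, tot G ℓ y ≤ n := fun y => card_le_n _
  have hlist : ∀ v : Fin n, ∀ j ≤ G.degree v,
      M2 9 ((ℓ v + j) * n + M1 10 (st v + v + j)) = v := by
    intro v j hj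
    refine Par.written_eq e2 (by decide) ((hiss _ _).2 ⟨v, j, hj, rfl, rfl⟩) (fun x hx => ?_)
      (v.2.trans hn)
    obtain ⟨v', j', hj', he, rfl⟩ := (hiss _ _).1 hx
    have r1 := (hslot.range v j hj).trans_le (htn _)
    have r2 := (hslot.range v' j' hj').trans_le (htn _)
    have hn0 : 0 < n := v.pos
    have hq : ℓ v + j = ℓ v' + j' := by
      have := congrArg (· / n) he
      simp only [mul_comm _ n, Nat.mul_add_div hn0, Nat.div_eq_of_lt r1,
        Nat.div_eq_of_lt r2] at this
      omega
    rw [hq] at he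
    exact congrArg _ (hslot.inj v' v j' hj' j hj hq.symm (by omega))
  have I2 : InMem G st tg M2 := I1.congr (f2 0 (by decide)) (f2 1 (by decide)) (f2 2 (by decide))
  have hp : peeled ([] : List (Fin n)) 0 = ∅ := rfl
  have hd0 : ∀ v, degIn G ∅ v = 0 := fun v => by simp [degIn]
  have hk : ∀ v, key G ℓ ∅ v = ℓ v + G.degree v := fun v => by rw [key, hd0, Nat.sub_zero]
  refine wp_mono (hc M2 (initCount.size * (5 + 3 * s) + initList.size * (1 + 2 * s))
    (initCount.size + initList.size) ⟨⟨I2, ?_, ?_, ?_⟩, ⟨I2, ?_, List.nodup_nil, ?_, ?_, le_rfl⟩,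
    ?_, ?_, ?_, ?_, ?_, ?_, ?_, ?_, ?_⟩ ?_ ?_) fun M3 W3 D3 h3 => by
      simpa only [add_assoc] using h3
  · rw [f2 3 (by decide)]
    exact L1
  · rw [f2 5 (by decide)]
    exact c5
  · intro v y h1 h2
    have h3 := hslot.range v (y - ℓ v) (by omega)
    have h4 := hlist v (y - ℓ v) (by omega)
    rw [Nat.add_sub_cancel' h1] at h3 h4
    exact ⟨_, h3, h4⟩
  · intro i hi
    exact absurd hi (Nat.not_lt_zero i)
  · rw [f2 16 (by decide), z16]
  · rw [f2 17 (by decide), z17]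
    rfl
  · rw [f2 18 (by decide), z18]
    rfl
  · rw [f2 15 (by decide), z15]
  · intro i hi
    exact absurd hi (Nat.not_lt_zero i)
  · intro i _
    rw [f2 13 (by decide), f1 13 (by decide)]
  · intro v
    rw [f2 8 (by decide), f1 8 (by decide), h.dec, hp, hd0]
  · intro v
    simp
  · intro y
    rw [f2 6 (by decide), c6, hp]
    simp only [hk]
    congr 1
    ext v
    simp only [Finset.mem_filter, Finset.mem_univ, true_and]
    omega
  · intro y
    rw [f2 7 (by decide), f1 7 (by decide), h.del, hp]
    simp only [hk]
    symm
    rw [Finset.card_eq_zero, Finset.filter_eq_empty_iff]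
    intro v _
    omega
  · intro a ha
    rw [f2 a (by rintro rfl; simp at ha), f1 a (by fin_cases ha <;> decide)]
  · have y1 : initCount.size ≤ 150 := by decide
    have y2 : initList.size ≤ 100 := by decide
    have y3 := Nat.mul_le_mul_right (5 + 3 * s) y1
    have y4 := Nat.mul_le_mul_right (1 + 2 * s) y2
    omega
  · decide

end Init

/-! ### Sweeps over a binary tree -/

section Sweep

variable {w : ℕ} {σ : Scheduler} {ω : ℕ → Fin (2 ^ w)} {M M' : Mem} {J : ℕ}

theorem wp_findPow {n : ℕ} (hM : M 0 0 = n) (hn : 0 < n) (hw : 2 * n ≤ 2 ^ w) :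
    wp σ ω findPow (fun M' W D => ∃ J, M' 23 0 = 2 ^ J ∧ n ≤ 2 ^ J ∧ 2 ^ J < 2 * n ∧
      (∀ a, a ≠ 23 → M' a = M a) ∧ W ≤ 20 * (J + 1) ∧ D ≤ 20 * (J + 1)) M := by
  refine wp_seq (wp_par le_rfl fun M1 e1 => ?_)
  have h1 : M1 23 0 = 1 := Par.written_eq e1 (by decide) (by simp [Par.Issues])
    (by simp [Par.Issues]) (by omega)
  have f1 : ∀ a, a ≠ 23 → M1 a = M a := fun a ha =>
    Par.frame e1 (by simp [Par.wrt, Par.ctr, Par.res, ha])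
  refine wp_loop (fun N W D => ∃ j, N 23 0 = 2 ^ j ∧ 2 ^ j < 2 * n ∧ (∀ a, a ≠ 23 → N a = M a) ∧
    W ≤ 20 * j ∧ D ≤ 20 * j) (fun N => n - N 23 0) ?_ ?_ ?_
  · rintro N W D ⟨j, hj, hlt, hN, hW, hD⟩ he
    have hjn : 2 ^ j < n := by
      by_contra hc
      simp [nE, hj, hN 0 (by decide), hM, hc] at he
    refine wp_par le_rfl fun N1 e2 => ?_
    have h2 : N1 23 0 = 2 ^ (j + 1) := by
      refine Par.written_eq e2 (by decide) ?_ ?_ ?_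
      · simp [Par.Issues, hj, pow_succ]
        omega
      · simp [Par.Issues, hj, pow_succ]
        omega
      · rw [pow_succ]
        omega
    have hpos : 0 < 2 ^ j := by positivity
    refine ⟨⟨j + 1, h2, by rw [pow_succ]; omega, fun a ha => ?_, ?_, ?_⟩, ?_⟩
    · rw [Par.frame e2 (by simp [Par.wrt, Par.ctr, Par.res, ha]), hN a ha]
    · simp only [nE, Par.size, Par.count, Expr.size, size_zero, size_add]
      omega
    · simp only [nE, Par.size, Expr.size, size_zero, size_add]
      omega
    · rw [h2, hj, pow_succ]
      omega
  · rintro N W D ⟨j, hj, hlt, hN, hW, hD⟩ he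
    have hjn : n ≤ 2 ^ j := by
      by_contra hc
      simp [nE, hj, hN 0 (by decide), hM, not_le.1 hc] at he
    refine ⟨j, hj, hjn, hlt, hN, ?_, ?_⟩
    · simp only [nE, Par.size, Par.count, Expr.size, size_zero, size_one]
      omega
    · simp only [nE, Par.size, Expr.size, size_zero, size_one]
      omega
  · exact ⟨0, h1, by omega, f1, le_rfl, le_rfl⟩

/-- The parallel step in the loop of `upSweep`. -/
def upStep (a : ℕ) (f : Expr → Expr) : Par :=
  .both (.parfor (.read 23 0) (.write a (.read 23 0 + .idx 0) (f (.read 23 0 + .idx 0))))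
    (.write 23 0 (.read 23 0 / 2))

/-- `lvl j i` is the value of node `2 ^ (J - j) + i`, the `i`-th one at height `j` above the leaves.
-/
theorem wp_upSweep {a Z : ℕ} {f : Expr → Expr} {g : ℕ → ℕ → ℕ} {lvl : ℕ → ℕ → ℕ} (ha : a ≠ 23)
    (hf : ∀ M', (∀ b, b ≠ a → b ≠ 23 → M' b = M b) → ∀ e env, (f e).eval ω env M' =
      g (M' a (2 * e.eval ω env M')) (M' a (2 * e.eval ω env M' + 1)))
    (hM : M 22 0 = 2 ^ J) (hw : 2 ^ J < 2 ^ w) (hZ : (upStep a f).size ≤ Z)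
    (hleaf : ∀ i < 2 ^ J, M a (2 ^ J + i) = lvl 0 i)
    (hlvl : ∀ j i, lvl (j + 1) i = g (lvl j (2 * i)) (lvl j (2 * i + 1)))
    (hlt : ∀ j i, lvl j i < 2 ^ w) :
    wp σ ω (upSweep a f) (fun M' W D => (∀ k ≤ J, ∀ i < 2 ^ k, M' a (2 ^ k + i) = lvl (J - k) i) ∧
      (∀ b, b ≠ a → b ≠ 23 → M' b = M b) ∧ W ≤ 4 * (Z + 20) * 2 ^ J ∧
      D ≤ (Z + 20) * (J + 1)) M := by
  have hJ : 1 ≤ 2 ^ J := Nat.one_le_two_pow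
  refine wp_seq (wp_par le_rfl fun M1 e1 => ?_)
  have h1 : M1 23 0 = 2 ^ J / 2 := by
    refine Par.written_eq e1 (by decide) ?_ ?_ ?_
    · simp [Par.Issues, hM]
    · simp [Par.Issues, hM]
    · omega
  have f1 : ∀ a, a ≠ 23 → M1 a = M a := fun a ha =>
    Par.frame e1 (by simp [Par.wrt, Par.ctr, Par.res, ha])
  refine wp_loop (fun N W D => (∀ b, b ≠ a → b ≠ 23 → N b = M b) ∧ ∃ k ≤ J, N 23 0 = 2 ^ k / 2 ∧
    (∀ k', k ≤ k' → k' ≤ J → ∀ i < 2 ^ k', N a (2 ^ k' + i) = lvl (J - k') i) ∧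
    W + 3 * (Z + 20) * 2 ^ k ≤ 3 * (Z + 20) * 2 ^ J ∧ D + (Z + 20) * k ≤ (Z + 20) * J)
    (fun N => N 23 0) ?_ ?_ ?_
  · rintro N W D ⟨hN, k, hk, hs, hl, hW, hD⟩ he
    have hk0 : k ≠ 0 := by
      rintro rfl
      simp [hs] at he
    obtain ⟨k, rfl⟩ := Nat.exists_eq_succ_of_ne_zero hk0
    have hpow : 2 ^ (k + 1) = 2 * 2 ^ k := by rw [pow_succ, mul_comm]
    have hpos : 1 ≤ 2 ^ k := Nat.one_le_two_pow
    have hkJ : 2 ^ (k + 1) ≤ 2 ^ J := Nat.pow_le_pow_right (by norm_num) hk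
    rw [Nat.succ_eq_add_one] at *
    have hs' : N 23 0 = 2 ^ k := by rw [hs]; omega
    have hcount : (upStep a f).count ω N [] ≤ 2 + 2 ^ k := by
      simp only [upStep, Par.count, eval_read, eval_zero, hs', Finset.sum_const, Finset.card_range,
        smul_eq_mul, mul_one]
      omega
    change wp σ ω (.par (upStep a f)) _ N
    refine wp_par hcount fun N1 e2 => ?_
    have hiss : ∀ i x, (upStep a f).Issues ω N (.write a i x) [] ↔ ∃ i' < 2 ^ k, i = 2 ^ k + i' ∧
        x = g (N a (2 * (2 ^ k + i'))) (N a (2 * (2 ^ k + i') + 1)) := by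
      intro i x
      simp only [upStep, Par.Issues, Req.write.injEq, hf N hN, eval_read, eval_zero, hs', eval_add,
        eval_idx_zero, true_and, ha, false_and, or_false]
    have hn23 : N1 23 0 = 2 ^ k / 2 := by
      refine Par.written_eq e2 (by simp [upStep, Par.ctr, Par.res]) ?_ ?_ ?_
      · simp [upStep, Par.Issues, hs']
      · intro v hv
        simpa [upStep, Par.Issues, hs', ha.symm] using hv
      · omega
    refine ⟨⟨fun b hb hb' => ?_, k, by omega, hn23, fun k' hk' hkJ' i hi => ?_, ?_, ?_⟩, ?_⟩
    · rw [Par.frame e2 (by simp [upStep, Par.wrt, Par.ctr, Par.res, hb, hb']), hN b hb hb']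
    · rcases hk'.eq_or_lt with rfl | hlt'
      · refine Par.written_eq e2 (by simp [upStep, Par.ctr, Par.res])
          ((hiss _ _).2 ⟨i, hi, rfl, ?_⟩) (fun x hx => ?_) (hlt _ _)
        · rw [show J - k = J - (k + 1) + 1 by omega, hlvl,
            ← hl (k + 1) le_rfl hk (2 * i) (by omega), ← hl (k + 1) le_rfl hk (2 * i + 1) (by omega),
            hpow]
          congr 2 <;> ring
        · obtain ⟨i', hi', he', rfl⟩ := (hiss _ _).1 hx
          obtain rfl : i = i' := by omega
          rw [show J - k = J - (k + 1) + 1 by omega, hlvl,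
            ← hl (k + 1) le_rfl hk (2 * i) (by omega), ← hl (k + 1) le_rfl hk (2 * i + 1) (by omega),
            hpow]
          congr 2 <;> ring
      · rw [← hl k' hlt' hkJ' i hi]
        refine Par.not_written e2 (by simp [upStep, Par.ctr, Par.res]) fun x hx => ?_
        obtain ⟨i', hi', he', _⟩ := (hiss _ _).1 hx
        have : 2 ^ (k + 1) ≤ 2 ^ k' := Nat.pow_le_pow_right (by norm_num) hlt'
        omega
    · have y1 := Nat.mul_le_mul_right (2 + 2 ^ k) hZ
      have y2 : Z * (2 + 2 ^ k) ≤ Z * (3 * 2 ^ k) := Nat.mul_le_mul_left _ (by omega)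
      have y3 : Z * (3 * 2 ^ k) = 3 * (Z * 2 ^ k) := by ring
      have y4 : 3 * (Z + 20) * 2 ^ (k + 1) = 6 * (Z * 2 ^ k) + 120 * 2 ^ k := by rw [hpow]; ring
      have y5 : 3 * (Z + 20) * 2 ^ k = 3 * (Z * 2 ^ k) + 60 * 2 ^ k := by ring
      simp only [Expr.size, size_zero]
      omega
    · have y4 : (Z + 20) * (k + 1) = (Z + 20) * k + (Z + 20) := by ring
      simp only [Expr.size, size_zero]
      omega
    · rw [hn23, hs']
      omega
  · rintro N W D ⟨hN, k, hk, hs, hl, hW, hD⟩ he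
    have hk0 : k = 0 := by
      by_contra hc
      have : 2 ≤ 2 ^ k := Nat.le_self_pow hc 2
      have h0 : 0 < 2 ^ k / 2 := by omega
      simp [hs, h0] at he
    subst hk0
    refine ⟨fun k' hk' => hl k' (Nat.zero_le _) hk', hN, ?_, ?_⟩
    · simp only [Par.size, Par.count, Expr.size, size_zero, size_div, size_two]
      have y1 : 4 * (Z + 20) * 2 ^ J = 3 * (Z + 20) * 2 ^ J + Z * 2 ^ J + 20 * 2 ^ J := by ring
      omega
    · simp only [Par.size, Expr.size, size_zero, size_div, size_two]
      have y1 : (Z + 20) * (J + 1) = (Z + 20) * J + Z + 20 := by ring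
      omega
  · refine ⟨fun b hb hb' => f1 b hb', J, le_rfl, h1, fun k' hk' hkJ i hi => ?_, by omega, by omega⟩
    obtain rfl : k' = J := by omega
    rw [f1 a ha, hleaf i hi, Nat.sub_self]

variable {leaf : ℕ → ℕ}

/-- The sum of the leaves below a node at height `j`. -/
def blockSum (leaf : ℕ → ℕ) (j i : ℕ) : ℕ := ∑ x ∈ Finset.Ico (2 ^ j * i) (2 ^ j * (i + 1)), leaf x

theorem blockSum_zero (i : ℕ) : blockSum leaf 0 i = leaf i := by
  simp [blockSum]

theorem blockSum_succ (j i : ℕ) :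
    blockSum leaf (j + 1) i = blockSum leaf j (2 * i) + blockSum leaf j (2 * i + 1) := by
  have h1 : 2 ^ (j + 1) * i = 2 ^ j * (2 * i) := by ring
  have h2 : 2 ^ (j + 1) * (i + 1) = 2 ^ j * (2 * i + 1 + 1) := by ring
  rw [blockSum, blockSum, blockSum, h1, h2, Finset.sum_Ico_consecutive]
  · exact Nat.mul_le_mul_left _ (by omega)
  · exact Nat.mul_le_mul_left _ (by omega)

/-- The parallel step in the loop of `downSweep`. -/
def downStep : Par :=
  .both (.parfor (.read 23 0) (.both
    (.write 25 (2 * (.read 23 0 + .idx 0))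
      (.read 25 (.read 23 0 + .idx 0) + .read 24 (2 * (.read 23 0 + .idx 0) + 1)))
    (.write 25 (2 * (.read 23 0 + .idx 0) + 1) (.read 25 (.read 23 0 + .idx 0)))))
  (.write 23 0 (.read 23 0 + .read 23 0))

theorem wp_downSweep (hM : M 22 0 = 2 ^ J) (hw : 2 ^ J < 2 ^ w)
    (htree : ∀ k ≤ J, ∀ i < 2 ^ k, M 24 (2 ^ k + i) = blockSum leaf (J - k) i)
    (hlt : ∑ x ∈ Finset.range (2 ^ J), leaf x < 2 ^ w) :
    wp σ ω downSweep (fun M' W D =>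
      (∀ i < 2 ^ J, M' 25 (2 ^ J + i) = ∑ x ∈ Finset.Ico (i + 1) (2 ^ J), leaf x) ∧
      (∀ b, b ≠ 23 → b ≠ 25 → M' b = M b) ∧ W ≤ 1000 * 2 ^ J ∧ D ≤ 200 * (J + 1)) M := by
  have hJ : 1 ≤ 2 ^ J := Nat.one_le_two_pow
  refine wp_seq (wp_par le_rfl fun M1 e1 => ?_)
  have h1 : M1 23 0 = 1 := Par.written_eq e1 (by decide) (by simp [Par.Issues])
    (by simp [Par.Issues]) (by omega)
  have h2 : M1 25 1 = 0 := Par.written_eq e1 (by decide) (by simp [Par.Issues])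
    (by simp [Par.Issues]) (by omega)
  have f1 : ∀ a, a ≠ 23 → a ≠ 25 → M1 a = M a := fun a ha hb =>
    Par.frame e1 (by simp [Par.wrt, Par.ctr, Par.res, ha, hb])
  have hsize : downStep.size ≤ 100 := by decide
  refine wp_loop (fun N W D => (∀ b, b ≠ 23 → b ≠ 25 → N b = M b) ∧ ∃ k ≤ J, N 23 0 = 2 ^ k ∧
    (∀ i < 2 ^ k, N 25 (2 ^ k + i) = ∑ x ∈ Finset.Ico (2 ^ (J - k) * (i + 1)) (2 ^ J), leaf x) ∧
    W ≤ 700 * 2 ^ k ∧ D ≤ 200 * k)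
    (fun N => 2 ^ J - N 23 0) ?_ ?_ ?_
  · rintro N W D ⟨hN, k, hk, hs, hl, hW, hD⟩ he
    have hkJ : k + 1 ≤ J := by
      by_contra hc
      obtain rfl : k = J := by omega
      simp [hs, hN 22 (by decide) (by decide), hM] at he
    have hpow : 2 ^ (k + 1) = 2 * 2 ^ k := by rw [pow_succ, mul_comm]
    have hpos : 1 ≤ 2 ^ k := Nat.one_le_two_pow
    have hkJ' : 2 ^ (k + 1) ≤ 2 ^ J := Nat.pow_le_pow_right (by norm_num) hkJ
    have hcount : downStep.count ω N [] ≤ 2 + 2 * 2 ^ k := by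
      simp only [downStep, Par.count, eval_read, eval_zero, hs, Finset.sum_const, Finset.card_range,
        smul_eq_mul]
      omega
    change wp σ ω (.par downStep) _ N
    refine wp_par hcount fun N1 e2 => ?_
    have hiss : ∀ i x, downStep.Issues ω N (.write 25 i x) [] ↔ ∃ i' < 2 ^ k,
        (i = 2 ^ (k + 1) + 2 * i' ∧
          x = ∑ x ∈ Finset.Ico (2 ^ (J - (k + 1)) * (2 * i' + 1)) (2 ^ J), leaf x) ∨
        (i = 2 ^ (k + 1) + (2 * i' + 1) ∧
          x = ∑ x ∈ Finset.Ico (2 ^ (J - (k + 1)) * (2 * i' + 1 + 1)) (2 ^ J), leaf x) := by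
      intro i x
      simp only [downStep, Par.Issues, Req.write.injEq, eval_read, eval_zero, hs, eval_add,
        eval_mul, eval_two, eval_one, eval_idx_zero, true_and, Nat.reduceEqDiff, false_and,
        or_false]
      refine exists_congr fun i' => and_congr_right fun hi' => ?_
      have hidx : 2 * (2 ^ k + i') = 2 ^ (k + 1) + 2 * i' := by rw [hpow]; ring
      have hJk : 2 ^ (J - k) = 2 ^ (J - (k + 1)) * 2 := by rw [← pow_succ]; congr 1; omega
      have hend : 2 ^ (J - (k + 1)) * (2 * i' + 1 + 1) = 2 ^ (J - k) * (i' + 1) := by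
        rw [hJk]
        ring
      have hend' : 2 ^ (J - k) * (i' + 1) ≤ 2 ^ J := by
        calc 2 ^ (J - k) * (i' + 1) ≤ 2 ^ (J - k) * 2 ^ k := Nat.mul_le_mul_left _ hi'
          _ = 2 ^ J := by rw [← pow_add]; congr 1; omega
      rw [hidx, add_assoc (2 ^ (k + 1)), hl i' hi', hN 24 (by decide) (by decide),
        htree (k + 1) hkJ (2 * i' + 1) (by omega), blockSum, hend, add_comm (∑ _ ∈ _, _),
        Finset.sum_Ico_consecutive]
      · rw [← hend]
        exact Nat.mul_le_mul_left _ (by omega)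
      · exact hend'
    have hn23 : N1 23 0 = 2 ^ (k + 1) := by
      refine Par.written_eq e2 (by decide) ?_ ?_ (by omega)
      · simp [downStep, Par.Issues, hs, hpow, two_mul]
      · intro v hv
        simpa [downStep, Par.Issues, hs, hpow, two_mul] using hv
    have hsum : ∀ y, ∑ x ∈ Finset.Ico y (2 ^ J), leaf x < 2 ^ w := fun y => by
      refine lt_of_le_of_lt (Finset.sum_le_sum_of_subset fun x hx => ?_) hlt
      rw [Finset.mem_Ico] at hx
      exact Finset.mem_range.2 hx.2
    refine ⟨⟨fun b hb hb' => ?_, k + 1, hkJ, hn23, fun i hi => ?_, ?_, ?_⟩, ?_⟩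
    · rw [Par.frame e2 (by simp [downStep, Par.wrt, Par.ctr, Par.res, hb, hb']), hN b hb hb']
    · refine Par.written_eq e2 (by decide) ((hiss _ _).2 ?_) (fun x hx => ?_) (hsum _)
      · rcases Nat.even_or_odd' i with ⟨i', rfl | rfl⟩
        · exact ⟨i', by omega, Or.inl ⟨rfl, rfl⟩⟩
        · exact ⟨i', by omega, Or.inr ⟨rfl, rfl⟩⟩
      · obtain ⟨i', hi', ⟨he', rfl⟩ | ⟨he', rfl⟩⟩ := (hiss _ _).1 hx
        · obtain rfl : i = 2 * i' := by omega
          rfl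
        · obtain rfl : i = 2 * i' + 1 := by omega
          rfl
    · have y1 := Nat.mul_le_mul_right (2 + 2 * 2 ^ k) hsize
      simp only [Expr.size, size_zero]
      omega
    · simp only [Expr.size, size_zero]
      omega
    · rw [hn23, hs]
      omega
  · rintro N W D ⟨hN, k, hk, hs, hl, hW, hD⟩ he
    have hkJ : k = J := by
      by_contra hc
      have : 2 ^ k < 2 ^ J := Nat.pow_lt_pow_right (by norm_num) (by omega)
      simp [hs, hN 22 (by decide) (by decide), hM, this] at he
    subst hkJ
    refine ⟨fun i hi => ?_, hN, ?_, ?_⟩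
    · rw [hl i hi, Nat.sub_self, pow_zero, one_mul]
    · simp only [Par.size, Par.count, Expr.size, size_zero, size_one]
      omega
    · simp only [Par.size, Expr.size, size_zero, size_one]
      omega
  · refine ⟨f1, 0, Nat.zero_le _, h1, fun i hi => ?_, by omega, by omega⟩
    obtain rfl : i = 0 := by omega
    simp [h2]

end Sweep

/-! ### The loads and the densest remaining graph -/

section Finish

variable {n : ℕ} {G : SimpleGraph (Fin n)} [DecidableRel G.Adj] {st : ℕ → ℕ} {tg : ℕ → Fin n}
  {w : ℕ} {σ : Scheduler} {ω : ℕ → Fin (2 ^ w)} {M0 M M' : Mem} {ℓ : Fin n → ℕ}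
  {S : Finset (Fin n)} {P : List (Fin n)} {N B : ℕ}

/-- The degree of a vertex at the moment when it is peeled. -/
def laterDeg (G : SimpleGraph (Fin n)) [DecidableRel G.Adj] (P : List (Fin n)) (v : Fin n) : ℕ :=
  degIn G (rest P (P.idxOf v)) v

/-- The degree, at the moment when it is peeled, of the vertex at position `i`. -/
def degAt (G : SimpleGraph (Fin n)) [DecidableRel G.Adj] (P : List (Fin n)) (i : ℕ) : ℕ :=
  ∑ v ∈ Finset.univ.filter (fun v => P.idxOf v = i), laterDeg G P v

theorem Rep.sum_target (h : Rep G st tg) (v : Fin n) (f : Fin n → ℕ) :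
    ∑ j ∈ Finset.range (G.degree v), f (tg (st v + j)) = ∑ u, if G.Adj v u then f u else 0 := by
  rw [← Finset.sum_fiberwise (Finset.range (G.degree v)) (fun j => tg (st v + j))]
  refine Finset.sum_congr rfl fun u _ => ?_
  rw [Finset.sum_congr rfl (g := fun _ => f u) fun j hj => by rw [(Finset.mem_filter.1 hj).2],
    Finset.sum_const, h.card]
  split_ifs <;> simp

theorem Rep.card_later (h : Rep G st tg) (hP : P.Nodup) (hall : ∀ v, v ∈ P) (v : Fin n) :
    (∑ j ∈ Finset.range (G.degree v), if P.idxOf v < P.idxOf (tg (st v + j)) then 1 else 0) =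
      laterDeg G P v := by
  rw [h.sum_target v (fun u => if P.idxOf v < P.idxOf u then 1 else 0), laterDeg,
    degIn_rest hP hall (S := Finset.univ) (fun u _ => Finset.mem_univ u), degIn, Finset.filter_filter,
    Finset.card_filter]
  refine Finset.sum_congr rfl fun u _ => ?_
  split_ifs <;> tauto

theorem laterDeg_le (P : List (Fin n)) (v : Fin n) : laterDeg G P v ≤ G.degree v :=
  degIn_le_degree _ v

theorem sum_degAt (hP : P.Nodup) (hall : ∀ v, v ∈ P) {i : ℕ} (hN : P.length ≤ N) :
    ∑ x ∈ Finset.Ico i N, degAt G P x = (G.edgeFinset ∩ (rest P i).sym2).card := by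
  rw [← sum_degIn_rest hP hall i]
  have hmem : ∀ v ∈ rest P i, P.idxOf v ∈ Finset.Ico i N := fun v hv => by
    rw [mem_rest hP] at hv
    have := List.idxOf_lt_length_of_mem hv.1
    exact Finset.mem_Ico.2 ⟨hv.2, by omega⟩
  rw [← Finset.sum_fiberwise_of_maps_to hmem]
  refine Finset.sum_congr rfl fun x hx => ?_
  rw [degAt]
  refine Finset.sum_congr ?_ fun v _ => rfl
  ext v
  rw [Finset.mem_Ico] at hx
  simp only [Finset.mem_filter, Finset.mem_univ, true_and, mem_rest hP]
  exact ⟨fun h => ⟨⟨hall v, by omega⟩, h⟩, fun h => h.2⟩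

theorem sum_degAt_le (s : Finset ℕ) : ∑ x ∈ s, degAt G P x ≤ ∑ v, (G.degree v + 1) := by
  have h1 : ∑ x ∈ s, degAt G P x =
      ∑ v ∈ Finset.univ.filter (fun v => P.idxOf v ∈ s), laterDeg G P v := by
    rw [← Finset.sum_fiberwise_of_maps_to (g := fun v => P.idxOf v) (t := s)
      fun v hv => (Finset.mem_filter.1 hv).2]
    refine Finset.sum_congr rfl fun x hx => ?_
    rw [degAt, Finset.filter_filter]
    refine Finset.sum_congr ?_ fun v _ => rfl
    ext v
    simp only [Finset.mem_filter, Finset.mem_univ, true_and]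
    exact ⟨fun h => ⟨h ▸ hx, h⟩, fun h => h.2⟩
  rw [h1]
  refine (Finset.sum_le_sum_of_subset (Finset.filter_subset _ _)).trans
    (Finset.sum_le_sum fun v _ => ?_)
  have := laterDeg_le (G := G) P v
  omega

theorem addLoads_total (hM : InMem G st tg M) (hR : Rep G st tg) (hP : P.Nodup)
    (hall : ∀ v, v ∈ P) (hpos : ∀ v : Fin n, M 12 v = P.idxOf v) {f : Req → ℕ}
    (hf : ∀ a i x, f (.write a i x) = 0) : addLoads.total ω M f [] =
      ∑ v, laterDeg G P v *
        (f (.fetchAdd 3 v 1 14 0) + f (.fetchAdd 24 (M 22 0 + P.idxOf v) 1 14 0)) := by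
  rw [addLoads, hM.vertexLoop_total]
  refine Finset.sum_congr rfl fun v _ => ?_
  have hdeg : (degE (.idx 0)).eval ω [(v : ℕ)] M = G.degree v := hM.degE hR rfl
  simp only [Par.total, hdeg, hf, Finset.sum_const_zero, zero_add, add_zero]
  rw [← hR.card_later hP hall, Finset.sum_mul]
  refine Finset.sum_congr rfl fun j hj => ?_
  rw [Finset.mem_range] at hj
  simp only [eval_lt, eval_read, eval_add, eval_idx_one, eval_idx_zero, eval_zero, eval_one,
    hM.start v v.2.le, hM.target v j hj, hpos]
  split_ifs <;> simp_all

theorem addLoads_effect (hM : InMem G st tg M) (hR : Rep G st tg) (hP : P.Nodup)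
    (hall : ∀ v, v ∈ P) (hpos : ∀ v : Fin n, M 12 v = P.idxOf v) (hload : ∀ v : Fin n, M 3 v = ℓ v)
    (hN : M 22 0 = N) (hleaf : ∀ i < N, M 24 (N + i) = 0)
    (hclear : ∀ a, a ∈ [5, 6, 7] → ∀ y, M a y ≠ 0 → ∃ v, ℓ v ≤ y ∧ y ≤ ℓ v + G.degree v)
    (hB : ∀ v, ℓ v + G.degree v < 2 ^ w) (hs : ∑ v, (G.degree v + 1) < 2 ^ w)
    (he : Eff w (addLoads.reqs ω M []) M M') :
    (∀ a, a ∉ [3, 5, 6, 7, 8, 14, 24] → M' a = M a) ∧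
    (∀ v : Fin n, M' 3 v = ℓ v + laterDeg G P v) ∧ (∀ i < N, M' 24 (N + i) = degAt G P i) ∧
    (∀ a, a ∈ [5, 6, 7] → ∀ y, M' a y = 0) ∧ ∀ v : Fin n, M' 8 v = 0 := by
  have hdeg : ∀ v : Fin n, (degE (.idx 0)).eval ω [(v : ℕ)] M = G.degree v := fun v =>
    hM.degE hR rfl
  have t3 : ∀ v : Fin n, addLoads.total ω M (Req.inc 3 v) [] = laterDeg G P v := by
    intro v
    rw [addLoads_total hM hR hP hall hpos fun _ _ _ => rfl]
    simp [Req.inc, Fin.ext_iff.symm]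
  have t24 : ∀ i, addLoads.total ω M (Req.inc 24 (N + i)) [] = degAt G P i := by
    intro i
    rw [addLoads_total hM hR hP hall hpos fun _ _ _ => rfl, degAt, Finset.sum_filter]
    simp [Req.inc, hN]
  have hwr : ∀ a i x, addLoads.Issues ω M (.write a i x) [] ↔ x = 0 ∧
      ∃ v : Fin n, (a = 8 ∧ i = v) ∨ (a ∈ [5, 6, 7] ∧ ℓ v ≤ i ∧ i ≤ ℓ v + G.degree v) := by
    intro a i x
    rw [addLoads, hM.vertexLoop_issues]
    simp only [Par.Issues, eval_add _ (degE _), hdeg, eval_one, eval_zero, eval_idx_zero,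
      Req.write.injEq, eval_add, eval_read, eval_idx_one, hload, reduceCtorEq, or_self, and_false,
      exists_false, or_false]
    constructor
    · rintro ⟨v, ⟨rfl, rfl, rfl⟩ | ⟨j, hj, h⟩⟩
      · exact ⟨rfl, v, Or.inl ⟨rfl, rfl⟩⟩
      · have hx : x = 0 ∧ i = ℓ v + j ∧ a ∈ [5, 6, 7] := by
          rcases h with h | h | h <;> simp [h]
        exact ⟨hx.1, v, Or.inr ⟨hx.2.2, by omega, by omega⟩⟩
    · rintro ⟨rfl, v, ⟨rfl, rfl⟩ | ⟨ha, h1, h2⟩⟩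
      · exact ⟨v, Or.inl ⟨rfl, rfl, rfl⟩⟩
      · refine ⟨v, Or.inr ⟨i - ℓ v, by omega, ?_⟩⟩
        rw [Nat.add_sub_cancel' h1]
        simpa using ha
  refine ⟨fun a ha => Par.frame he ?_, fun v => ?_, fun i hi => ?_, fun a ha y => ?_, fun v => ?_⟩
  · simp only [addLoads, Par.wrt, Par.ctr, Par.res]
    simp at ha ⊢
    omega
  · have h1 := laterDeg_le (G := G) P v
    have h2 := hB v
    rw [Par.counter he (by decide), t3, hload]
    rw [t3, hload]
    omega
  · rw [Par.counter he (by decide), t24, hleaf i hi, zero_add]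
    rw [t24, hleaf i hi, zero_add]
    refine lt_of_le_of_lt ?_ hs
    simpa using sum_degAt_le (G := G) (P := P) {i}
  · rcases Par.written (i := y) he (a := a) (by
      simp only [addLoads, Par.ctr, Par.res]
      simp at ha ⊢
      omega) with ⟨x, hx, he'⟩ | ⟨hx, he'⟩
    · rw [he', ((hwr _ _ _).1 hx).1, Nat.zero_mod]
    · rw [he']
      by_contra hc
      obtain ⟨v, hv⟩ := hclear a ha y hc
      exact hx 0 ((hwr _ _ _).2 ⟨rfl, v, Or.inr ⟨ha, hv⟩⟩)
  · exact Par.written_eq he (by decide) ((hwr _ _ _).2 ⟨rfl, v, Or.inl ⟨rfl, rfl⟩⟩)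
      (fun x hx => ((hwr _ _ _).1 hx).1) (by positivity)

theorem addLoads_count (hM : InMem G st tg M) (hR : Rep G st tg) :
    addLoads.count ω M [] ≤ 1 + 6 * ∑ v, (G.degree v + 1) := by
  rw [addLoads, hM.vertexLoop_count, Finset.mul_sum]
  refine Nat.add_le_add_left (Finset.sum_le_sum fun v _ => ?_) _
  have hdeg : (degE (.idx 0)).eval ω [(v : ℕ)] M = G.degree v := hM.degE hR rfl
  simp only [Par.count, eval_add, hdeg, eval_one, Finset.sum_const, Finset.card_range, smul_eq_mul]
  refine (Nat.add_le_add_left (Nat.add_le_add_left (Nat.add_le_add_left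
    (Finset.sum_le_card_nsmul _ _ 2 fun j _ => ?_) _) _) _).trans ?_
  · split_ifs <;> simp
  · rw [Finset.card_range, smul_eq_mul]
    omega

/-! ### The tournament for the densest graph -/

/-- The better one of two indices, where the graph with index `x` has `E x` edges and `n - x`
vertices. -/
def better (n : ℕ) (E : ℕ → ℕ) (x y : ℕ) : ℕ := if E x * (n - y) < E y * (n - x) then y else x

/-- The winners of the tournament at height `j` of the tree. -/
def winner (n : ℕ) (E : ℕ → ℕ) : ℕ → ℕ → ℕ
  | 0, i => if i < n then i else 0
  | j + 1, i => better n E (winner n E j (2 * i)) (winner n E j (2 * i + 1))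

theorem winner_lt (hn : 0 < n) (E : ℕ → ℕ) (j i : ℕ) : winner n E j i < n := by
  induction j generalizing i with
  | zero =>
    rw [winner]
    split_ifs <;> omega
  | succ j ih =>
    rw [winner, better]
    split_ifs
    exacts [ih _, ih _]

/-- The winner at a node is at least as dense as every remaining graph at a leaf below the node. -/
theorem le_winner (hn : 0 < n) {E : ℕ → ℕ} {ρ : ℕ → ℝ}
    (hρ : ∀ x < n, ∀ y < n, E x * (n - y) < E y * (n - x) ↔ ρ x < ρ y) (j i x : ℕ)
    (h1 : 2 ^ j * i ≤ x) (h2 : x < 2 ^ j * (i + 1)) (hx : x < n) : ρ x ≤ ρ (winner n E j i) := by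
  induction j generalizing i with
  | zero =>
    obtain rfl : x = i := by omega
    rw [winner, if_pos hx]
  | succ j ih =>
    have e1 : 2 ^ (j + 1) * i = 2 ^ j * (2 * i) := by ring
    have e2 : 2 ^ (j + 1) * (i + 1) = 2 ^ j * (2 * i + 1 + 1) := by ring
    have hw := hρ _ (winner_lt hn E j (2 * i)) _ (winner_lt hn E j (2 * i + 1))
    rw [winner, better]
    by_cases hm : x < 2 ^ j * (2 * i + 1)
    · have := ih (2 * i) (by omega) hm
      split_ifs with hc
      · exact this.trans (hw.1 hc).le
      · exact this
    · have := ih (2 * i + 1) (by omega) (by omega)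
      split_ifs with hc
      · exact this
      · rw [hw, not_lt] at hc
        exact this.trans hc

theorem card_rest (hP : P.Nodup) (i : ℕ) : (rest P i).card = P.length - i := by
  rw [rest, List.toFinset_card_of_nodup (hP.sublist (List.drop_sublist _ _)), List.length_drop]

theorem density_lt_iff {S S' : Finset (Fin n)} (hS : S.Nonempty) (hS' : S'.Nonempty) :
    density G S < density G S' ↔ (G.edgeFinset ∩ S.sym2).card * S'.card <
      (G.edgeFinset ∩ S'.sym2).card * S.card := by
  have h1 : (0 : ℝ) < S.card := by exact_mod_cast hS.card_pos
  have h2 : (0 : ℝ) < S'.card := by exact_mod_cast hS'.card_pos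
  rw [density, density, div_lt_div_iff₀ h1 h2]
  exact_mod_cast Iff.rfl

theorem rest_nonempty (hP : P.Nodup) {i : ℕ} (hi : i < P.length) : (rest P i).Nonempty := by
  rw [← Finset.card_pos, card_rest hP]
  omega

theorem storeEdges_effect {J : ℕ} (hN : M 22 0 = 2 ^ J) (h0 : M 0 0 = n) {E : ℕ → ℕ}
    (hw : 2 ^ J < 2 ^ w)
    (hE : ∀ i < 2 ^ J, M 25 (2 ^ J + i) + M 24 (2 ^ J + i) = E i) (hlt : ∀ i < 2 ^ J, E i < 2 ^ w)
    (he : Eff w (storeEdges.reqs ω M []) M M') :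
    (∀ a, a ≠ 26 → a ≠ 27 → M' a = M a) ∧ (∀ i < 2 ^ J, M' 27 i = E i) ∧
      ∀ i < 2 ^ J, M' 26 (2 ^ J + i) = if i < n then i else 0 := by
  refine ⟨fun a h1 h2 => Par.frame he (by simp [storeEdges, Par.wrt, Par.ctr, Par.res, h1, h2]),
    fun i hi => ?_, fun i hi => ?_⟩
  · refine Par.written_eq he (by decide) ?_ ?_ (hlt i hi)
    · simp only [storeEdges, Par.Issues, eval_read, eval_zero, hN]
      exact ⟨i, hi, Or.inl (by simp [hN, hE i hi])⟩
    · intro x hx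
      simp only [storeEdges, Par.Issues, eval_read, eval_zero, hN] at hx
      obtain ⟨i', hi', hx | hx⟩ := hx
      · simp [hN] at hx
        rw [hx.2, hx.1, hE i' hi']
      · simp at hx
  · refine Par.written_eq he (by decide) ?_ ?_ ?_
    · simp only [storeEdges, Par.Issues, eval_read, eval_zero, hN]
      refine ⟨i, hi, Or.inr ?_⟩
      simp [hN, nE, h0]
    · intro x hx
      simp only [storeEdges, Par.Issues, eval_read, eval_zero, hN] at hx
      obtain ⟨i', hi', hx | hx⟩ := hx
      · simp at hx
      · simp [hN, nE, h0] at hx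
        rw [hx.2, hx.1]
    · split_ifs <;> omega

theorem storeEdges_count (hN : M 22 0 = N) : storeEdges.count ω M [] ≤ 1 + 2 * N := by
  simp only [storeEdges, Par.count, eval_read, eval_zero, hN, Finset.sum_const, Finset.card_range,
    smul_eq_mul]
  omega

theorem eval_betterE (h0 : M 0 0 = n) (e : Expr) (env : List ℕ) : (betterE e).eval ω env M =
    better n (M 27) (M 26 (2 * e.eval ω env M)) (M 26 (2 * e.eval ω env M + 1)) := by
  simp only [betterE, denserE, better, nE, eval_add, eval_mul, eval_sub, eval_lt, eval_read,
    eval_one, eval_two, eval_zero, h0]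
  split_ifs <;> simp

end Finish

/-! ### The end of an iteration -/

section Finish

variable {n : ℕ} {G : SimpleGraph (Fin n)} [DecidableRel G.Adj] {st : ℕ → ℕ} {tg : ℕ → Fin n}
  {w : ℕ} {σ : Scheduler} {ω : ℕ → Fin (2 ^ w)} {M0 M M' : Mem} {ℓ : Fin n → ℕ}
  {S : Finset (Fin n)} {P : List (Fin n)} {b c X B : ℕ}

/-- The remaining graph with index `b` replaces the best subgraph if it is denser. A recorded
size `0` of the best subgraph marks the first iteration, where the best subgraph is the graph
itself. -/
theorem wp_best (hn : 2 ≤ n) (h0 : M 0 0 = n) (hP : P.Nodup) (hlen : P.length = n)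
    (hb : b < n) (hbM : M 26 1 = b)
    (hE : ∀ i < n, M 27 i = (G.edgeFinset ∩ (rest P i).sym2).card)
    (hpos : ∀ v : Fin n, M 12 v = P.idxOf v) (hflag : ∀ v : Fin n, M 4 v = 0 ↔ v ∈ S)
    (hbest : (M 29 0 = 0 ∧ S = Finset.univ) ∨
      (M 29 0 = S.card ∧ S.Nonempty ∧ M 28 0 = (G.edgeFinset ∩ S.sym2).card))
    (hw : n < 2 ^ w) (hEw : ∀ i < n, (G.edgeFinset ∩ (rest P i).sym2).card < 2 ^ w) :
    wp σ ω (.seq firstBest updateBest) (fun M' W D => ∃ S', (∀ v : Fin n, M' 4 v = 0 ↔ v ∈ S') ∧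
      (M' 29 0 = S'.card ∧ S'.Nonempty ∧ M' 28 0 = (G.edgeFinset ∩ S'.sym2).card) ∧
      ((S' = S ∧ density G (rest P b) ≤ density G S) ∨
        (S' = rest P b ∧ density G S < density G (rest P b))) ∧
      (∀ a, a ∉ [4, 28, 29] → M' a = M a) ∧ W ≤ 200 * (n + 1) ∧ D ≤ 200) M := by
  have hall : ∀ v, v ∈ P := by
    intro v
    have := (Finset.card_eq_iff_eq_univ P.toFinset).1 (by
      rw [List.toFinset_card_of_nodup hP, hlen, Fintype.card_fin])
    rw [← List.mem_toFinset, this]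
    exact Finset.mem_univ v
  have hrest0 : rest P 0 = Finset.univ := by
    ext v
    simp [rest, hall]
  have huniv : (Finset.univ : Finset (Fin n)).Nonempty := ⟨⟨0, by omega⟩, Finset.mem_univ _⟩
  -- the rest of the computation, once the size of the best subgraph is known
  have hupd : ∀ (W D : ℕ) (N : Mem), (∀ a, a ∉ [4, 28, 29] → N a = M a) → N 4 = M 4 →
      (N 29 0 = S.card ∧ S.Nonempty ∧ N 28 0 = (G.edgeFinset ∩ S.sym2).card) → W ≤ 30 → D ≤ 30 →
      wp σ ω updateBest (fun M' W' D' => ∃ S', (∀ v : Fin n, M' 4 v = 0 ↔ v ∈ S') ∧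
        (M' 29 0 = S'.card ∧ S'.Nonempty ∧ M' 28 0 = (G.edgeFinset ∩ S'.sym2).card) ∧
        ((S' = S ∧ density G (rest P b) ≤ density G S) ∨
          (S' = rest P b ∧ density G S < density G (rest P b))) ∧
        (∀ a, a ∉ [4, 28, 29] → M' a = M a) ∧ W + W' ≤ 200 * (n + 1) ∧ D + D' ≤ 200) N := by
    intro W D N hN h4 hbN hW hD
    have hr := rest_nonempty hP (i := b) (by omega)
    have hcr : (rest P b).card = n - b := by rw [card_rest hP, hlen]
    have h26 : N 26 1 = b := by rw [hN 26 (by decide), hbM]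
    have h27 : N 27 b = (G.edgeFinset ∩ (rest P b).sym2).card := by
      rw [hN 27 (by decide), hE b hb]
    have hnE : ∀ env, nE.eval ω env N = n := fun env => by simp [nE, hN 0 (by decide), h0]
    have htest := density_lt_iff (G := G) hbN.2.1 hr
    have heval : (Expr.op .lt (.read 28 0 * (nE - .read 26 1))
        (.read 27 (.read 26 1) * .read 29 0)).eval ω [] N =
        if density G S < density G (rest P b) then 1 else 0 := by
      simp only [eval_lt, eval_mul, eval_sub, eval_read, eval_zero, eval_one, hnE, h26, h27, hbN.1,
        hbN.2.2]
      rw [← hcr]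
      exact if_congr htest.symm rfl rfl
    refine wp_cond (fun he => ?_) fun he => ?_
    · have hlt : density G S < density G (rest P b) := by
        by_contra hc
        rw [heval, if_neg hc] at he
        exact he rfl
      refine wp_par (N := n + 3) ?_ fun N1 e1 => ?_
      · simp only [Par.count, hnE]
        simp
        omega
      have hf : ∀ v : Fin n, N1 4 v = if P.idxOf v < b then 1 else 0 := by
        intro v
        refine Par.written_eq e1 (by decide) ?_ ?_ ?_
        · simp only [Par.Issues, hnE]
          exact Or.inl ⟨v, v.2, by simp [h26, hN 12 (by decide), hpos]⟩
        · intro x hx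
          simp only [Par.Issues, hnE] at hx
          simp at hx
          rw [hx]
          exact if_congr (by rw [h26, hN 12 (by decide), hpos]) rfl rfl
        · split_ifs <;> omega
      refine ⟨rest P b, fun v => ?_, ⟨?_, hr, ?_⟩, Or.inr ⟨rfl, hlt⟩, fun a ha => ?_, ?_, ?_⟩
      · rw [hf, mem_rest hP]
        have := hall v
        split_ifs with h
        · simp [h]
        · simpa [this] using h
      · rw [hcr]
        refine Par.written_eq e1 (by decide) ?_ ?_ (by omega)
        · simp [Par.Issues, hnE, h26]
        · intro x hx
          simpa [Par.Issues, hnE, h26] using hx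
      · refine Par.written_eq e1 (by decide) ?_ ?_ (hEw b hb)
        · simp [Par.Issues, hnE, h26, h27]
        · intro x hx
          simpa [Par.Issues, hnE, h26, h27] using hx
      · rw [← hN a ha]
        refine Par.frame e1 ?_
        simp only [Par.wrt, Par.ctr, Par.res]
        simp at ha ⊢
        omega
      · simp only [nE, Par.size, Expr.size, size_zero, size_one, size_sub, size_mul]
        omega
      · simp only [nE, Par.size, Expr.size, size_zero, size_one, size_sub, size_mul]
        omega
    · have hle : density G (rest P b) ≤ density G S := by
        by_contra hc
        rw [heval, if_pos (not_le.1 hc)] at he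
        exact absurd he one_ne_zero
      refine wp_par (N := 1) le_rfl fun N1 e1 => ?_
      have hM : N1 = N := funext fun a => Par.frame e1 (by simp [Par.wrt, Par.ctr, Par.res])
      subst hM
      refine ⟨S, fun v => ?_, hbN, Or.inl ⟨rfl, hle⟩, hN, ?_, ?_⟩
      · rw [h4, hflag]
      · simp only [nE, Par.size, Expr.size, size_zero, size_one, size_sub, size_mul]
        omega
      · simp only [nE, Par.size, Expr.size, size_zero, size_one, size_sub, size_mul]
        omega
  refine wp_seq (wp_cond (fun he => ?_) fun he => ?_)
  · have h29 : M 29 0 = 0 := by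
      by_contra hc
      simp [hc] at he
    have hS : S = Finset.univ := by
      rcases hbest with h | h
      · exact h.2
      · rw [h29] at h
        have := h.2.1.card_pos
        omega
    refine wp_par (N := 2) le_rfl fun N1 e1 => ?_
    refine hupd _ _ N1 (fun a ha => ?_) ?_ ⟨?_, ?_, ?_⟩ ?_ ?_
    · refine Par.frame e1 ?_
      simp only [Par.wrt, Par.ctr, Par.res]
      simp at ha ⊢
      omega
    · exact Par.frame e1 (by decide)
    · rw [hS, Finset.card_univ, Fintype.card_fin]
      refine Par.written_eq e1 (by decide) ?_ ?_ hw
      · simp [Par.Issues, nE, h0]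
      · intro x hx
        simpa [Par.Issues, nE, h0] using hx
    · rw [hS]
      exact huniv
    · have hE0 := hE 0 (by omega)
      have hEw0 := hEw 0 (by omega)
      rw [hrest0, ← hS] at hE0 hEw0
      refine Par.written_eq e1 (by decide) ?_ ?_ hEw0
      · simp [Par.Issues, nE, h0, hE0]
      · intro x hx
        simpa [Par.Issues, nE, h0, hE0] using hx
    · decide
    · decide
  · have h29 : M 29 0 ≠ 0 := by
      intro hc
      simp [hc] at he
    refine wp_par (N := 1) le_rfl fun N1 e1 => ?_
    have hM : N1 = M := funext fun a => Par.frame e1 (by simp [Par.wrt, Par.ctr, Par.res])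
    subst hM
    exact hupd _ _ N1 (fun a _ => rfl) rfl (hbest.resolve_left fun h => h29 h.1) (by decide)
      (by decide)

/-- The new loads and the peeling order satisfy the condition that the jumps of the next iteration
need: along the order, the thresholds at which the vertices are peeled are monotone, and each lies
in the interval of its vertex both before and after the iteration. -/
theorem jumpOK_next {o : ℕ → ℕ} (hord : IsPeelingOrder G ℓ P c) (hlen : P.length = n)
    (ho : ∀ i, ∀ h : i < P.length, o i = P[i]) : JumpOK G (fun v => ℓ v + laterDeg G P v) o := by
  obtain ⟨hnd, hall, D, hD, hDv⟩ := hord.thresholds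
  intro y hy i hi
  have hgap := tot_eq_zero.1 hy
  refine ⟨P[i], ho i (by omega), ?_⟩
  -- off the intervals, the thresholds decide on which side of `y` the interval lies
  have hside : ∀ v, ℓ v + laterDeg G P v + G.degree v < y ↔ D v < y := by
    intro v
    have h1 := hDv v
    have h2 := hgap v
    rw [laterDeg] at *
    omega
  simp only [hside]
  have hmono : ∀ i j (hi : i < P.length) (hj : j < P.length), i ≤ j → D P[i] ≤ D P[j] := by
    intro i j hi hj hij
    rcases hij.eq_or_lt with rfl | h
    · exact le_rfl
    · exact List.pairwise_iff_getElem.1 hD i j hi hj h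
  constructor
  · intro h
    by_contra hc
    -- all vertices with threshold below `y` come before position `i`
    have hsub : Finset.univ.filter (fun v => D v < y) ⊆ (P.take i).toFinset := by
      intro v hv
      rw [Finset.mem_filter] at hv
      have hv' := List.idxOf_lt_length_of_mem (hall v)
      rw [List.mem_toFinset, List.mem_take_iff_getElem]
      refine ⟨P.idxOf v, ?_, List.getElem_idxOf hv'⟩
      by_contra hlt
      have := hmono i (P.idxOf v) (by omega) hv' (by omega)
      rw [List.getElem_idxOf hv'] at this
      have := hv.2
      omega
    have h1 := (Finset.card_le_card hsub).trans (List.toFinset_card_le _)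
    rw [List.length_take] at h1
    omega
  · intro h
    have hsub : (P.take (i + 1)).toFinset ⊆ Finset.univ.filter (fun v => D v < y) := by
      intro v hv
      rw [List.mem_toFinset, List.mem_take_iff_getElem] at hv
      obtain ⟨j, hj, rfl⟩ := hv
      rw [Finset.mem_filter]
      have := hmono j i (by omega) (by omega) (by omega)
      exact ⟨Finset.mem_univ _, by omega⟩
    have h1 := Finset.card_le_card hsub
    rw [List.toFinset_card_of_nodup (hnd.sublist (List.take_sublist _ _)), List.length_take] at h1
    omega

/-- The part of the program after the peeling. -/
def finish : Cmd :=
  .seq findPow (.seq (.par clearLeaves) (.seq (.par addLoads) (.seq (upSweep 24 sumE)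
    (.seq downSweep (.seq (.par storeEdges) (.seq (upSweep 26 betterE)
    (.seq firstBest updateBest)))))))

theorem clearLeaves_effect {J : ℕ} (hM : M 23 0 = 2 ^ J) (hw : 2 ^ J < 2 ^ w)
    (he : Eff w (clearLeaves.reqs ω M []) M M') :
    (∀ a, a ≠ 22 → a ≠ 24 → M' a = M a) ∧ M' 22 0 = 2 ^ J ∧ ∀ i < 2 ^ J, M' 24 (2 ^ J + i) = 0 := by
  refine ⟨fun a h1 h2 => Par.frame he (by simp [clearLeaves, Par.wrt, Par.ctr, Par.res, h1, h2]),
    ?_, fun i hi => ?_⟩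
  · refine Par.written_eq he (by decide) ?_ ?_ hw
    · simp [clearLeaves, Par.Issues, hM]
    · intro x hx
      simpa [clearLeaves, Par.Issues, hM] using hx
  · refine Par.written_eq he (by decide) ?_ ?_ (by positivity)
    · simp only [clearLeaves, Par.Issues, eval_read, eval_zero, hM]
      exact Or.inr ⟨i, hi, by simp [hM]⟩
    · intro x hx
      simp [clearLeaves, Par.Issues] at hx
      tauto

/-- After the peeling, sums over the binary tree give the numbers of edges of all remaining graphs,
and a tournament finds the densest one, all in logarithmic depth. -/
theorem wp_finish (hn : 2 ≤ n) (hM0 : IterInv G st tg ℓ S M0) (hR : Rep G st tg)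
    (hI : PeelInv G st tg ℓ M0 P P.length X M) (hlen : P.length = n)
    (hord : IsPeelingOrder G ℓ P c) (hB : ∀ v, ℓ v + G.degree v < 2 ^ w)
    (hs : ∑ v, (G.degree v + 1) < 2 ^ w) (hw : 4 * n < 2 ^ w) :
    wp σ ω finish (fun M' W D => ∃ S', Iteration G ℓ S (fun v => ℓ v + laterDeg G P v) S' c ∧
      IterInv G st tg (fun v => ℓ v + laterDeg G P v) S' M' ∧
      W ≤ 20000 * ∑ v, (G.degree v + 1) ∧ ∃ J, 2 ^ J < 2 * n ∧ D ≤ 2000 * (J + 1)) M := by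
  obtain ⟨hnd, hall, _⟩ := hord.thresholds
  have hnS : n ≤ ∑ v, (G.degree v + 1) := by
    have : ∑ _v : Fin n, 1 ≤ ∑ v, (G.degree v + 1) := Finset.sum_le_sum fun v _ => by omega
    simpa using this
  have hpos : ∀ v : Fin n, M 12 v = P.idxOf v := by
    intro v
    have hv := List.idxOf_lt_length_of_mem (hall v)
    have := hI.pos _ hv
    rwa [List.getElem_idxOf hv] at this
  refine wp_seq (wp_mono (wp_findPow hI.static.inMem.size (by omega) (by omega))
    fun M1 W1 D1 h => ?_)
  obtain ⟨J, h23, hnJ, hJn, f1, hW1, hD1⟩ := h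
  have hJw : 2 ^ J < 2 ^ w := by omega
  have hJJ : J < 2 ^ J := Nat.lt_two_pow_self
  have hcl : clearLeaves.count ω M1 [] ≤ 2 + 2 ^ J := by
    simp only [clearLeaves, Par.count, eval_read, eval_zero, h23, Finset.sum_const,
      Finset.card_range, smul_eq_mul]
    omega
  refine wp_seq (wp_par hcl fun M2 e2 => ?_)
  obtain ⟨f2, h22, hz⟩ := clearLeaves_effect h23 hJw e2
  have I2 : InMem G st tg M2 := hI.static.inMem.congr
    (by rw [f2 0 (by decide) (by decide), f1 0 (by decide)])
    (by rw [f2 1 (by decide) (by decide), f1 1 (by decide)])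
    (by rw [f2 2 (by decide) (by decide), f1 2 (by decide)])
  refine wp_seq (wp_par (addLoads_count I2 hR) fun M3 e3 => ?_)
  have hp2 : ∀ v : Fin n, M2 12 v = P.idxOf v := by
    rw [f2 12 (by decide) (by decide), f1 12 (by decide)]
    exact hpos
  have hl2 : ∀ v : Fin n, M2 3 v = ℓ v := by
    rw [f2 3 (by decide) (by decide), f1 3 (by decide)]
    exact hI.static.load
  have hclear : ∀ a, a ∈ [5, 6, 7] → ∀ y, M2 a y ≠ 0 →
      ∃ v, ℓ v ≤ y ∧ y ≤ ℓ v + G.degree v := by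
    intro a ha y hy
    rw [f2 a (by rintro rfl; simp at ha) (by rintro rfl; simp at ha),
      f1 a (by rintro rfl; simp at ha)] at hy
    simp only [List.mem_cons, List.not_mem_nil, or_false] at ha
    rcases ha with rfl | rfl | rfl
    · rw [hI.static.count, tot, Finset.card_ne_zero] at hy
      obtain ⟨v, hv⟩ := hy
      exact ⟨v, (Finset.mem_filter.1 hv).2⟩
    · rw [hI.ins, Finset.card_ne_zero] at hy
      obtain ⟨v, hv⟩ := hy
      have hv := (Finset.mem_filter.1 hv).2
      exact ⟨v, (le_key _ v).trans hv.1, hv.2⟩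
    · rw [hI.del, Finset.card_ne_zero] at hy
      obtain ⟨v, hv⟩ := hy
      have hv := (Finset.mem_filter.1 hv).2
      exact ⟨v, (le_key _ v).trans hv.1.le, hv.2⟩
  obtain ⟨f3, l3, t3, z3, d3⟩ := addLoads_effect I2 hR hnd hall hp2 hl2 h22 hz hclear hB hs e3
  refine wp_seq (wp_mono (wp_upSweep (Z := 40) (lvl := blockSum (degAt G P)) (g := (· + ·))
    (by decide) (fun M' _ e env => by simp [sumE]) (by rw [f3 22 (by decide), h22]) hJw (by decide)
    (fun i hi => by rw [t3 i hi, blockSum_zero]) blockSum_succ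
    (fun j i => (sum_degAt_le _).trans_lt hs)) fun M4 W4 D4 h => ?_)
  obtain ⟨t4, f4, hW4, hD4⟩ := h
  have h22' : M4 22 0 = 2 ^ J := by rw [f4 22 (by decide) (by decide), f3 22 (by decide), h22]
  refine wp_seq (wp_mono (wp_downSweep h22' hJw t4 ((sum_degAt_le _).trans_lt hs))
    fun M5 W5 D5 h => ?_)
  obtain ⟨t5, f5, hW5, hD5⟩ := h
  have h22'' : M5 22 0 = 2 ^ J := by rw [f5 22 (by decide) (by decide), h22']
  have frame5 : ∀ a ∈ [0, 1, 2, 4, 12, 13, 28, 29], M5 a = M a := by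
    intro a ha
    have hne : a ∉ [3, 5, 6, 7, 8, 14, 22, 23, 24, 25] := by
      revert a
      decide
    simp only [List.mem_cons, List.not_mem_nil, or_false, not_or] at hne
    obtain ⟨g3, g5, g6, g7, g8, g14, g22, g23, g24, g25⟩ := hne
    rw [f5 a g23 g25, f4 a g24 g23, f3 a (by simp; omega), f2 a g22 g24, f1 a g23]
  have n5 : M5 0 0 = n := by rw [frame5 0 (by decide), hI.static.inMem.size]
  have hEsum : ∀ i < 2 ^ J, M5 25 (2 ^ J + i) + M5 24 (2 ^ J + i) =
      (G.edgeFinset ∩ (rest P i).sym2).card := by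
    intro i hi
    rw [t5 i hi, f5 24 (by decide) (by decide), t4 J le_rfl i hi, Nat.sub_self, blockSum_zero,
      ← sum_degAt hnd hall (hlen.trans_le hnJ), Finset.sum_eq_sum_Ico_succ_bot hi, add_comm]
  have hEw : ∀ i < 2 ^ J, (G.edgeFinset ∩ (rest P i).sym2).card < 2 ^ w := by
    intro i _
    rw [← sum_degAt hnd hall (hlen.trans_le hnJ)]
    exact (sum_degAt_le _).trans_lt hs
  refine wp_seq (wp_par (storeEdges_count h22'') fun M6 e6 => ?_)
  obtain ⟨f6, t6, l6⟩ := storeEdges_effect h22'' n5 hJw hEsum hEw e6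
  have h22''' : M6 22 0 = 2 ^ J := by rw [f6 22 (by decide) (by decide), h22'']
  refine wp_seq (wp_mono (wp_upSweep (Z := 200) (lvl := winner n (M6 27)) (g := better n (M6 27))
    (by decide) (fun M' hM' e env => by
      rw [eval_betterE (by rw [hM' 0 (by decide) (by decide), f6 0 (by decide) (by decide), n5]),
        hM' 27 (by decide) (by decide)]) h22''' hJw (by decide)
    (fun i hi => by rw [l6 i hi]; rfl) (fun j i => rfl)
    (fun j i => (winner_lt (by omega) _ j i).trans (by omega))) fun M7 W7 D7 h => ?_)
  obtain ⟨t7, f7, hW7, hD7⟩ := h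
  set b := winner n (M6 27) J 0 with hb
  have hbn : b < n := winner_lt (by omega) _ _ _
  have frame7 : ∀ a ∈ [0, 1, 2, 4, 12, 13, 28, 29], M7 a = M a := by
    intro a ha
    have hne : a ∉ [23, 26, 27] := by
      revert a
      decide
    simp only [List.mem_cons, List.not_mem_nil, or_false, not_or] at hne
    rw [f7 a hne.2.1 hne.1, f6 a hne.2.1 hne.2.2, frame5 a ha]
  have keep7 : ∀ a ∈ [4, 28, 29], M7 a = M0 a := by
    intro a ha
    rw [frame7 a (by revert a; decide), hI.keep a ha]
  have t7' : M7 26 1 = b := t7 0 (Nat.zero_le _) 0 (by norm_num)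
  refine wp_mono (wp_best (S := S) hn (by rw [frame7 0 (by decide), hI.static.inMem.size]) hnd hlen
    hbn t7' (fun i hi => ?_) ?_ ?_ ?_ (by omega) (fun i hi => hEw i (by omega)))
    fun M8 W8 D8 h => ?_
  · rw [f7 27 (by decide) (by decide), t6 i (by omega)]
  · rw [frame7 12 (by decide)]
    exact hpos
  · rw [keep7 4 (by decide)]
    exact hM0.flag
  · rw [keep7 29 (by decide), keep7 28 (by decide)]
    exact hM0.best
  obtain ⟨S', hflag, hbest, hS', f8, hW8, hD8⟩ := h
  have hdom : ∀ i < n, density G (rest P i) ≤ density G (rest P b) := by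
    intro i hi
    refine le_winner (ρ := fun i => density G (rest P i)) (by omega) ?_ J 0 i (by omega)
      (by omega) hi
    intro x hx y hy
    rw [density_lt_iff (rest_nonempty hnd (by omega)) (rest_nonempty hnd (by omega)), card_rest hnd,
      card_rest hnd, hlen, t6 x (by omega), t6 y (by omega)]
  have frame8 : ∀ a ∈ [0, 1, 2, 12, 13], M8 a = M a := by
    intro a ha
    have h1 : a ∉ [4, 28, 29] := by
      revert a
      decide
    rw [f8 a h1, frame7 a (by revert a; decide)]
  have keep8 : ∀ a ∈ [3, 5, 6, 7, 8], M8 a = M3 a := by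
    intro a ha
    have hne : a ∉ [4, 28, 29, 23, 24, 25, 26, 27] := by
      revert a
      decide
    simp only [List.mem_cons, List.not_mem_nil, or_false, not_or] at hne
    obtain ⟨g1, g2, g3, g4, g5, g6, g7, g8⟩ := hne
    rw [f8 a (by simp; omega), f7 a g7 g4, f6 a g7 g8, f5 a g4 g6, f4 a g5 g4]
  refine ⟨S', ⟨P, hord, fun v => rfl, ?_⟩, ⟨?_, ?_, hflag, ?_, ?_, ?_, ?_, ?_, Or.inr hbest⟩, ?_, J,
    hJn, ?_⟩
  · rcases hS' with ⟨rfl, hle⟩ | ⟨rfl, hlt⟩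
    · exact Or.inl ⟨rfl, fun i hi => (hdom i (by omega)).trans hle⟩
    · exact Or.inr ⟨b, by omega, rfl, hlt, fun i hi => hdom i (by omega)⟩
  · exact hI.static.inMem.congr (frame8 0 (by decide)) (frame8 1 (by decide)) (frame8 2 (by decide))
  · rw [keep8 3 (by decide)]
    exact l3
  · rw [keep8 5 (by decide)]
    exact z3 5 (by decide)
  · rw [keep8 6 (by decide)]
    exact z3 6 (by decide)
  · rw [keep8 7 (by decide)]
    exact z3 7 (by decide)
  · rw [keep8 8 (by decide)]
    exact d3
  · rw [frame8 13 (by decide)]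
    exact jumpOK_next hord hlen hI.batch.ord
  · have y1 : clearLeaves.size ≤ 30 := by decide
    have y2 : addLoads.size ≤ 200 := by decide
    have y3 : storeEdges.size ≤ 50 := by decide
    have y4 := Nat.mul_le_mul_right (2 + 2 ^ J) y1
    have y5 := Nat.mul_le_mul_right (1 + 6 * ∑ v, (G.degree v + 1)) y2
    have y6 := Nat.mul_le_mul_right (1 + 2 * 2 ^ J) y3
    omega
  · have y1 : clearLeaves.size ≤ 30 := by decide
    have y2 : addLoads.size ≤ 200 := by decide
    have y3 : storeEdges.size ≤ 50 := by decide
    omega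

end Finish

/-! ### One iteration -/

section Iterate

variable {n : ℕ} {G : SimpleGraph (Fin n)} [DecidableRel G.Adj] {st : ℕ → ℕ} {tg : ℕ → Fin n}
  {w : ℕ} {σ : Scheduler} {ω : ℕ → Fin (2 ^ w)} {M : Mem} {ℓ : Fin n → ℕ}
  {S : Finset (Fin n)} {B : ℕ}

/-- One execution of the program performs an iteration of ParallelGreedy++ within the stated costs.
-/
theorem wp_program (hn : 2 ≤ n) (hM : IterInv G st tg ℓ S M) (hR : Rep G st tg)
    (hB : ∀ v, ℓ v + G.degree v < B) (hw : 4 * (B + 1) < 2 ^ w)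
    (hs : ∑ v, (G.degree v + 1) < 2 ^ w) (hnw : 4 * n < 2 ^ w) :
    wp σ ω program (fun M' W D => ∃ ℓ' S' c, Iteration G ℓ S ℓ' S' c ∧
      (∀ v, ℓ' v ≤ ℓ v + G.degree v) ∧ IterInv G st tg ℓ' S' M' ∧
      W ≤ 300000 * ∑ v, (G.degree v + 1) ∧ 1 ≤ c ∧ ∃ J, 2 ^ J < 2 * n ∧
      D ≤ 40000 * c * (Nat.log 2 (2 * (∑ v, (G.degree v + 1)) + 1) + 1) + 4000 * (J + 1)) M := by
  have hnS : n ≤ ∑ v, (G.degree v + 1) := by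
    have : ∑ _v : Fin n, 1 ≤ ∑ v, (G.degree v + 1) := Finset.sum_le_sum fun v _ => by omega
    simpa using this
  refine wp_init hM hR (by omega) fun M1 W1 D1 hI hW1 hD1 => ?_
  refine wp_seq (wp_mono (wp_peelLoop hI hR hM.jump hB hw (by omega)) fun M2 W2 D2 h => ?_)
  obtain ⟨P, X, c, hI2, hlen, hord, hW2, hD2⟩ := h
  refine wp_mono (wp_finish hn hM hR hI2 hlen hord (fun v => (hB v).trans (by omega)) hs hnw)
    fun M3 W3 D3 h => ?_
  obtain ⟨S', hit, hM3, hW3, J, hJ, hD3⟩ := h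
  refine ⟨_, S', c, hit, fun v => Nat.add_le_add_left (laterDeg_le P v) _, hM3, by omega, ?_, J, hJ,
    by omega⟩
  obtain ⟨Ls, _, _, hfl, hlc⟩ := hord
  rw [Nat.one_le_iff_ne_zero, ← hlc]
  intro h0
  rw [List.length_eq_zero_iff] at h0
  subst h0
  subst hfl
  simp at hlen
  omega

end Iterate

/-! ### The initial memory -/

section Input

variable {n : ℕ} {G : SimpleGraph (Fin n)} [DecidableRel G.Adj] {adj : Fin n → List (Fin n)}

theorem IsAdjacency.length_eq (h : IsAdjacency G adj) (v : Fin n) :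
    (adj v).length = G.degree v := by
  rw [← List.toFinset_card_of_nodup (h v).1, ← G.card_neighborFinset_eq_degree]
  congr 1
  ext u
  rw [List.mem_toFinset, (h v).2, G.mem_neighborFinset]

theorem flatten_ofFn_eq (adj : Fin n → List (Fin n)) (v : Fin n) : (List.ofFn adj).flatten =
    ((List.ofFn adj).take v).flatten ++ (adj v ++ ((List.ofFn adj).drop (v + 1)).flatten) := by
  conv_lhs => rw [← List.take_append_drop v (List.ofFn adj)]
  rw [List.flatten_append, List.drop_eq_getElem_cons (by simp), List.flatten_cons,
    List.getElem_ofFn]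

theorem getElem?_flatten_ofFn (adj : Fin n → List (Fin n)) (v : Fin n) {j : ℕ}
    (hj : j < (adj v).length) :
    (List.ofFn adj).flatten[((List.ofFn adj).take v).flatten.length + j]? = some (adj v)[j] := by
  rw [flatten_ofFn_eq adj v, List.getElem?_append_right (Nat.le_add_right _ _),
    Nat.add_sub_cancel_left, List.getElem?_append_left hj, List.getElem?_eq_getElem hj]

theorem IsAdjacency.exists_rep (h : IsAdjacency G adj) (hn : 0 < n) :
    ∃ st tg, Rep G st tg ∧ InMem G st tg (inputMem adj) := by
  have htg : ∀ (v : Fin n) (j : ℕ) (hj : j < (adj v).length), (List.ofFn adj).flatten.getD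
      (((List.ofFn adj).take v).flatten.length + j) ⟨0, hn⟩ = (adj v)[j] := by
    intro v j hj
    rw [List.getD_eq_getElem?_getD, getElem?_flatten_ofFn adj v hj, Option.getD_some]
  refine ⟨fun i => ((List.ofFn adj).take i).flatten.length,
    fun e => (List.ofFn adj).flatten.getD e ⟨0, hn⟩, ⟨fun v => ?_, fun v u => ?_⟩,
    ⟨by simp [inputMem], fun v hv => by simp [inputMem, hv], fun v j hj => ?_⟩⟩
  · rw [List.take_succ_eq_append_getElem (by simp), List.flatten_append, List.length_append,
      List.getElem_ofFn, ← h.length_eq]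
    simp
  · rw [Finset.card_filter, ← h.length_eq]
    rw [sum_list (h v).1 (f := fun x => if x = u then 1 else 0) fun i hi => by rw [htg v i hi],
      Finset.sum_ite_eq']
    simp [(h v).2]
  · rw [← h.length_eq] at hj
    simp only [inputMem]
    rw [htg v j hj, List.getD_eq_getElem?_getD, List.getElem?_map, getElem?_flatten_ofFn adj v hj]
    rfl

theorem iterInv_inputMem {st : ℕ → ℕ} {tg : ℕ → Fin n} (hn : 0 < n)
    (h : InMem G st tg (inputMem adj)) :
    IterInv G st tg (fun _ => 0) Finset.univ (inputMem adj) where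
  inMem := h
  load _ := rfl
  flag v := by simp [inputMem]
  count _ := rfl
  ins _ := rfl
  del _ := rfl
  dec _ := rfl
  jump y hy i hi := by
    have hlt := tot_eq_zero.1 hy
    have hcard : (Finset.univ.filter (fun v => 0 + G.degree v < y)).card = n := by
      rw [Finset.filter_true_of_mem fun v _ => hlt v (Nat.zero_le y), Finset.card_univ,
        Fintype.card_fin]
    refine ⟨⟨0, hn⟩, rfl, ?_⟩
    rw [hcard]
    exact iff_of_true hi (hlt _ (Nat.zero_le y))
  best := Or.inl ⟨rfl, rfl⟩

end Input

/-! ### The costs in terms of the size of the graph -/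

section Costs

variable {n : ℕ} {G : SimpleGraph (Fin n)} [DecidableRel G.Adj]

theorem sum_degree_add_one : ∑ v, (G.degree v + 1) = n + 2 * G.edgeFinset.card := by
  rw [Finset.sum_add_distrib, G.sum_degrees_eq_twice_card_edges]
  simp
  omega

theorem natLog_le_log {x k : ℕ} (hn : 2 ≤ n) (hx : x ≤ n ^ k) :
    (Nat.log 2 x : ℝ) ≤ k * (1.5 * Real.log n) := by
  have h2 := Real.log_two_gt_d9
  have hl : Real.log 2 ≤ Real.log n := Real.log_le_log (by norm_num) (by exact_mod_cast hn)
  have hle : (2 : ℝ) ^ Nat.log 2 (n ^ k) ≤ (n : ℝ) ^ k := by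
    exact_mod_cast Nat.pow_log_le_self 2 (by positivity)
  have h := Real.log_le_log (by positivity) hle
  rw [Real.log_pow, Real.log_pow] at h
  have hm : (Nat.log 2 x : ℝ) ≤ Nat.log 2 (n ^ k) := by
    exact_mod_cast Nat.log_mono_right hx
  have h0 : (0 : ℝ) ≤ Nat.log 2 (n ^ k) := Nat.cast_nonneg _
  nlinarith

/-- Both logarithms in the depth of an iteration are `O(log n)`, since the degrees sum up to less
than `n ^ 2`. -/
theorem depth_le_log {c J D : ℕ} (hn : 2 ≤ n) (hc : 1 ≤ c) (hJ : 2 ^ J < 2 * n)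
    (hD : D ≤ 40000 * c * (Nat.log 2 (2 * (∑ v, (G.degree v + 1)) + 1) + 1) + 4000 * (J + 1)) :
    (D : ℝ) ≤ 400000 * (c * Real.log n) := by
  have h2 := Real.log_two_gt_d9
  have hl : Real.log 2 ≤ Real.log n := Real.log_le_log (by norm_num) (by exact_mod_cast hn)
  have hs : ∑ v, (G.degree v + 1) ≤ n * n := by
    refine (Finset.sum_le_card_nsmul _ _ n fun v _ => degree_lt v).trans_eq ?_
    simp
  have h1 := natLog_le_log (x := 2 * (∑ v, (G.degree v + 1)) + 1) (k := 4) hn (by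
    have hq : 4 ≤ n * n := Nat.mul_le_mul hn hn
    have h4 : n ^ 4 = n * n * (n * n) := by ring
    nlinarith)
  have h3 := natLog_le_log (x := 2 ^ J) (k := 2) hn (by nlinarith)
  rw [Nat.log_pow (by norm_num)] at h3
  have hc' : (1 : ℝ) ≤ c := by exact_mod_cast hc
  have hD' : (D : ℝ) ≤ 40000 * c * (Nat.log 2 (2 * (∑ v, (G.degree v + 1)) + 1) + 1) +
      4000 * (J + 1) := by
    exact_mod_cast hD
  set L : ℝ := (Nat.log 2 (2 * (∑ v, (G.degree v + 1)) + 1) : ℝ)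
  set x := Real.log n
  push_cast at h1 h3
  have e1 : (c : ℝ) * (L + 1) ≤ c * (8 * x) := mul_le_mul_of_nonneg_left (by linarith) (by linarith)
  have e2 : x ≤ c * x := le_mul_of_one_le_left (by linarith) hc'
  nlinarith

end Costs

/-! ### Runs -/

/-- Dependent choice along the iterations. -/
theorem exists_chain {α : Type*} {I : ℕ → α → Prop} {R : ℕ → α → α → Prop} {x : α} (h0 : I 0 x)
    (h : ∀ t x, I t x → ∃ y, I (t + 1) y ∧ R t x y) :
    ∃ f : ℕ → α, f 0 = x ∧ ∀ t, I t (f t) ∧ R t (f t) (f (t + 1)) := by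
  choose g hg using h
  let F : (t : ℕ) → {y // I t y} := fun t =>
    Nat.rec ⟨x, h0⟩ (fun t y => ⟨g t y.1 y.2, (hg t y.1 y.2).1⟩) t
  exact ⟨fun t => (F t).1, rfl, fun t => ⟨(F t).2, (hg t (F t).1 (F t).2).2⟩⟩

section Run

variable {n : ℕ} {G : SimpleGraph (Fin n)} [DecidableRel G.Adj] {adj : Fin n → List (Fin n)}
  {T w : ℕ}

/-- The words are long enough for the iterations: no number stored in memory is cut. -/
theorem word_bounds (hn : 2 ≤ n) (h : (n + G.edgeFinset.card + T) ^ 6 ≤ 2 ^ w) :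
    4 * (T * n + 1) < 2 ^ w ∧ ∑ v, (G.degree v + 1) < 2 ^ w ∧ 4 * n < 2 ^ w := by
  rw [sum_degree_add_one]
  set m := G.edgeFinset.card
  obtain ⟨z, hz⟩ : ∃ z, z = n + m + T := ⟨_, rfl⟩
  rw [← hz] at h
  have hz2 : 2 ≤ z := by omega
  have h1 : T * n ≤ z * z := Nat.mul_le_mul (by omega) (by omega)
  have h4 : 4 ≤ z ^ 2 := by nlinarith
  have h16 : 16 ≤ z ^ 4 := by nlinarith [Nat.pow_le_pow_left hz2 4]
  have h6 : z ^ 6 = z ^ 4 * (z * z) := by ring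
  have h7 : 16 * (z * z) ≤ z ^ 6 := by
    rw [h6]
    exact Nat.mul_le_mul_right _ h16
  have h8 : 2 * z ≤ z * z := Nat.mul_le_mul_right _ hz2
  refine ⟨?_, ?_, ?_⟩ <;> omega

/-- For given random words, the program performs a run of ParallelGreedy++. -/
theorem exists_run (hn : 2 ≤ n) (hadj : IsAdjacency G adj)
    (hw : (n + G.edgeFinset.card + T) ^ 6 ≤ 2 ^ w) (σ : Scheduler) (ω : ℕ → Fin (2 ^ w)) :
    ∃ (s : ℕ → State) (ℓ : ℕ → Fin n → ℕ) (S : ℕ → Finset (Fin n)) (c : ℕ → ℕ),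
      s 0 = ⟨inputMem adj, 0, 0⟩ ∧ IsRun G T ℓ S c ∧
      (∀ t < T, Exec σ ω program (s t) (s (t + 1))) ∧
      (∀ t ≤ T, Holds (s t).mem (ℓ t) (S t)) ∧
      (∀ t < T, (s (t + 1)).work - (s t).work ≤ 600000 * (n + G.edgeFinset.card)) ∧
      (∀ t < T, (((s (t + 1)).depth - (s t).depth : ℕ) : ℝ) ≤
        400000 * ((c t : ℝ) * Real.log n)) := by
  obtain ⟨st, tg, hR, hM⟩ := hadj.exists_rep (by omega)
  obtain ⟨hw1, hw2, hw3⟩ := word_bounds hn hw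
  obtain ⟨f, hf0, hf⟩ := exists_chain (α := State × (Fin n → ℕ) × Finset (Fin n) × ℕ)
    (I := fun t x => t ≤ T → IterInv G st tg x.2.1 x.2.2.1 x.1.mem ∧ ∀ v, x.2.1 v ≤ t * n)
    (R := fun t x y => t < T → Exec σ ω program x.1 y.1 ∧
      Iteration G x.2.1 x.2.2.1 y.2.1 y.2.2.1 y.2.2.2 ∧
      y.1.work - x.1.work ≤ 600000 * (n + G.edgeFinset.card) ∧
      ((y.1.depth - x.1.depth : ℕ) : ℝ) ≤ 400000 * ((y.2.2.2 : ℝ) * Real.log n))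
    (x := (⟨inputMem adj, 0, 0⟩, fun _ => 0, Finset.univ, 0))
    (fun _ => ⟨iterInv_inputMem (by omega) hM, fun v => Nat.zero_le _⟩) (by
      intro t x hx
      by_cases ht : t < T
      · obtain ⟨hI, hl⟩ := hx ht.le
        have hB : ∀ v, x.2.1 v + G.degree v < T * n := by
          intro v
          have h1 := hl v
          have h2 := degree_lt (G := G) v
          have h3 : (t + 1) * n ≤ T * n := Nat.mul_le_mul_right _ ht
          rw [add_mul, one_mul] at h3
          omega
        obtain ⟨s', W, D, hex, ⟨ℓ', S', c, hit, hl', hI', hW, hc, J, hJ, hD⟩, hsW, hsD⟩ :=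
          wp_program (σ := σ) (ω := ω) hn hI hR hB hw1 hw2 hw3 x.1 rfl
        refine ⟨(s', ℓ', S', c), fun _ => ⟨hI', fun v => ?_⟩, fun _ => ⟨hex, hit, ?_, ?_⟩⟩
        · have h1 := hl v
          have h2 := degree_lt (G := G) v
          have h3 := hl' v
          have h4 : (t + 1) * n = t * n + n := by ring
          change ℓ' v ≤ (t + 1) * n
          omega
        · rw [sum_degree_add_one] at hW
          change s'.work - x.1.work ≤ _
          omega
        · exact depth_le_log (G := G) hn hc hJ (le_trans (by
            change s'.depth - x.1.depth ≤ D
            omega) hD)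
      · exact ⟨x, fun h => absurd h (by omega), fun h => absurd h ht⟩)
  refine ⟨fun t => (f t).1, fun t => (f t).2.1, fun t => (f t).2.2.1, fun t => (f (t + 1)).2.2.2,
    by simp only [hf0], ⟨by simp only [hf0], by simp only [hf0], fun t ht => ((hf t).2 ht).2.1⟩,
    fun t ht => ((hf t).2 ht).1, fun t ht v => ?_, fun t ht => ((hf t).2 ht).2.2.1,
    fun t ht => ((hf t).2 ht).2.2.2⟩
  have := ((hf t).1 ht).1
  exact ⟨this.load v, this.flag v⟩

instance (w : ℕ) : IsProbabilityMeasure (coins w) := by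
  unfold coins
  infer_instance

end Run

end ParGreedy

theorem mainTheorem2 :
    -- the approximation guarantee
    (∃ C : ℝ, 0 < C ∧
      ∀ (n : ℕ) (G : SimpleGraph (Fin n)) [DecidableRel G.Adj] (ε : ℝ) (T : ℕ)
        (ℓ : ℕ → Fin n → ℕ) (S : ℕ → Finset (Fin n)) (c : ℕ → ℕ),
        0 < ε → ε < 1 →
        C * ((G.maxDegree : ℝ) * Real.log n / (ParGreedy.maxDensity G * ε ^ 2)) ≤ (T : ℝ) →
        ParGreedy.IsRun G T ℓ S c →
        ParGreedy.maxDensity G ≤ (1 + ε) * ParGreedy.density G (S T)) ∧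
    -- an implementation of the loop body, with its work and depth
    (∃ (prog : ParGreedy.Cmd) (K : ℕ) (C : ℝ) (D : ℝ → ℝ),
      ∀ (n : ℕ) (G : SimpleGraph (Fin n)) [DecidableRel G.Adj] (adj : Fin n → List (Fin n))
        (T w : ℕ) (σ : ParGreedy.Scheduler),
        2 ≤ n → ParGreedy.IsAdjacency G adj → (n + G.edgeFinset.card + T) ^ K ≤ 2 ^ w →
        ∃ (s : (ℕ → Fin (2 ^ w)) → ℕ → ParGreedy.State)
          (ℓ : (ℕ → Fin (2 ^ w)) → ℕ → Fin n → ℕ)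
          (S : (ℕ → Fin (2 ^ w)) → ℕ → Finset (Fin n))
          (c : (ℕ → Fin (2 ^ w)) → ℕ → ℕ),
          (∀ᵐ ω ∂(ParGreedy.coins w),
            s ω 0 = ⟨ParGreedy.inputMem adj, 0, 0⟩ ∧
            ParGreedy.IsRun G T (ℓ ω) (S ω) (c ω) ∧
            (∀ t < T, ParGreedy.Exec σ ω prog (s ω t) (s ω (t + 1))) ∧
            (∀ t ≤ T, ParGreedy.Holds (s ω t).mem (ℓ ω t) (S ω t))) ∧
          (∀ t < T,
            ∫⁻ ω, (((s ω (t + 1)).work - (s ω t).work : ℕ) : ENNReal) ∂(ParGreedy.coins w)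
              ≤ ENNReal.ofReal (C * ((n : ℝ) + (G.edgeFinset.card : ℝ)))) ∧
          (∀ a : ℝ, 1 ≤ a → ∀ t < T,
            ParGreedy.coins w {ω | D a * ((c ω t : ℝ) * Real.log n) <
                (((s ω (t + 1)).depth - (s ω t).depth : ℕ) : ℝ)}
              ≤ ENNReal.ofReal (1 / (n : ℝ) ^ a))) := by
  -- the program uses no random words, so that its bounds hold for every outcome and scheduler
  refine ⟨⟨80, by norm_num, ParGreedy.approximation⟩, ParGreedy.program, 6, 600000,
    fun _ => 400000, ?_⟩
  intro n G _ adj T w σ hn hadj hw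
  choose s ℓ S c h0 hrun hex hholds hwork hdepth using
    fun ω => ParGreedy.exists_run (T := T) hn hadj hw σ ω
  refine ⟨s, ℓ, S, c, Filter.Eventually.of_forall fun ω => ⟨h0 ω, hrun ω, hex ω, hholds ω⟩,
    fun t ht => ?_, fun a _ t ht => ?_⟩
  · have hconst : ∫⁻ ω, (((s ω (t + 1)).work - (s ω t).work : ℕ) : ENNReal) ∂(ParGreedy.coins w) ≤
        ∫⁻ _, ((600000 * (n + G.edgeFinset.card) : ℕ) : ENNReal) ∂(ParGreedy.coins w) :=
      lintegral_mono fun ω => (Nat.cast_le (α := ENNReal)).2 (hwork ω t ht)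
    rw [lintegral_const, measure_univ, mul_one] at hconst
    refine hconst.trans_eq ?_
    rw [← ENNReal.ofReal_natCast]
    push_cast
    rfl
  · have hempty : {ω | 400000 * ((c ω t : ℝ) * Real.log n) <
        (((s ω (t + 1)).depth - (s ω t).depth : ℕ) : ℝ)} = ∅ :=
      Set.eq_empty_of_forall_notMem fun ω hω => absurd (hdepth ω t ht) (not_le.2 hω)
    rw [hempty, measure_empty]
    exact zero_le
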